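/- Lattice functions are functions of $(n,m)\in\mathbb Z^2$ with values in $\mathbb C$; write $\tilde f(n,m)=f(n+1,m)$ and $\hat f(n,m)=f(n,m+1)$. Let $p,q\in\mathbb C$ and let $$\Gamma=\mathrm{Diag}\bigl(k_1,\dots,k_{N_1},\,J_1,\dots,J_s\bigr)$$ be an $N\times N$ complex matrix, where $J_j$ is a lower triangular Jordan block of size $N_j'$ with eigenvalue $\kappa_j$ ($\kappa_j$ on the diagonal, $1$ on the subdiagonal). Let ${}^tc$ be a constant row vector of length $N$. Assume that $pI\pm\Gamma$ and $qI\pm\Gamma$ are invertible and that $k+k'\neq0$ for all eigenvalues $k,k'$ of $\Gamma$ (including $k=k'$). The *starting set* for a vector $r(n,m)$ and a matrix $M(n,m)$ is $$(pI-\Gamma)\tilde r=(pI+\Gamma)r,\qquad (qI-\Gamma)\hat r=(qI+\Gamma)r,\qquad M\Gamma+\Gamma M=r\,{}^tc .$$ Put $$S^{(i,j)}={}^tc\,\Gamma^j(I+M)^{-1}\Gamma^i r,\qquad S(a,b)={}^tc(bI+\Gamma)^{-1}(I+M)^{-1}(aI+\Gamma)^{-1}r,$$ $$V(a)=1-{}^tc(I+M)^{-1}(aI+\Gamma)^{-1}r,\qquad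 Z(a,b)={}^tc(bI+\Gamma)^{-2}(I+M)^{-1}(aI+\Gamma)^{-1}r .$$ **(I)** For every solution $(r,M)$ of the starting set the functions $u$ below solve the stated equations on every elementary square at whose four vertices $I+M$ is invertible. Whenever $a$ (or $b$) occurs as a parameter, $aI\pm\Gamma$ (and $bI\pm\Gamma$) are assumed invertible and $p^2,q^2\ne a^2$ (and $p^2,q^2\neq b^2$). All other constants are arbitrary complex numbers subject to the stated conditions. * **Q3**: $P(u\hat u+\tilde u\hat{\tilde u})-Q(u\tilde u+\hat u\hat{\tilde u})=(p^2-q^2)\bigl(\tilde u\hat u+u\hat{\tilde u}+\frac{\delta^2}{4PQ}\bigr)$ with $a,b\ne0$, $P^2=(p^2-a^2)(p^2-b^2)$, $Q^2=(q^2-a^2)(q^2-b^2)$: $u=A\,G(a,b)+B\,G(a,-b)+C\,G(-a,b)+D\,G(-a,-b)$, where $G(a,b)=\bigl(\tfrac{P}{(p-a)(p-b)}\bigr)^n\bigl(\tfrac{Q}{(q-a)(q-b)}\bigr)^m[1-(a+b)S(a,b)]$ and $AD(a+b)^2-BC(a-b)^2=-\frac{\delta^2}{16ab}$. For the next two equations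 let $\xi=2a\bigl(\frac{pn}{a^2-p^2}+\frac{qm}{a^2-q^2}\bigr)+\xi_0$, $\rho(a)=\bigl(\frac{p+a}{p-a}\bigr)^n\bigl(\frac{q+a}{q-a}\bigr)^m\rho_{00}$ with $\rho_{00}\ne0$, and $\rho(-a)=\rho(a)^{-1}$. * **Q2**: $(q^2-a^2)(u-\hat u)(\tilde u-\hat{\tilde u})-(p^2-a^2)(u-\tilde u)(\hat u-\hat{\tilde u})+(p^2-a^2)(q^2-a^2)(q^2-p^2)(u+\tilde u+\hat u+\hat{\tilde u})=(p^2-a^2)(q^2-a^2)(q^2-p^2)\bigl[(p^2-a^2)^2+(q^2-a^2)^2-(p^2-a^2)(q^2-a^2)\bigr]$ with $a\ne0$: $u=\frac{(p^2-a^2)^2(q^2-a^2)^2}{a^4}\Bigl[\tfrac14(\xi^2+1)+a\xi S(-a,a)+a^2\bigl(Z(a,-a)+Z(-a,a)\bigr)+AD+\tfrac A2\rho(a)\bigl(1-2aS(a,a)\bigr)+\tfrac D2\rho(-a)\bigl(1+2aS(-a,-a)\bigr)\Bigr]$. * **Q1, exponential background**: $(q^2-a^2)(u-\hat u)(\tilde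 u-\hat{\tilde u})-(p^2-a^2)(u-\tilde u)(\hat u-\hat{\tilde u})=\frac{\delta^2a^4(p^2-q^2)}{(p^2-a^2)(q^2-a^2)}$: $u=A\rho(a)(1-2aS(a,a))+D\rho(-a)(1+2aS(-a,-a))+B(\xi+2aS(-a,a))$ with $16AD+4B^2=\delta^2$. * **Q1, linear background** (Q1 with spacing parameters $1/p^2,1/q^2$): $q^2(u-\hat u)(\tilde u-\hat{\tilde u})-p^2(u-\tilde u)(\hat u-\hat{\tilde u})=\frac{\delta^2(p^2-q^2)}{p^2q^2}$ with $p,q\neq0$: $u=\delta\bigl(\nu^2-2\nu S^{(-1,-1)}+2S^{(-1,-2)}\bigr)+2A\bigl(\nu+c_0-S^{(-1,-1)}\bigr)$, $\nu=\frac np+\frac mq+\nu_0$. * **H3**: $P(a^2-q^2)(u\tilde u+\hat u\hat{\tilde u})-Q(a^2-p^2)(u\hat u+\tilde u\hat{\tilde u})=\delta(q^2-p^2)$ with $a\neq0$, $P^2=a^2-p^2$, $Q^2=a^2-q^2$: $u=(A+(-1)^{n+m}B)\vartheta V(a)+(D+(-1)^{n+m}C)\vartheta^{-1}V(-a)$,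 $\vartheta=\bigl(\frac{P}{a-p}\bigr)^n\bigl(\frac{Q}{a-q}\bigr)^m\vartheta_{00}$, $\vartheta_{00}\ne0$, $AD-BC=-\frac{\delta}{4a}$. * **H2**: $(u-\hat{\tilde u})(\tilde u-\hat u)+(p^2-q^2)(u+\tilde u+\hat u+\hat{\tilde u})=p^4-q^4$: $u=\tfrac14\zeta^2-\zeta S^{(0,0)}+2S^{(0,1)}-A^2+(-1)^{n+m}A(\zeta+c_0-2S^{(0,0)})$, $\zeta=2pn+2qm+\zeta_0$. * **H1**: $(u-\hat{\tilde u})(\hat u-\tilde u)=p^2-q^2$: $u=A(\zeta-S^{(0,0)})+(-1)^{n+m}B(\zeta+c_0-S^{(0,0)})$, $\zeta=pn+qm+\zeta_0$, $A^2-B^2=1$. **(II)** In particular this applies to the following explicit pairs, which solve the starting set. For constants $\rho^0$ let $\rho_k=\bigl(\frac{p+k}{p-k}\bigr)^n\bigl(\frac{q+k}{q-k}\bigr)^m\rho^0$, with one constant $\rho^0$ for each $k_i$ and one for each Jordan block. Let $r$ have the entries $\rho_{k_i}$ on the diagonal part and $\bigl(\rho_k,\frac{\partial_k\rho_k}{1!},\dots,\frac{\partial_k^{N_j'-1}\rho_k}{(N_j'-1)!}\bigr)\big|_{k=\kappa_j}$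 on the $j$-th Jordan block, and let $M=FGH$. Here $F=\mathrm{Diag}(\rho_{k_1},\dots,\rho_{k_{N_1}},F_1,\dots,F_s)$ with $F_j$ the lower triangular Toeplitz matrix whose first column is the $j$-th block of $r$; $H=\mathrm{Diag}(c_1,\dots,c_{N_1},H_1,\dots,H_s)$ with $H_j$ the Hankel matrix whose first row is the $j$-th block of ${}^tc$ and which vanishes below the anti-diagonal; and $G$ is the symmetric block matrix with entries $\frac1{k_i+k_l}$ in the diagonal part, $-\bigl(\frac{-1}{k_i+\kappa_j}\bigr)^{l}$ (row $i$, column $l\ge1$) between the diagonal part and block $j$, and $\binom{i+l-2}{i-1}\frac{(-1)^{i+l}}{(\kappa_j+\kappa_{j'})^{i+l-1}}$ ($i,l\geq1$) between blocks $j$ and $j'$. More generally, $(\mathcal A r,\mathcal A M)$ solves the starting set for every constant $\mathcal A=\mathrm{Diag}(I_{N_1},\mathcal A_1,\dots,\mathcal A_s)$ with lower triangular Toeplitz blocks $\mathcal A_j$ of size $N_j'$. -/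

import Mathlib

open Matrix
open scoped Nat

namespace CauchyABS

noncomputable section

/-! ### The starting matrix equation set and the scalar functions built from it

Functions on the lattice `ℤ × ℤ` are written `f n m`; the shifts are `f (n+1) m` and
`f n (m+1)`.  Column vectors and row vectors indexed by `ι` are functions `ι → ℂ`. -/

section General

variable {ι : Type} [Fintype ι] [DecidableEq ι]

/-- `s I + Γ` and `s I - Γ` are both invertible. -/
def InvertibleAt (Γ : Matrix ι ι ℂ) (s : ℂ) : Prop :=
  IsUnit (s • (1 : Matrix ι ι ℂ) + Γ) ∧ IsUnit (s • (1 : Matrix ι ι ℂ) - Γ)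

/-- The starting matrix equation set for the pair `(r, M)`, with constant `Γ` and constant row
vector `c`. -/
structure StartingSet (p q : ℂ) (Γ : Matrix ι ι ℂ) (c : ι → ℂ)
    (r : ℤ → ℤ → ι → ℂ) (M : ℤ → ℤ → Matrix ι ι ℂ) : Prop where
  shift_n : ∀ n m, (p • (1 : Matrix ι ι ℂ) - Γ) *ᵥ r (n + 1) m
    = (p • (1 : Matrix ι ι ℂ) + Γ) *ᵥ r n m
  shift_m : ∀ n m, (q • (1 : Matrix ι ι ℂ) - Γ) *ᵥ r n (m + 1)
    = (q • (1 : Matrix ι ι ℂ) + Γ) *ᵥ r n m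
  sylvester : ∀ n m, M n m * Γ + Γ * M n m = vecMulVec (r n m) c

variable (Γ : Matrix ι ι ℂ) (c : ι → ℂ) (r : ℤ → ℤ → ι → ℂ) (M : ℤ → ℤ → Matrix ι ι ℂ)

/-- `S^{(i,j)} = c Γ^j (I + M)⁻¹ Γ^i r`. -/
def Sij (i j : ℤ) (n m : ℤ) : ℂ :=
  c ⬝ᵥ (Γ ^ j * (1 + M n m)⁻¹ * Γ ^ i) *ᵥ r n m

/-- `S(a,b) = c (b I + Γ)⁻¹ (I + M)⁻¹ (a I + Γ)⁻¹ r`. -/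
def Sab (a b : ℂ) (n m : ℤ) : ℂ :=
  c ⬝ᵥ ((b • (1 : Matrix ι ι ℂ) + Γ)⁻¹ * (1 + M n m)⁻¹
    * (a • (1 : Matrix ι ι ℂ) + Γ)⁻¹) *ᵥ r n m

/-- `V(a) = 1 - c (I + M)⁻¹ (a I + Γ)⁻¹ r`. -/
def Va (a : ℂ) (n m : ℤ) : ℂ :=
  1 - c ⬝ᵥ ((1 + M n m)⁻¹ * (a • (1 : Matrix ι ι ℂ) + Γ)⁻¹) *ᵥ r n m

/-- `Z(a,b) = c (b I + Γ)⁻² (I + M)⁻¹ (a I + Γ)⁻¹ r`. -/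
def Zab (a b : ℂ) (n m : ℤ) : ℂ :=
  c ⬝ᵥ (((b • (1 : Matrix ι ι ℂ) + Γ)⁻¹) ^ 2 * (1 + M n m)⁻¹
    * (a • (1 : Matrix ι ι ℂ) + Γ)⁻¹) *ᵥ r n m

/-- The function `u` satisfies the quadrilateral equation `E (u, ũ, û, û̃)` on every elementary
square at whose four vertices `I + M` is invertible, that is, wherever `u` is defined. -/
def Solves (E : ℂ → ℂ → ℂ → ℂ → Prop) (u : ℤ → ℤ → ℂ) : Prop :=
  ∀ n m : ℤ, IsUnit (1 + M n m) → IsUnit (1 + M (n + 1) m) → IsUnit (1 + M n (m + 1)) →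
    IsUnit (1 + M (n + 1) (m + 1)) →
    E (u n m) (u (n + 1) m) (u n (m + 1)) (u (n + 1) (m + 1))

end General

/-! ### The re-parametrised lattice equations

The arguments `u ut uh uth` are the values at `(n,m)`, `(n+1,m)`, `(n,m+1)`, `(n+1,m+1)`. -/

def EqQ3 (p q P Q δ : ℂ) (u ut uh uth : ℂ) : Prop :=
  P * (u * uh + ut * uth) - Q * (u * ut + uh * uth)
    = (p ^ 2 - q ^ 2) * ((ut * uh + u * uth) + δ ^ 2 / (4 * P * Q))

def EqQ2 (p q a : ℂ) (u ut uh uth : ℂ) : Prop :=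
  (q ^ 2 - a ^ 2) * (u - uh) * (ut - uth) - (p ^ 2 - a ^ 2) * (u - ut) * (uh - uth)
      + (p ^ 2 - a ^ 2) * (q ^ 2 - a ^ 2) * (q ^ 2 - p ^ 2) * (u + ut + uh + uth)
    = (p ^ 2 - a ^ 2) * (q ^ 2 - a ^ 2) * (q ^ 2 - p ^ 2)
      * ((p ^ 2 - a ^ 2) ^ 2 + (q ^ 2 - a ^ 2) ^ 2 - (p ^ 2 - a ^ 2) * (q ^ 2 - a ^ 2))

/-- Q1 with spacing parameters `a² / (p² - a²)` and `a² / (q² - a²)`. -/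
def EqQ1 (p q a δ : ℂ) (u ut uh uth : ℂ) : Prop :=
  (q ^ 2 - a ^ 2) * (u - uh) * (ut - uth) - (p ^ 2 - a ^ 2) * (u - ut) * (uh - uth)
    = δ ^ 2 * a ^ 4 * (p ^ 2 - q ^ 2) / ((p ^ 2 - a ^ 2) * (q ^ 2 - a ^ 2))

/-- Q1 with spacing parameters `1 / p²` and `1 / q²`; this is `EqQ1 p q a (δ / a²)` in the limit
`a → 0`. -/
def EqQ1Lin (p q δ : ℂ) (u ut uh uth : ℂ) : Prop :=
  q ^ 2 * (u - uh) * (ut - uth) - p ^ 2 * (u - ut) * (uh - uth)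
    = δ ^ 2 * (p ^ 2 - q ^ 2) / (p ^ 2 * q ^ 2)

def EqH3 (p q a P Q δ : ℂ) (u ut uh uth : ℂ) : Prop :=
  P * (a ^ 2 - q ^ 2) * (u * ut + uh * uth) - Q * (a ^ 2 - p ^ 2) * (u * uh + ut * uth)
    = δ * (q ^ 2 - p ^ 2)

def EqH2 (p q : ℂ) (u ut uh uth : ℂ) : Prop :=
  (u - uth) * (ut - uh) + (p ^ 2 - q ^ 2) * (u + ut + uh + uth) = p ^ 4 - q ^ 4

def EqH1 (p q : ℂ) (u ut uh uth : ℂ) : Prop :=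
  (u - uth) * (uh - ut) = p ^ 2 - q ^ 2

/-! ### The solution formulae -/

/-- `ξ = 2a (p n / (a² - p²) + q m / (a² - q²)) + ξ₀`. -/
def xi (p q a ξ₀ : ℂ) (n m : ℤ) : ℂ :=
  2 * a * (p * n / (a ^ 2 - p ^ 2) + q * m / (a ^ 2 - q ^ 2)) + ξ₀

/-- The plain wave factor `((p+k)/(p-k))^n ((q+k)/(q-k))^m ρ₀`. -/
def rho (p q k ρ₀ : ℂ) (n m : ℤ) : ℂ :=
  ((p + k) / (p - k)) ^ n * ((q + k) / (q - k)) ^ m * ρ₀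

def gam (p q a : ℂ) : ℂ := a ^ 4 / ((p ^ 2 - a ^ 2) ^ 2 * (q ^ 2 - a ^ 2) ^ 2)

def nu (p q ν₀ : ℂ) (n m : ℤ) : ℂ := n / p + m / q + ν₀

def vartheta (p q a P Q ϑ₀ : ℂ) (n m : ℤ) : ℂ :=
  (P / (a - p)) ^ n * (Q / (a - q)) ^ m * ϑ₀

def zeta (p q ζ₀ : ℂ) (n m : ℤ) : ℂ := p * n + q * m + ζ₀

section Formulae

variable {ι : Type} [Fintype ι] [DecidableEq ι]
variable (Γ : Matrix ι ι ℂ) (c : ι → ℂ) (r : ℤ → ℤ → ι → ℂ) (M : ℤ → ℤ → Matrix ι ι ℂ)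

def Gab (p q P Q a b : ℂ) (n m : ℤ) : ℂ :=
  (P / ((p - a) * (p - b))) ^ n * (Q / ((q - a) * (q - b))) ^ m
    * (1 - (a + b) * Sab Γ c r M a b n m)

def uQ3 (p q P Q a b A B C D : ℂ) (n m : ℤ) : ℂ :=
  A * Gab Γ c r M p q P Q a b n m + B * Gab Γ c r M p q P Q a (-b) n m
    + C * Gab Γ c r M p q P Q (-a) b n m + D * Gab Γ c r M p q P Q (-a) (-b) n m

/-- Here `ρ(a) = rho p q a ρ₀` and `ρ(-a) = rho p q (-a) ρ₀⁻¹ = ρ(a)⁻¹`. -/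
def uQ2 (p q a ξ₀ ρ₀ A D : ℂ) (n m : ℤ) : ℂ :=
  (gam p q a)⁻¹ *
    ((1 / 4) * (xi p q a ξ₀ n m ^ 2 + 1) + a * xi p q a ξ₀ n m * Sab Γ c r M (-a) a n m
      + a ^ 2 * (Zab Γ c r M a (-a) n m + Zab Γ c r M (-a) a n m)
      + A * D
      + A / 2 * rho p q a ρ₀ n m * (1 - 2 * a * Sab Γ c r M a a n m)
      + D / 2 * rho p q (-a) ρ₀⁻¹ n m * (1 + 2 * a * Sab Γ c r M (-a) (-a) n m))

/-- Exponential background; `ρ(a) = rho p q a ρ₀` and `ρ(-a) = rho p q (-a) ρ₀⁻¹ = ρ(a)⁻¹`. -/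
def uQ1 (p q a ξ₀ ρ₀ A B D : ℂ) (n m : ℤ) : ℂ :=
  A * rho p q a ρ₀ n m * (1 - 2 * a * Sab Γ c r M a a n m)
    + D * rho p q (-a) ρ₀⁻¹ n m * (1 + 2 * a * Sab Γ c r M (-a) (-a) n m)
    + B * (xi p q a ξ₀ n m + 2 * a * Sab Γ c r M (-a) a n m)

/-- Linear background. -/
def uQ1Lin (p q δ ν₀ A c₀ : ℂ) (n m : ℤ) : ℂ :=
  δ * (nu p q ν₀ n m ^ 2 - 2 * nu p q ν₀ n m * Sij Γ c r M (-1) (-1) n m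
      + 2 * Sij Γ c r M (-1) (-2) n m)
    + 2 * A * (nu p q ν₀ n m + c₀ - Sij Γ c r M (-1) (-1) n m)

def uH3 (p q a P Q ϑ₀ A B C D : ℂ) (n m : ℤ) : ℂ :=
  (A + (-1) ^ (n + m) * B) * vartheta p q a P Q ϑ₀ n m * Va Γ c r M a n m
    + (D + (-1) ^ (n + m) * C) * (vartheta p q a P Q ϑ₀ n m)⁻¹ * Va Γ c r M (-a) n m

/-- In this formula the linear function is `2 p n + 2 q m + ζ₀`. -/
def uH2 (p q ζ₀ A c₀ : ℂ) (n m : ℤ) : ℂ :=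
  (1 / 4) * zeta (2 * p) (2 * q) ζ₀ n m ^ 2
    - zeta (2 * p) (2 * q) ζ₀ n m * Sij Γ c r M 0 0 n m
    + 2 * Sij Γ c r M 0 1 n m - A ^ 2
    + (-1) ^ (n + m) * A * (zeta (2 * p) (2 * q) ζ₀ n m + c₀ - 2 * Sij Γ c r M 0 0 n m)

def uH1 (p q ζ₀ A B c₀ : ℂ) (n m : ℤ) : ℂ :=
  A * (zeta p q ζ₀ n m - Sij Γ c r M 0 0 n m)
    + (-1) ^ (n + m) * B * (zeta p q ζ₀ n m + c₀ - Sij Γ c r M 0 0 n m)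

/-- All the solution formulae built from `(Γ, c, r, M)` solve the corresponding equations. -/
structure FormulaeValid (p q : ℂ) : Prop where
  Q3 : ∀ a b P Q δ A B C D : ℂ, InvertibleAt Γ a → InvertibleAt Γ b → a ≠ 0 → b ≠ 0 →
    p ^ 2 ≠ a ^ 2 → p ^ 2 ≠ b ^ 2 → q ^ 2 ≠ a ^ 2 → q ^ 2 ≠ b ^ 2 →
    P ^ 2 = (p ^ 2 - a ^ 2) * (p ^ 2 - b ^ 2) → Q ^ 2 = (q ^ 2 - a ^ 2) * (q ^ 2 - b ^ 2) →
    A * D * (a + b) ^ 2 - B * C * (a - b) ^ 2 = -(δ ^ 2 / (16 * a * b)) →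
    Solves M (EqQ3 p q P Q δ) (uQ3 Γ c r M p q P Q a b A B C D)
  Q2 : ∀ a ξ₀ ρ₀ A D : ℂ, InvertibleAt Γ a → a ≠ 0 → p ^ 2 ≠ a ^ 2 → q ^ 2 ≠ a ^ 2 → ρ₀ ≠ 0 →
    Solves M (EqQ2 p q a) (uQ2 Γ c r M p q a ξ₀ ρ₀ A D)
  Q1_exponential : ∀ a δ ξ₀ ρ₀ A B D : ℂ, InvertibleAt Γ a → p ^ 2 ≠ a ^ 2 → q ^ 2 ≠ a ^ 2 →
    ρ₀ ≠ 0 → 16 * A * D + 4 * B ^ 2 = δ ^ 2 →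
    Solves M (EqQ1 p q a δ) (uQ1 Γ c r M p q a ξ₀ ρ₀ A B D)
  Q1_linear : ∀ δ ν₀ A c₀ : ℂ, p ≠ 0 → q ≠ 0 →
    Solves M (EqQ1Lin p q δ) (uQ1Lin Γ c r M p q δ ν₀ A c₀)
  H3 : ∀ a P Q δ ϑ₀ A B C D : ℂ, InvertibleAt Γ a → a ≠ 0 → p ^ 2 ≠ a ^ 2 → q ^ 2 ≠ a ^ 2 →
    P ^ 2 = a ^ 2 - p ^ 2 → Q ^ 2 = a ^ 2 - q ^ 2 → ϑ₀ ≠ 0 →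
    A * D - B * C = -δ / (4 * a) →
    Solves M (EqH3 p q a P Q δ) (uH3 Γ c r M p q a P Q ϑ₀ A B C D)
  H2 : ∀ ζ₀ A c₀ : ℂ, Solves M (EqH2 p q) (uH2 Γ c r M p q ζ₀ A c₀)
  H1 : ∀ ζ₀ A B c₀ : ℂ, A ^ 2 - B ^ 2 = 1 → Solves M (EqH1 p q) (uH1 Γ c r M p q ζ₀ A B c₀)

end Formulae

/-! ### The generic canonical matrix and the explicit solutions of the starting set

The index type is `Fin N₁ ⊕ Σ j : Fin s, Fin (N j)`: a diagonal part of size `N₁` followed by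
`s` Jordan blocks of sizes `N j`. -/

/-- The lower triangular Toeplitz matrix with first column `(α 0, α 1, …)`. -/
def toeplitz (d : ℕ) (α : ℕ → ℂ) : Matrix (Fin d) (Fin d) ℂ :=
  Matrix.of fun i l => if l ≤ i then α ((i : ℕ) - (l : ℕ)) else 0

/-- The lower triangular Jordan block with eigenvalue `k`. -/
def jordan (d : ℕ) (k : ℂ) : Matrix (Fin d) (Fin d) ℂ :=
  Matrix.of fun i l => if i = l then k else if (i : ℕ) = (l : ℕ) + 1 then 1 else 0

/-- The Hankel matrix with first row `c` and zeros below the anti-diagonal. -/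
def hankel (d : ℕ) (c : Fin d → ℂ) : Matrix (Fin d) (Fin d) ℂ :=
  Matrix.of fun i l => if h : (i : ℕ) + (l : ℕ) < d then c ⟨(i : ℕ) + (l : ℕ), h⟩ else 0

/-- The Taylor coefficient `∂_k^l ρ / l!` of the plain wave factor. -/
def rhoTaylor (p q k ρ₀ : ℂ) (n m : ℤ) (l : ℕ) : ℂ :=
  iteratedDeriv l (fun κ => rho p q κ ρ₀ n m) k / (l ! : ℂ)

section Canonical

variable {N₁ s : ℕ} {N : Fin s → ℕ}

abbrev Idx (N₁ : ℕ) {s : ℕ} (N : Fin s → ℕ) : Type := Fin N₁ ⊕ (Σ j : Fin s, Fin (N j))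

/-- `Γ = Diag(Γ_D({kD i}), Γ_J(kJ 1), …, Γ_J(kJ s))`. -/
def canonicalMatrix (kD : Fin N₁ → ℂ) (kJ : Fin s → ℂ) :
    Matrix (Idx N₁ N) (Idx N₁ N) ℂ :=
  fromBlocks (diagonal kD) 0 0 (blockDiagonal' fun j => jordan (N j) (kJ j))

/-- The explicit vector of plain wave factors and their derivatives. -/
def explicitR (p q : ℂ) (kD ρD : Fin N₁ → ℂ) (kJ ρJ : Fin s → ℂ) (n m : ℤ) : Idx N₁ N → ℂ :=
  Sum.elim (fun i => rho p q (kD i) (ρD i) n m)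
    (fun x => rhoTaylor p q (kJ x.1) (ρJ x.1) n m x.2)

def matF (p q : ℂ) (kD ρD : Fin N₁ → ℂ) (kJ ρJ : Fin s → ℂ) (n m : ℤ) :
    Matrix (Idx N₁ N) (Idx N₁ N) ℂ :=
  fromBlocks (diagonal fun i => rho p q (kD i) (ρD i) n m) 0 0
    (blockDiagonal' fun j => toeplitz (N j) (rhoTaylor p q (kJ j) (ρJ j) n m))

def matH (c : Idx N₁ N → ℂ) : Matrix (Idx N₁ N) (Idx N₁ N) ℂ :=
  fromBlocks (diagonal fun i => c (Sum.inl i)) 0 0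
    (blockDiagonal' fun j => hankel (N j) fun l => c (Sum.inr ⟨j, l⟩))

/-- The block of `G` between the diagonal part and the Jordan blocks (zero-based columns). -/
def matGDJ (kD : Fin N₁ → ℂ) (kJ : Fin s → ℂ) :
    Matrix (Fin N₁) (Σ j : Fin s, Fin (N j)) ℂ :=
  Matrix.of fun i y => -(-1 / (kD i + kJ y.1)) ^ ((y.2 : ℕ) + 1)

/-- The blocks of `G` between Jordan blocks (zero-based rows and columns). -/
def matGJJ (kJ : Fin s → ℂ) :
    Matrix (Σ j : Fin s, Fin (N j)) (Σ j : Fin s, Fin (N j)) ℂ :=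
  Matrix.of fun x y => (Nat.choose ((x.2 : ℕ) + (y.2 : ℕ)) (x.2 : ℕ) : ℂ)
    * ((-1) ^ ((x.2 : ℕ) + (y.2 : ℕ)) / (kJ x.1 + kJ y.1) ^ ((x.2 : ℕ) + (y.2 : ℕ) + 1))

def matG (kD : Fin N₁ → ℂ) (kJ : Fin s → ℂ) : Matrix (Idx N₁ N) (Idx N₁ N) ℂ :=
  fromBlocks (Matrix.of fun i l => 1 / (kD i + kD l)) (matGDJ kD kJ) (matGDJ kD kJ)ᵀ (matGJJ kJ)

/-- `M = F G H`. -/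
def explicitM (p q : ℂ) (kD ρD : Fin N₁ → ℂ) (kJ ρJ : Fin s → ℂ) (c : Idx N₁ N → ℂ)
    (n m : ℤ) : Matrix (Idx N₁ N) (Idx N₁ N) ℂ :=
  matF p q kD ρD kJ ρJ n m * matG kD kJ * matH c

/-- `Diag(I, 𝒜₁, …, 𝒜ₛ)` with lower triangular Toeplitz blocks `𝒜ⱼ`. -/
def matA (α : Fin s → ℕ → ℂ) : Matrix (Idx N₁ N) (Idx N₁ N) ℂ :=
  fromBlocks 1 0 0 (blockDiagonal' fun j => toeplitz (N j) (α j))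

end Canonical

end

end CauchyABS

namespace CauchyABS

/-! ### Scalar relations on the edges of the lattice -/

/-! All the scalar functions are values of one bracket `c Y (I + M)⁻¹ X r`, with `X` and `Y`
functions of `Γ`. Two properties of it carry the proof. First, the condition `k + k' ≠ 0` makes the
Sylvester equation uniquely solvable, so the shift of `r` forces `(p - Γ) M̃ = (p + Γ) M`; because
the right-hand side `r c` has rank one, a lattice shift changes the bracket by a product of two
brackets (`br_shift`). Second, the bracket is symmetric in `X` and `Y` (`br_symm`): uniqueness lets
every `M` be factored as `F G H`, with `F` commuting with `Γ`, `G` symmetric, and `H` symmetric with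
`H Γ = Γᵀ H`. Taking `X` and `Y` among `1`, `Γ`, the resolvents and their squares gives the
relations in `EdgeRel`; after that no matrix is needed, only algebra on one elementary square.

On a square, eliminating `T` leaves a linear problem for `V(a)` whose coefficients are `f = p - q +
Ŝ - S̃` and `g = p + q + S - S'`, where `S = S^{(0,0)}` and `S'` is its value at the far corner;
moreover `f g = p² - q²` (`potential`). Symmetry of `S(a,-a)` gives Wronskians of `V(a)` and
`V(-a)`: a multiple of `f` for the two middle vertices, a multiple of `g` for the two extreme ones.

For Q1 and Q3 the edge differences of `u` (weighted by `P` and `p² - b²` in Q3) are values of a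
bilinear form on two-component wave vectors. The determinant identity `bilin_det` turns the
quadrilateral expression into the determinant of the form times two Wronskians, hence times `f g`;
where the free constants are constrained, the constraint fixes this determinant. For H1, H2 and H3
the factors `f` and `g` appear more directly. Q2 also needs the wave function differentiated in the
spectral parameter, `psi`; the determinant is then no longer constant but affine in the sum of the
two middle values of `u` (`Q2_det`).

For the explicit pairs, Taylor coefficients turn multiplication by `κ` into a Jordan block, which
gives the shifts of `r`. With the cyclic vector `e` one has `r = F e`, `c = e H` and `Γ G + G Γᵀ = e
eᵀ`, so `F G H` solves the Sylvester equation. -/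

/-- The scalar quantities attached to a lattice vertex: `S0 = S^{(0,0)}`, `T0 = S^{(0,1)}`,
`S a b = S(a,b)`, `Z = -∂_b S`, `X = ∂_a ∂_b S`, `V a = V(a)`, `Y = V'`,
`T a = c Γ (I + M)⁻¹ (a I + Γ)⁻¹ r` and `T2 = -T'`. -/
structure Vertex where
  S0 : ℂ
  T0 : ℂ
  S : ℂ → ℂ → ℂ
  Z : ℂ → ℂ → ℂ
  X : ℂ → ℂ → ℂ
  V : ℂ → ℂ
  Y : ℂ → ℂ
  T : ℂ → ℂ
  T2 : ℂ → ℂ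

/-- The relations between the scalar quantities at the two ends of a lattice edge with lattice
parameter `p`, for admissible parameters `a` and `b`. -/
structure EdgeRel (Adm : ℂ → Prop) (p : ℂ) (v v' : Vertex) : Prop where
  pot : p * (v'.S0 - v.S0) + v.S0 * v'.S0 = v.T0 + v'.T0
  fwd : ∀ a, Adm a → v.T a = a - (p + a) * v'.V a + (p - v'.S0) * v.V a
  bwd : ∀ a, Adm a → v'.T a = a + (p - a) * v.V a - (p + v.S0) * v'.V a
  dfwd : ∀ a, Adm a → -v.T2 a = 1 - v'.V a - (p + a) * v'.Y a + (p - v'.S0) * v.Y a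
  dbwd : ∀ a, Adm a → -v'.T2 a = 1 - v.V a + (p - a) * v.Y a - (p + v.S0) * v'.Y a
  S_rel : ∀ a b, Adm a → Adm b →
    1 - (p + b) * v'.S a b + (p - a) * v.S a b = v'.V a * v.V b
  Z_rel : ∀ a b, Adm a → Adm b →
    (p + b) * v'.Z a b - v'.S a b = (p - a) * v.Z a b + v'.V a * v.Y b
  Z_rel' : ∀ a b, Adm a → Adm b →
    (p + a) * v'.Z a b = (p - b) * v.Z a b + v.S a b + v'.Y b * v.V a
  X_rel : ∀ a b, Adm a → Adm b →
    (p + b) * v'.X a b - v'.Z b a = (p - a) * v.X a b + v.Z a b - v'.Y a * v.Y b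
  S_symm : ∀ a b, Adm a → Adm b → v.S a b = v.S b a
  S_symm' : ∀ a b, Adm a → Adm b → v'.S a b = v'.S b a
  X_symm : ∀ a b, Adm a → Adm b → v.X a b = v.X b a
  X_symm' : ∀ a b, Adm a → Adm b → v'.X a b = v'.X b a

namespace EdgeRel

variable {Adm : ℂ → Prop} {p : ℂ} {v v' : Vertex}

/-- Since `S(a,-a) = S(-a,a)`, the relations `S_rel a (-a)` and `S_rel (-a) a` contain the same
increment of `S`, with factors `p - a` and `p + a`; eliminating it leaves a constant. -/
lemma wronskian (h : EdgeRel Adm p v v') {a : ℂ} (ha : Adm a) (hna : Adm (-a)) :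
    (p + a) * v'.V a * v.V (-a) - (p - a) * v'.V (-a) * v.V a = 2 * a := by
  have h1 := h.S_rel a (-a) ha hna
  have h2 := h.S_rel (-a) a hna ha
  rw [h.S_symm (-a) a hna ha, h.S_symm' (-a) a hna ha] at h2
  linear_combination (p - a) * h2 - (p + a) * h1

/-- At `b = a` the relations `Z_rel` and `Z_rel'` have identical `Z` terms, so their difference
expresses the increment of `S(a,a)` as a Wronskian of `V` and its derivative. -/
lemma S_diff (h : EdgeRel Adm p v v') {a : ℂ} (ha : Adm a) :
    v'.S a a - v.S a a = v'.Y a * v.V a - v'.V a * v.Y a := by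
  linear_combination h.Z_rel' a a ha ha - h.Z_rel a a ha ha

lemma one_sub_S (h : EdgeRel Adm p v v') {a : ℂ} (ha : Adm a) :
    1 - 2 * a * v'.S a a = v'.V a * v.V a + (p - a) * (v'.Y a * v.V a - v'.V a * v.Y a) := by
  linear_combination h.S_rel a a ha ha + (p - a) * h.S_diff ha

/-- `S(a,-a)` in terms of the `V` and `Y` along an edge. -/
lemma S_neg (h : EdgeRel Adm p v v') {a : ℂ} (ha : Adm a) (hna : Adm (-a)) :
    -1 - 2 * a * v'.S a (-a) = - v'.V a * v.V (-a) + (p + a) * v'.V a * v.Y (-a)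
      - (p - a) * v'.Y (-a) * v.V a := by
  linear_combination -h.S_rel a (-a) ha hna + (p + a) * h.Z_rel a (-a) ha hna
    - (p - a) * h.Z_rel' a (-a) ha hna

lemma S_neg' (h : EdgeRel Adm p v v') {a : ℂ} (ha : Adm a) (hna : Adm (-a)) :
    1 - 2 * a * v'.S a (-a) = (p + a) * v'.Y a * v.V (-a) + v'.V (-a) * v.V a
      - (p - a) * v'.V (-a) * v.Y a := by
  have h1 := h.Z_rel (-a) a hna ha
  have h2 := h.Z_rel' (-a) a hna ha
  have h3 := h.S_rel (-a) a hna ha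
  rw [h.S_symm' (-a) a hna ha] at h1 h3
  rw [h.S_symm (-a) a hna ha] at h2 h3
  linear_combination h3 + (p + a) * h2 - (p - a) * h1

/-- `Z(a,-a) + Z(-a,a)` in terms of the `V` and `Y` along an edge. -/
lemma Z_neg (h : EdgeRel Adm p v v') {a : ℂ} (ha : Adm a) (hna : Adm (-a)) :
    2 * a * (v'.Z a (-a) + v'.Z (-a) a) = - v'.Y a * v.V (-a) + (p + a) * v'.Y a * v.Y (-a)
      + v'.Y (-a) * v.V a - (p - a) * v'.Y (-a) * v.Y a := by
  -- Symmetry of `X` makes the two `X_rel` relations share one increment of `X`, which is eliminated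
  -- as in `wronskian`; the values of `Z` at the first vertex are then removed with `Z_rel'`.
  have h1 := h.X_rel a (-a) ha hna
  have h2 := h.X_rel (-a) a hna ha
  rw [h.X_symm (-a) a hna ha, h.X_symm' (-a) a hna ha] at h2
  have h3 := h.Z_rel' a (-a) ha hna
  have h4 := h.Z_rel' (-a) a hna ha
  rw [h.S_symm (-a) a hna ha] at h4
  linear_combination (p - a) * h2 - (p + a) * h1 + h3 - h4

end EdgeRel

/-- The relations on the four edges of an elementary square. -/
structure SquareRel (Adm : ℂ → Prop) (p q : ℂ) (v v₁ v₂ v₁₂ : Vertex) : Prop where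
  e₁ : EdgeRel Adm p v v₁
  e₂ : EdgeRel Adm q v v₂
  e₁₂ : EdgeRel Adm q v₁ v₁₂
  e₂₁ : EdgeRel Adm p v₂ v₁₂

namespace SquareRel

variable {Adm : ℂ → Prop} {p q : ℂ} {v v₁ v₂ v₁₂ : Vertex}

lemma swap (h : SquareRel Adm p q v v₁ v₂ v₁₂) : SquareRel Adm q p v v₂ v₁ v₁₂ :=
  ⟨h.e₂, h.e₁, h.e₂₁, h.e₁₂⟩

/-- The alternating sum of `pot` around the square cancels every `T0`. This product `f g` is the
only nonlinear relation between the corners' `S0`, and it supplies the factor `p² - q²` in each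
equation. -/
lemma potential (h : SquareRel Adm p q v v₁ v₂ v₁₂) :
    (p - q + v₂.S0 - v₁.S0) * (p + q + v.S0 - v₁₂.S0) = p ^ 2 - q ^ 2 := by
  linear_combination h.e₂.pot - h.e₁.pot + h.e₁₂.pot - h.e₂₁.pot

/-- `V_zero`, `V_both` and `V_one` are the linear problem of the lattice. Each compares two
expressions for `T` at one vertex: at `v` from its outgoing edges, at `v₁₂` from its incoming edges,
and at `v₁` from the edge entering and the edge leaving. -/
lemma V_zero (h : SquareRel Adm p q v v₁ v₂ v₁₂) {a : ℂ} (ha : Adm a) :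
    (p - q + v₂.S0 - v₁.S0) * v.V a = (p + a) * v₁.V a - (q + a) * v₂.V a := by
  linear_combination h.e₂.fwd a ha - h.e₁.fwd a ha

lemma V_both (h : SquareRel Adm p q v v₁ v₂ v₁₂) {a : ℂ} (ha : Adm a) :
    (p - q + v₂.S0 - v₁.S0) * v₁₂.V a = (p - a) * v₂.V a - (q - a) * v₁.V a := by
  linear_combination h.e₂₁.bwd a ha - h.e₁₂.bwd a ha

lemma V_one (h : SquareRel Adm p q v v₁ v₂ v₁₂) {a : ℂ} (ha : Adm a) :
    (p + q + v.S0 - v₁₂.S0) * v₁.V a = (p - a) * v.V a + (q + a) * v₁₂.V a := by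
  linear_combination h.e₁.bwd a ha - h.e₁₂.fwd a ha

lemma Y_zero (h : SquareRel Adm p q v v₁ v₂ v₁₂) {a : ℂ} (ha : Adm a) :
    (p - q + v₂.S0 - v₁.S0) * v.Y a
      = (p + a) * v₁.Y a + v₁.V a - (q + a) * v₂.Y a - v₂.V a := by
  linear_combination h.e₂.dfwd a ha - h.e₁.dfwd a ha

lemma Y_one (h : SquareRel Adm p q v v₁ v₂ v₁₂) {a : ℂ} (ha : Adm a) :
    (p + q + v.S0 - v₁₂.S0) * v₁.Y a
      = (p - a) * v.Y a - v.V a + (q + a) * v₁₂.Y a + v₁₂.V a := by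
  linear_combination h.e₁.dbwd a ha - h.e₁₂.dfwd a ha

/-- The edge Wronskian is transported across the square: it is multiplied by the coefficient of the
linear problem, and `V` at the unwanted vertex is replaced by the linear relation. -/
lemma wronskian_one_two (h : SquareRel Adm p q v v₁ v₂ v₁₂) {a : ℂ} (ha : Adm a)
    (hna : Adm (-a)) :
    (p - a) * (q + a) * v₁.V (-a) * v₂.V a - (p + a) * (q - a) * v₁.V a * v₂.V (-a)
      = 2 * a * (p - q + v₂.S0 - v₁.S0) := by
  linear_combination (p - q + v₂.S0 - v₁.S0) * h.e₁.wronskian ha hna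
    - (p + a) * v₁.V a * h.V_zero hna + (p - a) * v₁.V (-a) * h.V_zero ha

lemma wronskian_zero_both (h : SquareRel Adm p q v v₁ v₂ v₁₂) {a : ℂ} (ha : Adm a)
    (hna : Adm (-a)) :
    (p + a) * (q + a) * v.V (-a) * v₁₂.V a - (p - a) * (q - a) * v.V a * v₁₂.V (-a)
      = 2 * a * (p + q + v.S0 - v₁₂.S0) := by
  linear_combination (p + q + v.S0 - v₁₂.S0) * h.e₁.wronskian ha hna
    - (p + a) * v.V (-a) * h.V_one ha + (p - a) * v.V a * h.V_one hna

end SquareRel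


/-! ### The equations H1, H2 and H3 -/

namespace SquareRel

variable {Adm : ℂ → Prop} {p q : ℂ} {v v₁ v₂ v₁₂ : Vertex}

/-- The sign `σ` agrees on each diagonal of the square, so `c₀` drops out of both diagonal
differences. These are multiples of `g` and `f` by `-(A + σB)` and `-(A - σB)`, and the product of
the multipliers is `A² - B²`. -/
lemma eqH1 (h : SquareRel Adm p q v v₁ v₂ v₁₂) (ζ c₀ A B σ : ℂ) (hσ : σ ^ 2 = 1)
    (hAB : A ^ 2 - B ^ 2 = 1) :
    EqH1 p q (A * (ζ - v.S0) + σ * B * (ζ + c₀ - v.S0))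
      (A * (ζ + p - v₁.S0) + -σ * B * (ζ + p + c₀ - v₁.S0))
      (A * (ζ + q - v₂.S0) + -σ * B * (ζ + q + c₀ - v₂.S0))
      (A * (ζ + p + q - v₁₂.S0) + σ * B * (ζ + p + q + c₀ - v₁₂.S0)) := by
  unfold EqH1
  linear_combination (A ^ 2 - σ ^ 2 * B ^ 2) * h.potential + (p ^ 2 - q ^ 2) * hAB
    - B ^ 2 * (p ^ 2 - q ^ 2) * hσ

/-- H2 is reached from H1 by a Miura-type relation: if the edge sums of `u` are `2 K K̃` plus the
squared lattice parameter, and the diagonal differences of `K` multiply to `p² - q²`, then `u`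
solves H2 (this is `key`). Here `K = ζ/2 - S0 - σA`, and the edge sums are `pot`. -/
lemma eqH2 (h : SquareRel Adm p q v v₁ v₂ v₁₂) (ζ c₀ A σ : ℂ) (hσ : σ ^ 2 = 1) :
    EqH2 p q
      (1 / 4 * ζ ^ 2 - ζ * v.S0 + 2 * v.T0 - A ^ 2 + σ * A * (ζ + c₀ - 2 * v.S0))
      (1 / 4 * (ζ + 2 * p) ^ 2 - (ζ + 2 * p) * v₁.S0 + 2 * v₁.T0 - A ^ 2
        + -σ * A * (ζ + 2 * p + c₀ - 2 * v₁.S0))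
      (1 / 4 * (ζ + 2 * q) ^ 2 - (ζ + 2 * q) * v₂.S0 + 2 * v₂.T0 - A ^ 2
        + -σ * A * (ζ + 2 * q + c₀ - 2 * v₂.S0))
      (1 / 4 * (ζ + 2 * p + 2 * q) ^ 2 - (ζ + 2 * p + 2 * q) * v₁₂.S0 + 2 * v₁₂.T0 - A ^ 2
        + σ * A * (ζ + 2 * p + 2 * q + c₀ - 2 * v₁₂.S0)) := by
  have hpot := h.potential
  have key : ∀ u u₁ u₂ u₁₂ K K₁ K₂ K₁₂ : ℂ,
      u + u₁ = 2 * K * K₁ + p ^ 2 → u + u₂ = 2 * K * K₂ + q ^ 2 →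
      u₁ + u₁₂ = 2 * K₁ * K₁₂ + q ^ 2 → u₂ + u₁₂ = 2 * K₂ * K₁₂ + p ^ 2 →
      (K₁ - K₂) * (K₁₂ - K) = p ^ 2 - q ^ 2 → EqH2 p q u u₁ u₂ u₁₂ := by
    intro u u₁ u₂ u₁₂ K K₁ K₂ K₁₂ h₁ h₂ h₃ h₄ hK
    have e1 : u₁ - u₂ = 2 * K * (K₁ - K₂) + (p ^ 2 - q ^ 2) := by linear_combination h₁ - h₂
    have e2 : u - u₁₂ = -2 * K₁ * (K₁₂ - K) + (p ^ 2 - q ^ 2) := by linear_combination h₁ - h₃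
    have e3 : u + u₁ + u₂ + u₁₂ = (K₁ + K₂) * (K + K₁₂) + p ^ 2 + q ^ 2 := by
      linear_combination (h₁ + h₂ + h₃ + h₄) / 2
    unfold EqH2
    rw [e1, e2, e3, ← hK]
    linear_combination (p ^ 2 + q ^ 2) * hK
  apply key _ _ _ _ (ζ / 2 - v.S0 - σ * A) (ζ / 2 + p - v₁.S0 + σ * A)
    (ζ / 2 + q - v₂.S0 + σ * A) (ζ / 2 + p + q - v₁₂.S0 - σ * A)
  · linear_combination 2 * A ^ 2 * hσ - 2 * h.e₁.pot
  · linear_combination 2 * A ^ 2 * hσ - 2 * h.e₂.pot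
  · linear_combination 2 * A ^ 2 * hσ - 2 * h.e₁₂.pot
  · linear_combination 2 * A ^ 2 * hσ - 2 * h.e₂₁.pot
  · linear_combination hpot

/-- The left side is `PQ (u (Q u₁ - P u₂) + u₁₂ (Q u₂ - P u₁))`. By the linear problem the inner
combinations are `f` times data at `v₁₂` and at `v` respectively; what remains is the Wronskian of
these two vertices, which contributes `g`. -/
lemma eqH3 (h : SquareRel Adm p q v v₁ v₂ v₁₂) {a : ℂ} (ha : Adm a) (hna : Adm (-a))
    (a0 : a ≠ 0) {P Q : ℂ} (hpa : p ^ 2 ≠ a ^ 2) (hqa : q ^ 2 ≠ a ^ 2)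
    (hP : P ^ 2 = a ^ 2 - p ^ 2) (hQ : Q ^ 2 = a ^ 2 - q ^ 2) {θ θ' A B C D δ σ : ℂ}
    (hθ : θ * θ' = 1) (hσ : σ ^ 2 = 1) (hAD : A * D - B * C = -δ / (4 * a)) :
    EqH3 p q a P Q δ
      ((A + σ * B) * θ * v.V a + (D + σ * C) * θ' * v.V (-a))
      ((A + -σ * B) * (P / (a - p) * θ) * v₁.V a + (D + -σ * C) * (P / (a + p) * θ') * v₁.V (-a))
      ((A + -σ * B) * (Q / (a - q) * θ) * v₂.V a + (D + -σ * C) * (Q / (a + q) * θ') * v₂.V (-a))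
      ((A + σ * B) * (P / (a - p) * (Q / (a - q)) * θ) * v₁₂.V a
        + (D + σ * C) * (P / (a + p) * (Q / (a + q)) * θ') * v₁₂.V (-a)) := by
  have h1 : a - p ≠ 0 := fun h0 => hpa (by linear_combination -(a + p) * h0)
  have h2 : a + p ≠ 0 := fun h0 => hpa (by linear_combination -(a - p) * h0)
  have h3 : a - q ≠ 0 := fun h0 => hqa (by linear_combination -(a + q) * h0)
  have h4 : a + q ≠ 0 := fun h0 => hqa (by linear_combination -(a - q) * h0)
  have hδ : δ = -4 * a * (A * D - B * C) := by rw [hAD]; field_simp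
  have hL1 := h.V_zero ha
  have hL1' := h.V_zero hna
  have hL2 := h.V_both ha
  have hL2' := h.V_both hna
  have hG := h.wronskian_zero_both ha hna
  have hpot := h.potential
  set f := p - q + v₂.S0 - v₁.S0
  set g := p + q + v.S0 - v₁₂.S0
  set A₁ := A + σ * B with hA₁
  set A₂ := A + -σ * B with hA₂
  set D₁ := D + σ * C with hD₁
  set D₂ := D + -σ * C with hD₂
  have hsum : A₁ * D₂ + D₁ * A₂ = 2 * (A * D - B * C) := by
    rw [hA₁, hA₂, hD₁, hD₂]; linear_combination -2 * B * C * hσ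
  clear_value A₁ A₂ D₁ D₂ f g
  set x := v.V a
  set x' := v.V (-a)
  set y := v₁.V a
  set y' := v₁.V (-a)
  set z := v₂.V a
  set z' := v₂.V (-a)
  set w := v₁₂.V a
  set w' := v₁₂.V (-a)
  clear_value x x' y y' z z' w w'
  set u₁ := A₂ * (P / (a - p) * θ) * y + D₂ * (P / (a + p) * θ') * y' with hu₁
  set u₂ := A₂ * (Q / (a - q) * θ) * z + D₂ * (Q / (a + q) * θ') * z' with hu₂
  have e1 : Q * u₁ - P * u₂ = P * Q * f * (A₂ * θ * w / (a - p) / (a - q)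
      - D₂ * θ' * w' / (a + p) / (a + q)) := by
    rw [hu₁, hu₂]
    field_simp
    linear_combination -P * Q * A₂ * θ * (a + p) * (a + q) * hL2
      + P * Q * D₂ * θ' * (a - p) * (a - q) * hL2'
  have e2 : Q * u₂ - P * u₁ = f * (-A₂ * θ * x + D₂ * θ' * x') := by
    have hp1 : P * (P / (a - p)) = a + p := by field_simp; linear_combination hP
    have hp2 : P * (P / (a + p)) = a - p := by field_simp; linear_combination hP
    have hq1 : Q * (Q / (a - q)) = a + q := by field_simp; linear_combination hQ
    have hq2 : Q * (Q / (a + q)) = a - q := by field_simp; linear_combination hQ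
    rw [hu₁, hu₂]
    linear_combination A₂ * θ * z * hq1 + D₂ * θ' * z' * hq2 - A₂ * θ * y * hp1
      - D₂ * θ' * y' * hp2 + A₂ * θ * hL1 - D₂ * θ' * hL1'
  clear_value u₁ u₂
  unfold EqH3
  rw [hδ, ← hP, ← hQ]
  have hPQ : P ^ 2 * Q ^ 2 = (a - p) * (a - q) * (a + p) * (a + q) := by rw [hP, hQ]; ring
  have e4 : x' * w / (a - p) / (a - q) - x * w' / (a + p) / (a + q)
      = 2 * a * g / (P ^ 2 * Q ^ 2) := by
    rw [hPQ]; field_simp; linear_combination hG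
  have P0 : P ^ 2 * Q ^ 2 ≠ 0 := by rw [hPQ]; simp [h1, h2, h3, h4]
  rw [eq_div_iff P0] at e4
  linear_combination P * Q * (A₁ * θ * x + D₁ * θ' * x') * e1
    + P * Q * (A₁ * (P / (a - p) * (Q / (a - q)) * θ) * w
        + D₁ * (P / (a + p) * (Q / (a + q)) * θ') * w') * e2
    + f * (θ * θ') * (A₁ * D₂ + D₁ * A₂) * e4
    + 2 * a * g * f * (A₁ * D₂ + D₁ * A₂) * hθ + 2 * a * f * g * hsum
    + 4 * a * (A * D - B * C) * hpot

end SquareRel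


/-! ### Q1 and Q3 -/

/-- The two-by-two determinant identity behind the equations of type Q. -/
lemma bilin_det (α β γ δ x₁ x₂ y₁ y₂ z₁ z₂ w₁ w₂ : ℂ) :
    (α * x₁ * y₁ + β * x₁ * y₂ + γ * x₂ * y₁ + δ * x₂ * y₂)
        * (α * z₁ * w₁ + β * z₁ * w₂ + γ * z₂ * w₁ + δ * z₂ * w₂)
      - (α * x₁ * w₁ + β * x₁ * w₂ + γ * x₂ * w₁ + δ * x₂ * w₂)
        * (α * z₁ * y₁ + β * z₁ * y₂ + γ * z₂ * y₁ + δ * z₂ * y₂)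
      = (α * δ - β * γ) * (x₁ * z₂ - x₂ * z₁) * (y₁ * w₂ - y₂ * w₁) := by
  ring

lemma sub_ne_zero_of_sq_ne {p a : ℂ} (h : p ^ 2 ≠ a ^ 2) : p - a ≠ 0 :=
  fun h0 => h (by linear_combination (p + a) * h0)

lemma add_ne_zero_of_sq_ne {p a : ℂ} (h : p ^ 2 ≠ a ^ 2) : p + a ≠ 0 :=
  fun h0 => h (by linear_combination (p - a) * h0)

namespace EdgeRel

variable {Adm : ℂ → Prop} {p : ℂ} {v v' : Vertex}

/-- The right side is the symmetric form with matrix `((2A, δ), (δ, 0))` on the vectors `(V, Y +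
νV)` at the two ends. At spectral parameter `0` the functions `V(a)` and `V(-a)` coincide, so `Y +
νV` serves as the second wave function. -/
lemma linear_diff (h : EdgeRel Adm p v v') (h0 : Adm 0) (hp : p ≠ 0) (δ A c₀ ν : ℂ) :
    p * ((δ * ((ν + 1 / p) ^ 2 - 2 * (ν + 1 / p) * v'.S 0 0 + 2 * v'.Z 0 0)
          + 2 * A * (ν + 1 / p + c₀ - v'.S 0 0))
        - (δ * (ν ^ 2 - 2 * ν * v.S 0 0 + 2 * v.Z 0 0) + 2 * A * (ν + c₀ - v.S 0 0)))
      = 2 * A * v.V 0 * v'.V 0 + δ * v.V 0 * (v'.Y 0 + (ν + 1 / p) * v'.V 0)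
        + δ * (v.Y 0 + ν * v.V 0) * v'.V 0 := by
  have h1 := h.S_rel 0 0 h0 h0
  have h2 := h.Z_rel 0 0 h0 h0
  have h3 := h.Z_rel' 0 0 h0 h0
  have hi : p * (1 / p) = 1 := mul_one_div_cancel hp
  set i := 1 / p
  linear_combination (δ * (2 * ν + i) + 2 * A) * h1 + δ * h2 + δ * h3
    + (2 * A - δ * (v'.S 0 0 + v.S 0 0) + δ * (2 * ν + i)) * hi

lemma linear_wronskian (h : EdgeRel Adm p v v') (h0 : Adm 0) (hp : p ≠ 0) (ν : ℂ) :
    p * (v.V 0 * (v'.Y 0 + (ν + 1 / p) * v'.V 0) - v'.V 0 * (v.Y 0 + ν * v.V 0)) = 1 := by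
  have h1 := h.S_rel 0 0 h0 h0
  have h2 := h.S_diff h0
  have hi : p * (1 / p) = 1 := mul_one_div_cancel hp
  set i := 1 / p
  linear_combination -h1 - p * h2 + v.V 0 * v'.V 0 * hi

/-- The right side is a bilinear form in `V(±a)` at the first vertex and `V(±a)/(p ∓ a)` at the
second. The cross terms come from `S(-a,a)`, whose two shift relations are averaged to keep the form
symmetric. -/
lemma exponential_diff (h : EdgeRel Adm p v v') {a : ℂ} (ha : Adm a) (hna : Adm (-a))
    (hpa : p ^ 2 ≠ a ^ 2) (ρ σ ξ A B D : ℂ) :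
    (A * ((p + a) / (p - a) * ρ) * (1 - 2 * a * v'.S a a)
        + D * ((p - a) / (p + a) * σ) * (1 + 2 * a * v'.S (-a) (-a))
        + B * (ξ + 2 * a * p / (a ^ 2 - p ^ 2) + 2 * a * v'.S (-a) a))
      - (A * ρ * (1 - 2 * a * v.S a a) + D * σ * (1 + 2 * a * v.S (-a) (-a))
        + B * (ξ + 2 * a * v.S (-a) a))
      = 2 * a * A * ρ * v.V a * (v'.V a / (p - a))
        + -a * B * v.V a * (v'.V (-a) / (p + a))
        + -a * B * v.V (-a) * (v'.V a / (p - a))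
        + -2 * a * D * σ * v.V (-a) * (v'.V (-a) / (p + a)) := by
  have hm := sub_ne_zero_of_sq_ne hpa
  have hp := add_ne_zero_of_sq_ne hpa
  have h1 := h.S_rel a a ha ha
  have h2 := h.S_rel (-a) (-a) hna hna
  have h3 := h.S_rel (-a) a hna ha
  have h4 := h.S_rel a (-a) ha hna
  rw [h.S_symm a (-a) ha hna, h.S_symm' a (-a) ha hna] at h4
  have hmp : a ^ 2 - p ^ 2 = -((p - a) * (p + a)) := by ring
  rw [hmp]
  field_simp
  linear_combination 2 * a * A * ρ * (p + a) * h1 - 2 * a * D * σ * (p - a) * h2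
    - a * B * (p - a) * h3 - a * B * (p + a) * h4

/-- The weights `P` and `p² - b²` match the coefficients of `S_rel b a`, so the combination splits
into a function of `a` at one end and a function of `b` at the other. `Q3_diff'` uses `S_rel a b`
instead, which exchanges the ends. -/
lemma Q3_diff (h : EdgeRel Adm p v v') {a b P : ℂ} (ha : Adm a) (hb : Adm b)
    (hpa : p ^ 2 ≠ a ^ 2) (hpb : p ^ 2 ≠ b ^ 2)
    (hP : P ^ 2 = (p ^ 2 - a ^ 2) * (p ^ 2 - b ^ 2)) (E : ℂ) :
    P * (P / ((p - a) * (p - b)) * E * (1 - (a + b) * v'.S a b))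
        - (p ^ 2 - b ^ 2) * (E * (1 - (a + b) * v.S a b))
      = (p ^ 2 - b ^ 2) * ((a + b) * E * v.V a * (v'.V b / (p - b))) := by
  have hm := sub_ne_zero_of_sq_ne hpa
  have hm' := sub_ne_zero_of_sq_ne hpb
  have h1 := h.S_rel b a hb ha
  rw [h.S_symm b a hb ha, h.S_symm' b a hb ha] at h1
  field_simp
  rw [hP]
  linear_combination (a + b) * E * (p - a) * (p ^ 2 - b ^ 2) * h1

lemma Q3_diff' (h : EdgeRel Adm p v v') {a b P : ℂ} (ha : Adm a) (hb : Adm b)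
    (hpa : p ^ 2 ≠ a ^ 2) (hpb : p ^ 2 ≠ b ^ 2) (E : ℂ) :
    P * (E * (1 - (a + b) * v.S a b))
        - (p ^ 2 - b ^ 2) * (P / ((p - a) * (p - b)) * E * (1 - (a + b) * v'.S a b))
      = -P * ((a + b) * E * (v'.V a / (p - a)) * v.V b) := by
  have hm := sub_ne_zero_of_sq_ne hpa
  have hm' := sub_ne_zero_of_sq_ne hpb
  have h1 := h.S_rel a b ha hb
  field_simp
  linear_combination -P * (a + b) * E * (p - b) * h1

end EdgeRel

namespace SquareRel

variable {Adm : ℂ → Prop} {p q : ℂ} {v v₁ v₂ v₁₂ : Vertex}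

/-- The four edge differences evaluate the same symmetric form of determinant `-δ²`. By `bilin_det`
the equation reduces to the Wronskians of the two opposite vertex pairs, `f/(pq)` and `g/(pq)` up to
sign. -/
lemma eqQ1Lin (h : SquareRel Adm p q v v₁ v₂ v₁₂) (h0 : Adm 0) (hp : p ≠ 0) (hq : q ≠ 0)
    (δ A c₀ ν : ℂ) :
    EqQ1Lin p q δ
      (δ * (ν ^ 2 - 2 * ν * v.S 0 0 + 2 * v.Z 0 0) + 2 * A * (ν + c₀ - v.S 0 0))
      (δ * ((ν + 1 / p) ^ 2 - 2 * (ν + 1 / p) * v₁.S 0 0 + 2 * v₁.Z 0 0)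
        + 2 * A * (ν + 1 / p + c₀ - v₁.S 0 0))
      (δ * ((ν + 1 / q) ^ 2 - 2 * (ν + 1 / q) * v₂.S 0 0 + 2 * v₂.Z 0 0)
        + 2 * A * (ν + 1 / q + c₀ - v₂.S 0 0))
      (δ * ((ν + 1 / p + 1 / q) ^ 2 - 2 * (ν + 1 / p + 1 / q) * v₁₂.S 0 0 + 2 * v₁₂.Z 0 0)
        + 2 * A * (ν + 1 / p + 1 / q + c₀ - v₁₂.S 0 0)) := by
  have h1 := h.e₁.linear_diff h0 hp δ A c₀ ν
  have h2 := h.e₂.linear_diff h0 hq δ A c₀ ν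
  have h12 := h.e₁₂.linear_diff h0 hq δ A c₀ (ν + 1 / p)
  have h21 := h.e₂₁.linear_diff h0 hp δ A c₀ (ν + 1 / q)
  rw [add_right_comm ν (1 / q) (1 / p)] at h21
  have hw := h.e₁.linear_wronskian h0 hp ν
  have hpi : p * (1 / p) = 1 := mul_one_div_cancel hp
  have hqi : q * (1 / q) = 1 := mul_one_div_cancel hq
  have hf := h.V_zero h0
  have hg := h.V_one h0
  have hf' := h.Y_zero h0
  have hg' := h.Y_one h0
  have hpot := h.potential
  have hrhs : δ ^ 2 * (p ^ 2 - q ^ 2) / (p ^ 2 * q ^ 2)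
      = δ ^ 2 * (p ^ 2 - q ^ 2) * (1 / p) ^ 2 * (1 / q) ^ 2 := by field_simp
  unfold EqQ1Lin
  rw [hrhs]
  set i := 1 / p
  set j := 1 / q
  set f := p - q + v₂.S0 - v₁.S0
  set g := p + q + v.S0 - v₁₂.S0
  have hf'' : f * (v.Y 0 + ν * v.V 0)
      = p * (v₁.Y 0 + (ν + i) * v₁.V 0) - q * (v₂.Y 0 + (ν + j) * v₂.V 0) := by
    linear_combination hf' + ν * hf - v₁.V 0 * hpi + v₂.V 0 * hqi
  have hg'' : g * (v₁.Y 0 + (ν + i) * v₁.V 0)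
      = p * (v.Y 0 + ν * v.V 0) + q * (v₁₂.Y 0 + (ν + i + j) * v₁₂.V 0) := by
    linear_combination hg' + (ν + i) * hg + v.V 0 * hpi - v₁₂.V 0 * hqi
  set x := v.V 0
  set X := v.Y 0 + ν * v.V 0
  set y := v₁.V 0
  set Y := v₁.Y 0 + (ν + i) * v₁.V 0
  set z := v₂.V 0
  set Z := v₂.Y 0 + (ν + j) * v₂.V 0
  set w := v₁₂.V 0
  set W := v₁₂.Y 0 + (ν + i + j) * v₁₂.V 0
  have d1 : p * q * (y * Z - z * Y) = f := by
    linear_combination f * hw - p * Y * hf + p * y * hf''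
  have d2 : p * q * (x * W - X * w) = g := by
    linear_combination g * hw - p * x * hg'' + p * X * hg
  have d1' : y * Z - z * Y = i * j * f := by
    linear_combination i * j * d1 - (q * j * hpi + hqi) * (y * Z - z * Y)
  have d2' : x * W - X * w = i * j * g := by
    linear_combination i * j * d2 - (q * j * hpi + hqi) * (x * W - X * w)
  have key := bilin_det (2 * A) δ δ 0 x X z Z w W y Y
  generalize δ * (ν ^ 2 - 2 * ν * v.S 0 0 + 2 * v.Z 0 0) + 2 * A * (ν + c₀ - v.S 0 0) = u at *
  generalize δ * ((ν + i) ^ 2 - 2 * (ν + i) * v₁.S 0 0 + 2 * v₁.Z 0 0)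
        + 2 * A * (ν + i + c₀ - v₁.S 0 0) = u₁ at *
  generalize δ * ((ν + j) ^ 2 - 2 * (ν + j) * v₂.S 0 0 + 2 * v₂.Z 0 0)
        + 2 * A * (ν + j + c₀ - v₂.S 0 0) = u₂ at *
  generalize δ * ((ν + i + j) ^ 2 - 2 * (ν + i + j) * v₁₂.S 0 0 + 2 * v₁₂.Z 0 0)
        + 2 * A * (ν + i + j + c₀ - v₁₂.S 0 0) = u₁₂ at *
  have e1 : q ^ 2 * (u - u₂) * (u₁ - u₁₂) = (q * (u₂ - u)) * (q * (u₁₂ - u₁)) := by ring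
  have e2 : p ^ 2 * (u - u₁) * (u₂ - u₁₂) = (p * (u₁ - u)) * (p * (u₁₂ - u₂)) := by ring
  rw [e1, e2, h1, h2, h12, h21]
  linear_combination key + δ ^ 2 * (y * Z - z * Y) * d2' + δ ^ 2 * i * j * g * d1'
    + δ ^ 2 * i ^ 2 * j ^ 2 * hpot

lemma eqQ1 (h : SquareRel Adm p q v v₁ v₂ v₁₂) {a : ℂ} (ha : Adm a) (hna : Adm (-a))
    (hpa : p ^ 2 ≠ a ^ 2) (hqa : q ^ 2 ≠ a ^ 2) (ξ A B D : ℂ) {ρ σ δ : ℂ} (hρ : ρ * σ = 1)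
    (hδ : 16 * A * D + 4 * B ^ 2 = δ ^ 2) :
    EqQ1 p q a δ
      (A * ρ * (1 - 2 * a * v.S a a) + D * σ * (1 + 2 * a * v.S (-a) (-a))
        + B * (ξ + 2 * a * v.S (-a) a))
      (A * ((p + a) / (p - a) * ρ) * (1 - 2 * a * v₁.S a a)
        + D * ((p - a) / (p + a) * σ) * (1 + 2 * a * v₁.S (-a) (-a))
        + B * (ξ + 2 * a * p / (a ^ 2 - p ^ 2) + 2 * a * v₁.S (-a) a))
      (A * ((q + a) / (q - a) * ρ) * (1 - 2 * a * v₂.S a a)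
        + D * ((q - a) / (q + a) * σ) * (1 + 2 * a * v₂.S (-a) (-a))
        + B * (ξ + 2 * a * q / (a ^ 2 - q ^ 2) + 2 * a * v₂.S (-a) a))
      (A * ((q + a) / (q - a) * ((p + a) / (p - a) * ρ)) * (1 - 2 * a * v₁₂.S a a)
        + D * ((q - a) / (q + a) * ((p - a) / (p + a) * σ)) * (1 + 2 * a * v₁₂.S (-a) (-a))
        + B * (ξ + 2 * a * p / (a ^ 2 - p ^ 2) + 2 * a * q / (a ^ 2 - q ^ 2)
          + 2 * a * v₁₂.S (-a) a)) := by
  have hm := sub_ne_zero_of_sq_ne hpa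
  have hp := add_ne_zero_of_sq_ne hpa
  have hm' := sub_ne_zero_of_sq_ne hqa
  have hp' := add_ne_zero_of_sq_ne hqa
  have h1 := h.e₁.exponential_diff ha hna hpa ρ σ ξ A B D
  have h2 := h.e₂.exponential_diff ha hna hqa ρ σ ξ A B D
  have h12 := h.e₁₂.exponential_diff ha hna hqa ((p + a) / (p - a) * ρ) ((p - a) / (p + a) * σ)
    (ξ + 2 * a * p / (a ^ 2 - p ^ 2)) A B D
  have h21 := h.e₂₁.exponential_diff ha hna hpa ((q + a) / (q - a) * ρ) ((q - a) / (q + a) * σ)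
    (ξ + 2 * a * q / (a ^ 2 - q ^ 2)) A B D
  rw [add_right_comm ξ (2 * a * q / (a ^ 2 - q ^ 2)), mul_left_comm ((p + a) / (p - a)),
    mul_left_comm ((p - a) / (p + a))] at h21
  have hF := h.wronskian_one_two ha hna
  have hG := h.wronskian_zero_both ha hna
  have hpot := h.potential
  set f := p - q + v₂.S0 - v₁.S0
  set g := p + q + v.S0 - v₁₂.S0
  clear_value f g
  unfold EqQ1
  generalize A * ρ * (1 - 2 * a * v.S a a) + D * σ * (1 + 2 * a * v.S (-a) (-a))
        + B * (ξ + 2 * a * v.S (-a) a) = u at *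
  generalize (A * ((p + a) / (p - a) * ρ) * (1 - 2 * a * v₁.S a a)
        + D * ((p - a) / (p + a) * σ) * (1 + 2 * a * v₁.S (-a) (-a))
        + B * (ξ + 2 * a * p / (a ^ 2 - p ^ 2) + 2 * a * v₁.S (-a) a)) = u₁ at *
  generalize (A * ((q + a) / (q - a) * ρ) * (1 - 2 * a * v₂.S a a)
        + D * ((q - a) / (q + a) * σ) * (1 + 2 * a * v₂.S (-a) (-a))
        + B * (ξ + 2 * a * q / (a ^ 2 - q ^ 2) + 2 * a * v₂.S (-a) a)) = u₂ at *
  generalize (A * ((q + a) / (q - a) * ((p + a) / (p - a) * ρ)) * (1 - 2 * a * v₁₂.S a a)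
        + D * ((q - a) / (q + a) * ((p - a) / (p + a) * σ)) * (1 + 2 * a * v₁₂.S (-a) (-a))
        + B * (ξ + 2 * a * p / (a ^ 2 - p ^ 2) + 2 * a * q / (a ^ 2 - q ^ 2)
          + 2 * a * v₁₂.S (-a) a)) = u₁₂ at *
  set y := v₁.V a / (p - a) with hy
  set y' := v₁.V (-a) / (p + a) with hy'
  set z := v₂.V a / (q - a) with hz
  set z' := v₂.V (-a) / (q + a) with hz'
  -- The plain wave factors gained at `v₁` are moved into the vector at `v₁₂`. The edges into `v₁₂`
  -- then use the same form as the edges out of `v`, and the same vectors at `v₁` and `v₂`, as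
  -- `bilin_det` requires.
  have k12 : (q ^ 2 - a ^ 2) * (u₁₂ - u₁)
      = 2 * a * A * ρ * ((p + a) * (q + a) * v₁₂.V a) * y
        + -a * B * ((p + a) * (q + a) * v₁₂.V a) * y'
        + -a * B * ((p - a) * (q - a) * v₁₂.V (-a)) * y
        + -2 * a * D * σ * ((p - a) * (q - a) * v₁₂.V (-a)) * y' := by
    rw [h12, hy, hy']
    field_simp
    ring
  have k21 : (p ^ 2 - a ^ 2) * (u₁₂ - u₂)
      = 2 * a * A * ρ * ((p + a) * (q + a) * v₁₂.V a) * z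
        + -a * B * ((p + a) * (q + a) * v₁₂.V a) * z'
        + -a * B * ((p - a) * (q - a) * v₁₂.V (-a)) * z
        + -2 * a * D * σ * ((p - a) * (q - a) * v₁₂.V (-a)) * z' := by
    rw [h21, hz, hz']
    field_simp
    ring
  have hF' : z * y' - z' * y = 2 * a * f / ((p ^ 2 - a ^ 2) * (q ^ 2 - a ^ 2)) := by
    have e : (p ^ 2 - a ^ 2) * (q ^ 2 - a ^ 2) = (p - a) * (p + a) * ((q - a) * (q + a)) := by ring
    rw [e, hy, hy', hz, hz']
    field_simp
    linear_combination hF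
  have key := bilin_det (2 * a * A * ρ) (-a * B) (-a * B) (-2 * a * D * σ) (v.V a) (v.V (-a)) z z'
    ((p + a) * (q + a) * v₁₂.V a) ((p - a) * (q - a) * v₁₂.V (-a)) y y'
  have e1 : (q ^ 2 - a ^ 2) * (u - u₂) * (u₁ - u₁₂)
      = (u₂ - u) * ((q ^ 2 - a ^ 2) * (u₁₂ - u₁)) := by ring
  have e2 : (p ^ 2 - a ^ 2) * (u - u₁) * (u₂ - u₁₂)
      = (u₁ - u) * ((p ^ 2 - a ^ 2) * (u₁₂ - u₂)) := by ring
  -- The only use of the constraint on `A`, `B`, `D`: it states the determinant of the form.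
  have hdet : 2 * a * A * ρ * (-2 * a * D * σ) - -a * B * (-a * B) = -a ^ 2 * δ ^ 2 / 4 := by
    linear_combination -4 * a ^ 2 * A * D * hρ - a ^ 2 / 4 * hδ
  rw [hdet, hF'] at key
  rw [e1, e2, k12, k21, h1, h2]
  have hG' : v.V a * ((p - a) * (q - a) * v₁₂.V (-a)) - v.V (-a) * ((p + a) * (q + a) * v₁₂.V a)
      = -2 * a * g := by linear_combination -hG
  rw [hG'] at key
  rw [mul_div_assoc] at key
  rw [key, mul_div_assoc, ← hpot]
  ring

/-- Here the form pairs a vector of parameter `±a`, taken at `v` or `v₁₂`, with a vector of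
parameter `±b`, taken at `v₁` or `v₂`. Hence `g` comes from the Wronskian in `a` and `f` from the
one in `b`. -/
lemma eqQ3 (h : SquareRel Adm p q v v₁ v₂ v₁₂) {a b : ℂ} (ha : Adm a) (hna : Adm (-a))
    (hb : Adm b) (hnb : Adm (-b)) (a0 : a ≠ 0) (b0 : b ≠ 0)
    (hpa : p ^ 2 ≠ a ^ 2) (hpb : p ^ 2 ≠ b ^ 2) (hqa : q ^ 2 ≠ a ^ 2) (hqb : q ^ 2 ≠ b ^ 2)
    {P Q : ℂ} (hP : P ^ 2 = (p ^ 2 - a ^ 2) * (p ^ 2 - b ^ 2))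
    (hQ : Q ^ 2 = (q ^ 2 - a ^ 2) * (q ^ 2 - b ^ 2)) {A B C D δ E₁ E₂ E₃ E₄ : ℂ}
    (hE : E₁ * E₄ = 1) (hE' : E₂ * E₃ = 1)
    (hδ : A * D * (a + b) ^ 2 - B * C * (a - b) ^ 2 = -(δ ^ 2 / (16 * a * b)))
    {u u₁ u₂ u₁₂ : ℂ}
    (hu : u = A * (E₁ * (1 - (a + b) * v.S a b)) + B * (E₂ * (1 - (a + -b) * v.S a (-b)))
      + C * (E₃ * (1 - (-a + b) * v.S (-a) b)) + D * (E₄ * (1 - (-a + -b) * v.S (-a) (-b))))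
    (hu₁ : u₁ = A * (P / ((p - a) * (p - b)) * E₁ * (1 - (a + b) * v₁.S a b))
      + B * (P / ((p - a) * (p - -b)) * E₂ * (1 - (a + -b) * v₁.S a (-b)))
      + C * (P / ((p - -a) * (p - b)) * E₃ * (1 - (-a + b) * v₁.S (-a) b))
      + D * (P / ((p - -a) * (p - -b)) * E₄ * (1 - (-a + -b) * v₁.S (-a) (-b))))
    (hu₂ : u₂ = A * (Q / ((q - a) * (q - b)) * E₁ * (1 - (a + b) * v₂.S a b))
      + B * (Q / ((q - a) * (q - -b)) * E₂ * (1 - (a + -b) * v₂.S a (-b)))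
      + C * (Q / ((q - -a) * (q - b)) * E₃ * (1 - (-a + b) * v₂.S (-a) b))
      + D * (Q / ((q - -a) * (q - -b)) * E₄ * (1 - (-a + -b) * v₂.S (-a) (-b))))
    (hu₁₂ : u₁₂ = A * (P / ((p - a) * (p - b)) * (Q / ((q - a) * (q - b)) * E₁)
        * (1 - (a + b) * v₁₂.S a b))
      + B * (P / ((p - a) * (p - -b)) * (Q / ((q - a) * (q - -b)) * E₂)
        * (1 - (a + -b) * v₁₂.S a (-b)))
      + C * (P / ((p - -a) * (p - b)) * (Q / ((q - -a) * (q - b)) * E₃)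
        * (1 - (-a + b) * v₁₂.S (-a) b))
      + D * (P / ((p - -a) * (p - -b)) * (Q / ((q - -a) * (q - -b)) * E₄)
        * (1 - (-a + -b) * v₁₂.S (-a) (-b)))) :
    EqQ3 p q P Q δ u u₁ u₂ u₁₂ := by
  have hpa' : p ^ 2 ≠ (-a) ^ 2 := by rwa [neg_sq]
  have hpb' : p ^ 2 ≠ (-b) ^ 2 := by rwa [neg_sq]
  have hqa' : q ^ 2 ≠ (-a) ^ 2 := by rwa [neg_sq]
  have hqb' : q ^ 2 ≠ (-b) ^ 2 := by rwa [neg_sq]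
  have P0 : P ≠ 0 := by
    rintro rfl
    have := mul_ne_zero (sub_ne_zero.2 hpa) (sub_ne_zero.2 hpb)
    exact this (by rw [← hP]; ring)
  have Q0 : Q ≠ 0 := by
    rintro rfl
    have := mul_ne_zero (sub_ne_zero.2 hqa) (sub_ne_zero.2 hqb)
    exact this (by rw [← hQ]; ring)
  have m1 := sub_ne_zero_of_sq_ne hpa
  have m2 := sub_ne_zero_of_sq_ne hqa
  have m3 := sub_ne_zero_of_sq_ne hpb
  have m4 := sub_ne_zero_of_sq_ne hqb
  have s1 := add_ne_zero_of_sq_ne hpa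
  have s2 := add_ne_zero_of_sq_ne hqa
  have s3 := add_ne_zero_of_sq_ne hpb
  have s4 := add_ne_zero_of_sq_ne hqb
  have hF := h.wronskian_one_two hb hnb
  have hG := h.wronskian_zero_both ha hna
  have hpot := h.potential
  set f := p - q + v₂.S0 - v₁.S0
  set g := p + q + v.S0 - v₁₂.S0
  clear_value f g
  set α := A * ((a + b) * E₁) with hα
  set β := B * ((a + -b) * E₂) with hβ
  set γ := C * ((-a + b) * E₃) with hγ
  set ε := D * ((-a + -b) * E₄) with hε
  set x := v.V a with hx
  set x' := v.V (-a) with hx'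
  set y := v₁.V b / (p - b) with hy
  set y' := v₁.V (-b) / (p - -b) with hy'
  set z := v₁₂.V a / ((p - a) * (q - a)) with hz
  set z' := v₁₂.V (-a) / ((p - -a) * (q - -a)) with hz'
  set w := v₂.V b / (q - b) with hw
  set w' := v₂.V (-b) / (q - -b) with hw'
  have X1 : P * u₁ - (p ^ 2 - b ^ 2) * u
      = (p ^ 2 - b ^ 2) * (α * x * y + β * x * y' + γ * x' * y + ε * x' * y') := by
    have k1 := h.e₁.Q3_diff ha hb hpa hpb hP E₁
    have k2 := h.e₁.Q3_diff (P := P) ha hnb hpa hpb' (by rw [hP]; ring) E₂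
    have k3 := h.e₁.Q3_diff (P := P) hna hb hpa' hpb (by rw [hP]; ring) E₃
    have k4 := h.e₁.Q3_diff (P := P) hna hnb hpa' hpb' (by rw [hP]; ring) E₄
    rw [neg_sq] at k2 k4
    rw [hu, hu₁]
    linear_combination A * k1 + B * k2 + C * k3 + D * k4
  have X2 : Q * u₂ - (q ^ 2 - b ^ 2) * u
      = (q ^ 2 - b ^ 2) * (α * x * w + β * x * w' + γ * x' * w + ε * x' * w') := by
    have k1 := h.e₂.Q3_diff ha hb hqa hqb hQ E₁
    have k2 := h.e₂.Q3_diff (P := Q) ha hnb hqa hqb' (by rw [hQ]; ring) E₂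
    have k3 := h.e₂.Q3_diff (P := Q) hna hb hqa' hqb (by rw [hQ]; ring) E₃
    have k4 := h.e₂.Q3_diff (P := Q) hna hnb hqa' hqb' (by rw [hQ]; ring) E₄
    rw [neg_sq] at k2 k4
    rw [hu, hu₂]
    linear_combination A * k1 + B * k2 + C * k3 + D * k4
  have Y1 : P * u₂ - (p ^ 2 - b ^ 2) * u₁₂
      = -P * Q * (α * z * w + β * z * w' + γ * z' * w + ε * z' * w') := by
    have k1 := h.e₂₁.Q3_diff' (P := P) ha hb hpa hpb (Q / ((q - a) * (q - b)) * E₁)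
    have k2 := h.e₂₁.Q3_diff' (P := P) ha hnb hpa hpb' (Q / ((q - a) * (q - -b)) * E₂)
    have k3 := h.e₂₁.Q3_diff' (P := P) hna hb hpa' hpb (Q / ((q - -a) * (q - b)) * E₃)
    have k4 := h.e₂₁.Q3_diff' (P := P) hna hnb hpa' hpb' (Q / ((q - -a) * (q - -b)) * E₄)
    rw [neg_sq] at k2 k4
    rw [hu₂, hu₁₂]
    simp only [hα, hβ, hγ, hε, hz, hz', hw, hw', div_eq_mul_inv, mul_inv] at k1 k2 k3 k4 ⊢
    linear_combination A * k1 + B * k2 + C * k3 + D * k4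
  have Y2 : Q * u₁ - (q ^ 2 - b ^ 2) * u₁₂
      = -P * Q * (α * z * y + β * z * y' + γ * z' * y + ε * z' * y') := by
    have k1 := h.e₁₂.Q3_diff' (P := Q) ha hb hqa hqb (P / ((p - a) * (p - b)) * E₁)
    have k2 := h.e₁₂.Q3_diff' (P := Q) ha hnb hqa hqb' (P / ((p - a) * (p - -b)) * E₂)
    have k3 := h.e₁₂.Q3_diff' (P := Q) hna hb hqa' hqb (P / ((p - -a) * (p - b)) * E₃)
    have k4 := h.e₁₂.Q3_diff' (P := Q) hna hnb hqa' hqb' (P / ((p - -a) * (p - -b)) * E₄)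
    rw [neg_sq] at k2 k4
    rw [hu₁, hu₁₂]
    simp only [hα, hβ, hγ, hε, hz, hz', hy, hy', div_eq_mul_inv, mul_inv] at k1 k2 k3 k4 ⊢
    linear_combination A * k1 + B * k2 + C * k3 + D * k4
  have hdet : α * ε - β * γ = δ ^ 2 / (16 * a * b) := by
    rw [hα, hβ, hγ, hε]
    linear_combination -A * D * (a + b) ^ 2 * hE + B * C * (a - b) ^ 2 * hE' - hδ
  have hD1 : x * z' - x' * z = -2 * a * g / ((p ^ 2 - a ^ 2) * (q ^ 2 - a ^ 2)) := by
    have e : (p ^ 2 - a ^ 2) * (q ^ 2 - a ^ 2) = (p - a) * (p + a) * ((q - a) * (q + a)) := by ring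
    rw [e, hz, hz', sub_neg_eq_add, sub_neg_eq_add]
    field_simp
    linear_combination -hG
  have hD2 : y * w' - y' * w = -2 * b * f / ((p ^ 2 - b ^ 2) * (q ^ 2 - b ^ 2)) := by
    have e : (p ^ 2 - b ^ 2) * (q ^ 2 - b ^ 2) = (p - b) * (p + b) * ((q - b) * (q + b)) := by ring
    rw [e, hy, hy', hw, hw', sub_neg_eq_add, sub_neg_eq_add]
    field_simp
    linear_combination -hF
  have key := bilin_det α β γ ε x x' y y' z z' w w'
  have hkey : (α * ε - β * γ) * (x * z' - x' * z) * (y * w' - y' * w)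
      = δ ^ 2 * (p ^ 2 - q ^ 2) / (4 * P ^ 2 * Q ^ 2) := by
    rw [hdet, hD1, hD2, hP, hQ, ← hpot]
    have := sub_ne_zero.2 hpa
    have := sub_ne_zero.2 hpb
    have := sub_ne_zero.2 hqa
    have := sub_ne_zero.2 hqb
    field_simp
    ring
  rw [hkey] at key
  clear_value α β γ ε x x' y y' z z' w w'
  clear hu hu₁ hu₂ hu₁₂
  set F₁ := α * x * y + β * x * y' + γ * x' * y + ε * x' * y'
  set F₂ := α * x * w + β * x * w' + γ * x' * w + ε * x' * w'
  set K₁ := α * z * w + β * z * w' + γ * z' * w + ε * z' * w'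
  set K₂ := α * z * y + β * z * y' + γ * z' * y + ε * z' * y'
  -- Expanding the product of two weighted differences gives `P²`, which is divisible by `p² - b²`.
  -- After cancellation, subtracting the analogue `r2` for `q` reproduces the left side of Q3 and
  -- its term in `ũ û + u û̃`.
  have r1 : F₁ * (P * u₂ - (p ^ 2 - b ^ 2) * u₁₂)
      = (p ^ 2 - a ^ 2) * u₁ * u₂ - P * (u₁ * u₁₂ + u * u₂) + (p ^ 2 - b ^ 2) * u * u₁₂ := by
    apply mul_left_cancel₀ (sub_ne_zero.2 hpb)
    linear_combination -(P * u₂ - (p ^ 2 - b ^ 2) * u₁₂) * X1 + u₁ * u₂ * hP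
  have r2 : F₂ * (Q * u₁ - (q ^ 2 - b ^ 2) * u₁₂)
      = (q ^ 2 - a ^ 2) * u₁ * u₂ - Q * (u₂ * u₁₂ + u * u₁) + (q ^ 2 - b ^ 2) * u * u₁₂ := by
    apply mul_left_cancel₀ (sub_ne_zero.2 hqb)
    linear_combination -(Q * u₁ - (q ^ 2 - b ^ 2) * u₁₂) * X2 + u₁ * u₂ * hQ
  rw [Y1] at r1
  rw [Y2] at r2
  have hR : (p ^ 2 - q ^ 2) * (δ ^ 2 / (4 * P * Q))
      = P * Q * (δ ^ 2 * (p ^ 2 - q ^ 2) / (4 * P ^ 2 * Q ^ 2)) := by field_simp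
  unfold EqQ3
  linear_combination r1 - r2 + P * Q * key - hR

end SquareRel


/-! ### Q2 -/

/-- The background-plus-soliton function of Q2, up to its constant prefactor; `σ` plays the role of
`ρ⁻¹`. -/
noncomputable def Vertex.w (v : Vertex) (a A D ξ ρ σ : ℂ) : ℂ :=
  1 / 4 * (ξ ^ 2 + 1) + a * ξ * v.S (-a) a + a ^ 2 * (v.Z a (-a) + v.Z (-a) a) + A * D
    + A / 2 * ρ * (1 - 2 * a * v.S a a) + D / 2 * σ * (1 + 2 * a * v.S (-a) (-a))

/-- `-2a` times the derivative of the wave function. -/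
noncomputable def Vertex.psi (v : Vertex) (a ξ k : ℂ) : ℂ := ξ * v.V k - 2 * a * v.Y k

namespace EdgeRel

variable {Adm : ℂ → Prop} {p : ℂ} {v v' : Vertex}

/-- After subtraction of `a² (p/(p² - a²))²` the edge difference becomes a scalar product of data at
the first end with `V(±a)` at the second. `Q2_diff'` adds the same constant and has the roles of the
ends exchanged; Q2 needs one form on edges leaving `v` and the other on edges entering `v₁₂`. -/
lemma Q2_diff (h : EdgeRel Adm p v v') {a : ℂ} (ha : Adm a) (hna : Adm (-a))
    (hpa : p ^ 2 ≠ a ^ 2) (ρ σ ξ A D : ℂ) :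
    v'.w a A D (ξ + 2 * a * p / (a ^ 2 - p ^ 2)) ((p + a) / (p - a) * ρ) ((p - a) / (p + a) * σ)
        - v.w a A D ξ ρ σ - a ^ 2 * (p / (p ^ 2 - a ^ 2)) ^ 2
      = (a * A * ρ * v.V a - a / 2 * v.psi a ξ (-a)) * (v'.V a / (p - a))
        + (-a * D * σ * v.V (-a) - a / 2 * v.psi a ξ a) * (v'.V (-a) / (p + a)) := by
  have hm := sub_ne_zero_of_sq_ne hpa
  have hp := add_ne_zero_of_sq_ne hpa
  have h1 := h.S_rel a a ha ha
  have h2 := h.S_rel (-a) (-a) hna hna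
  have h3 := h.S_rel (-a) a hna ha
  have h4 := h.S_rel a (-a) ha hna
  have h5 := h.Z_rel a (-a) ha hna
  have h6 := h.Z_rel (-a) a hna ha
  rw [h.S_symm a (-a) ha hna, h.S_symm' a (-a) ha hna] at h4
  rw [h.S_symm' a (-a) ha hna] at h5
  have hmp : a ^ 2 - p ^ 2 = -((p - a) * (p + a)) := by ring
  have hmp' : p ^ 2 - a ^ 2 = (p - a) * (p + a) := by ring
  unfold Vertex.w Vertex.psi
  rw [hmp, hmp']
  field_simp
  linear_combination 8 * a * A * ρ * (p + a) ^ 2 * (p - a) * h1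
    - 8 * a * D * σ * (p - a) ^ 2 * (p + a) * h2
    - 4 * a * ξ * (p - a) ^ 2 * (p + a) * h3 - 4 * a * ξ * (p + a) ^ 2 * (p - a) * h4
    + 8 * a ^ 2 * (p + a) ^ 2 * (p - a) * h5 + 8 * a ^ 2 * (p - a) ^ 2 * (p + a) * h6

lemma Q2_diff' (h : EdgeRel Adm p v v') {a : ℂ} (ha : Adm a) (hna : Adm (-a))
    (hpa : p ^ 2 ≠ a ^ 2) (ρ σ ξ A D : ℂ) :
    v'.w a A D (ξ + 2 * a * p / (a ^ 2 - p ^ 2)) ((p + a) / (p - a) * ρ) ((p - a) / (p + a) * σ)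
        - v.w a A D ξ ρ σ + a ^ 2 * (p / (p ^ 2 - a ^ 2)) ^ 2
      = (a * A * ((p + a) / (p - a) * ρ) * v'.V a
          - a / 2 * v'.psi a (ξ + 2 * a * p / (a ^ 2 - p ^ 2)) (-a)) * (v.V a / (p + a))
        + (-a * D * ((p - a) / (p + a) * σ) * v'.V (-a)
          - a / 2 * v'.psi a (ξ + 2 * a * p / (a ^ 2 - p ^ 2)) a) * (v.V (-a) / (p - a)) := by
  have hm := sub_ne_zero_of_sq_ne hpa
  have hp := add_ne_zero_of_sq_ne hpa
  have h1 := h.S_rel a a ha ha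
  have h2 := h.S_rel (-a) (-a) hna hna
  have h3 := h.S_rel (-a) a hna ha
  have h4 := h.S_rel a (-a) ha hna
  have h5 := h.Z_rel' a (-a) ha hna
  have h6 := h.Z_rel' (-a) a hna ha
  rw [h.S_symm a (-a) ha hna, h.S_symm' a (-a) ha hna] at h4
  rw [h.S_symm a (-a) ha hna] at h5
  have hmp : a ^ 2 - p ^ 2 = -((p - a) * (p + a)) := by ring
  have hmp' : p ^ 2 - a ^ 2 = (p - a) * (p + a) := by ring
  unfold Vertex.w Vertex.psi
  rw [hmp, hmp']
  field_simp
  linear_combination 8 * a * A * ρ * (p + a) ^ 2 * (p - a) * h1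
    - 8 * a * D * σ * (p - a) ^ 2 * (p + a) * h2
    - 4 * a * (p - a) * (ξ * (p - a) * (p + a) - 2 * a * p) * h3
    - 4 * a * (p + a) * (ξ * (p - a) * (p + a) - 2 * a * p) * h4
    + 8 * a ^ 2 * (p - a) ^ 2 * (p + a) * h5 + 8 * a ^ 2 * (p + a) ^ 2 * (p - a) * h6

/-- The wave functions on an edge determine `S(a,-a)` and `Z(a,-a) + Z(-a,a)`. -/
lemma psi_psi (h : EdgeRel Adm p v v') {a : ℂ} (ha : Adm a) (hna : Adm (-a))
    (hpa : p ^ 2 ≠ a ^ 2) {ξ ξ' : ℂ} (hξ : ξ' = ξ + 2 * a * p / (a ^ 2 - p ^ 2)) :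
    (p + a) * v'.psi a ξ' a * v.psi a ξ (-a) - (p - a) * v'.psi a ξ' (-a) * v.psi a ξ a
      = 8 * a * (1 / 4 * ξ' ^ 2 + a * ξ' * v'.S (-a) a + a ^ 2 * (v'.Z a (-a) + v'.Z (-a) a))
        + 2 * a ^ 2 * (v'.psi a ξ' a * v.V (-a) / (p - a) + v'.psi a ξ' (-a) * v.V a / (p + a)) := by
  have hm := sub_ne_zero_of_sq_ne hpa
  have hp := add_ne_zero_of_sq_ne hpa
  have h0 := h.wronskian ha hna
  have h1 := h.Z_neg ha hna
  have h2 := h.S_neg ha hna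
  have h3 := h.S_neg' ha hna
  rw [h.S_symm' a (-a) ha hna] at h2 h3
  have hmp : a ^ 2 - p ^ 2 = -((p - a) * (p + a)) := by ring
  have hξ' : ξ = ξ' + 2 * a * p / ((p - a) * (p + a)) := by rw [hξ, hmp]; field_simp; ring
  rw [hξ']
  unfold Vertex.psi
  field_simp
  linear_combination 4 * (p - a) * (p + a) * (ξ' ^ 2 * h0 - 4 * a ^ 2 * h1 + 2 * a * ξ' * (h2 + h3))

lemma psi_wronskian (h : EdgeRel Adm p v v') {a : ℂ} (ha : Adm a) (hna : Adm (-a))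
    (hpa : p ^ 2 ≠ a ^ 2) {ξ ξ' : ℂ} (hξ : ξ' = ξ + 2 * a * p / (a ^ 2 - p ^ 2)) :
    (p + a) * (v.V (-a) * v'.psi a ξ' a - v.psi a ξ (-a) * v'.V a)
        + (p - a) * (v.V a * v'.psi a ξ' (-a) - v.psi a ξ a * v'.V (-a))
      = -4 * a * p ^ 2 / ((p - a) * (p + a)) := by
  have hm := sub_ne_zero_of_sq_ne hpa
  have hp := add_ne_zero_of_sq_ne hpa
  have h0 := h.wronskian ha hna
  have h2 := h.S_neg ha hna
  have h3 := h.S_neg' ha hna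
  have hmp : a ^ 2 - p ^ 2 = -((p - a) * (p + a)) := by ring
  rw [hξ, hmp]
  unfold Vertex.psi
  field_simp
  linear_combination 2 * a * (p - a) * (p + a) * (h3 - h2) - 2 * a ^ 2 * h0

/-- `1 - 2a S(a,a)` as a Wronskian along an edge. -/
lemma psi_self (h : EdgeRel Adm p v v') {a : ℂ} (ha : Adm a)
    (hpa : p ^ 2 ≠ a ^ 2) {ξ ξ' : ℂ} (hξ : ξ' = ξ + 2 * a * p / (a ^ 2 - p ^ 2)) :
    (p - a) * (v.V a * v'.psi a ξ' a - v.psi a ξ a * v'.V a)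
      = -2 * a * (1 - 2 * a * v'.S a a) + 2 * a ^ 2 / (p + a) * v.V a * v'.V a := by
  have hm := sub_ne_zero_of_sq_ne hpa
  have hp := add_ne_zero_of_sq_ne hpa
  have h1 := h.one_sub_S ha
  have hmp : a ^ 2 - p ^ 2 = -((p - a) * (p + a)) := by ring
  rw [hξ, hmp, h1]
  unfold Vertex.psi
  field_simp
  ring

end EdgeRel

namespace SquareRel

variable {Adm : ℂ → Prop} {p q : ℂ} {v v₁ v₂ v₁₂ : Vertex}

/-- This is `V_one` differentiated in the spectral parameter. The increments of `ξ` absorb part of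
the derivatives of the factors `p - a` and `q + a`; the rest is the inhomogeneous term in `V`. -/
lemma psi_one (h : SquareRel Adm p q v v₁ v₂ v₁₂) {a : ℂ} (ha : Adm a) (hpa : p ^ 2 ≠ a ^ 2)
    (hqa : q ^ 2 ≠ a ^ 2) {ξ ξ₁ ξ₁₂ : ℂ} (hξ₁ : ξ₁ = ξ + 2 * a * p / (a ^ 2 - p ^ 2))
    (hξ₁₂ : ξ₁₂ = ξ₁ + 2 * a * q / (a ^ 2 - q ^ 2)) :
    (p + q + v.S0 - v₁₂.S0) * v₁.psi a ξ₁ a = (p - a) * v.psi a ξ a + (q + a) * v₁₂.psi a ξ₁₂ a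
      + 2 * a ^ 2 * (v.V a / (p + a) + v₁₂.V a / (q - a)) := by
  have hm := sub_ne_zero_of_sq_ne hpa
  have hp := add_ne_zero_of_sq_ne hpa
  have hm' := sub_ne_zero_of_sq_ne hqa
  have hp' := add_ne_zero_of_sq_ne hqa
  have h1 := h.V_one ha
  have h2 := h.Y_one ha
  have hξ : ξ = ξ₁ + 2 * a * p / ((p - a) * (p + a)) := by
    rw [hξ₁, show a ^ 2 - p ^ 2 = -((p - a) * (p + a)) by ring]; field_simp; ring
  have hξ' : ξ₁₂ = ξ₁ - 2 * a * q / ((q - a) * (q + a)) := by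
    rw [hξ₁₂, show a ^ 2 - q ^ 2 = -((q - a) * (q + a)) by ring]; field_simp; ring
  have e : (p + q + v.S0 - v₁₂.S0) * v₁.psi a ξ₁ a
      = ξ₁ * ((p - a) * v.V a + (q + a) * v₁₂.V a)
        - 2 * a * ((p - a) * v.Y a - v.V a + (q + a) * v₁₂.Y a + v₁₂.V a) := by
    unfold Vertex.psi
    linear_combination ξ₁ * h1 - 2 * a * h2
  rw [e, hξ, hξ']
  unfold Vertex.psi
  field_simp
  ring

lemma psi_one_neg (h : SquareRel Adm p q v v₁ v₂ v₁₂) {a : ℂ} (hna : Adm (-a))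
    (hpa : p ^ 2 ≠ a ^ 2) (hqa : q ^ 2 ≠ a ^ 2) {ξ ξ₁ ξ₁₂ : ℂ}
    (hξ₁ : ξ₁ = ξ + 2 * a * p / (a ^ 2 - p ^ 2))
    (hξ₁₂ : ξ₁₂ = ξ₁ + 2 * a * q / (a ^ 2 - q ^ 2)) :
    (p + q + v.S0 - v₁₂.S0) * v₁.psi a ξ₁ (-a)
      = (p + a) * v.psi a ξ (-a) + (q - a) * v₁₂.psi a ξ₁₂ (-a)
      - 2 * a ^ 2 * (v.V (-a) / (p - a) + v₁₂.V (-a) / (q + a)) := by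
  -- Reversing `a` and `ξ` together preserves the shifts of `ξ` and only changes the sign of `psi`.
  have h1 := h.psi_one hna (ξ := -ξ) (ξ₁ := -ξ₁) (ξ₁₂ := -ξ₁₂) (by rwa [neg_sq]) (by rwa [neg_sq])
    (by rw [hξ₁]; ring) (by rw [hξ₁₂]; ring)
  simp only [Vertex.psi] at h1 ⊢
  rw [sub_neg_eq_add, sub_neg_eq_add, ← sub_eq_add_neg, ← sub_eq_add_neg] at h1
  linear_combination -h1

/-- The quadratic expression in the wave functions at opposite vertices which occurs in Q2, seen
from the edge between the first two vertices. -/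
lemma psi_zero_both (h : SquareRel Adm p q v v₁ v₂ v₁₂) {a : ℂ} (ha : Adm a) (hna : Adm (-a))
    (hpa : p ^ 2 ≠ a ^ 2) (hqa : q ^ 2 ≠ a ^ 2) {ξ ξ₁ ξ₁₂ : ℂ}
    (hξ₁ : ξ₁ = ξ + 2 * a * p / (a ^ 2 - p ^ 2))
    (hξ₁₂ : ξ₁₂ = ξ₁ + 2 * a * q / (a ^ 2 - q ^ 2)) :
    (p + a) * (q + a) * v₁₂.psi a ξ₁₂ a * v.psi a ξ (-a)
        - (p - a) * (q - a) * v₁₂.psi a ξ₁₂ (-a) * v.psi a ξ a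
      = 8 * a * (p + q + v.S0 - v₁₂.S0)
          * (1 / 4 * ξ₁ ^ 2 + a * ξ₁ * v₁.S (-a) a + a ^ 2 * (v₁.Z a (-a) + v₁.Z (-a) a))
        + 2 * a ^ 2 * ((q + a) / (p - a) * v.V (-a) * v₁₂.psi a ξ₁₂ a
          + (q - a) / (p + a) * v.V a * v₁₂.psi a ξ₁₂ (-a)
          - (p + a) / (q - a) * v.psi a ξ (-a) * v₁₂.V a
          - (p - a) / (q + a) * v.psi a ξ a * v₁₂.V (-a)
          + 4 * a ^ 3 * (p + q + v.S0 - v₁₂.S0) / ((p ^ 2 - a ^ 2) * (q ^ 2 - a ^ 2))) := by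
  have hm := sub_ne_zero_of_sq_ne hpa
  have hp := add_ne_zero_of_sq_ne hpa
  have hm' := sub_ne_zero_of_sq_ne hqa
  have hp' := add_ne_zero_of_sq_ne hqa
  have h1 := h.e₁.psi_psi ha hna hpa hξ₁
  have h2 := h.psi_one ha hpa hqa hξ₁ hξ₁₂
  have h3 := h.psi_one_neg hna hpa hqa hξ₁ hξ₁₂
  have hG := h.wronskian_zero_both ha hna
  rw [show (p ^ 2 - a ^ 2) * (q ^ 2 - a ^ 2) = (p - a) * (p + a) * ((q - a) * (q + a)) by ring]
  generalize v₁.psi a ξ₁ a = y at *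
  generalize v₁.psi a ξ₁ (-a) = y' at *
  generalize v.psi a ξ a = x at *
  generalize v.psi a ξ (-a) = x' at *
  generalize v₁₂.psi a ξ₁₂ a = w at *
  generalize v₁₂.psi a ξ₁₂ (-a) = w' at *
  generalize 1 / 4 * ξ₁ ^ 2 + a * ξ₁ * v₁.S (-a) a + a ^ 2 * (v₁.Z a (-a) + v₁.Z (-a) a) = k at *
  generalize p + q + v.S0 - v₁₂.S0 = g at *
  -- Multiplication by `g` lets `psi_one` and `psi_one_neg` replace the data at `v₁` by data at `v`
  -- and `v₁₂`; the products `w w'` do not arise.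
  have E : (p + a) * (g * y) * x' - (p - a) * (g * y') * x
      = 8 * a * g * k + 2 * a ^ 2 * ((g * y) * v.V (-a) / (p - a) + (g * y') * v.V a / (p + a)) := by
    linear_combination g * h1
  rw [h2, h3] at E
  field_simp at E ⊢
  linear_combination E + 4 * a ^ 4 * hG

/-- The symmetric Wronskian of the wave functions at opposite vertices. -/
lemma psi_wronskian (h : SquareRel Adm p q v v₁ v₂ v₁₂) {a : ℂ} (ha : Adm a) (hna : Adm (-a))
    (hpa : p ^ 2 ≠ a ^ 2) (hqa : q ^ 2 ≠ a ^ 2) {ξ ξ₁ ξ₁₂ : ℂ}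
    (hξ₁ : ξ₁ = ξ + 2 * a * p / (a ^ 2 - p ^ 2))
    (hξ₁₂ : ξ₁₂ = ξ₁ + 2 * a * q / (a ^ 2 - q ^ 2)) :
    (p + a) * (q + a) * (v.V (-a) * v₁₂.psi a ξ₁₂ a - v.psi a ξ (-a) * v₁₂.V a)
        + (p - a) * (q - a) * (v.V a * v₁₂.psi a ξ₁₂ (-a) - v.psi a ξ a * v₁₂.V (-a))
      = -4 * a * (p + q + v.S0 - v₁₂.S0)
        * (1 + a ^ 2 / (p ^ 2 - a ^ 2) + a ^ 2 / (q ^ 2 - a ^ 2)) := by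
  have hm := sub_ne_zero_of_sq_ne hpa
  have hp := add_ne_zero_of_sq_ne hpa
  have hm' := sub_ne_zero_of_sq_ne hqa
  have hp' := add_ne_zero_of_sq_ne hqa
  have h1 := h.V_one ha
  have h1' := h.V_one hna
  have h2 := h.psi_one ha hpa hqa hξ₁ hξ₁₂
  have h3 := h.psi_one_neg hna hpa hqa hξ₁ hξ₁₂
  have hG := h.wronskian_zero_both ha hna
  have hW := h.e₁.psi_wronskian ha hna hpa hξ₁
  rw [show p ^ 2 - a ^ 2 = (p - a) * (p + a) by ring,
    show q ^ 2 - a ^ 2 = (q - a) * (q + a) by ring]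
  generalize v₁.psi a ξ₁ a = y at *
  generalize v₁.psi a ξ₁ (-a) = y' at *
  generalize v.psi a ξ a = x at *
  generalize v.psi a ξ (-a) = x' at *
  generalize v₁₂.psi a ξ₁₂ a = w at *
  generalize v₁₂.psi a ξ₁₂ (-a) = w' at *
  generalize p + q + v.S0 - v₁₂.S0 = g at *
  have E : (p + a) * (v.V (-a) * (g * y) - x' * (g * v₁.V a))
      + (p - a) * (v.V a * (g * y') - x * (g * v₁.V (-a)))
      = -4 * a * g * p ^ 2 / ((p - a) * (p + a)) := by
    linear_combination g * hW
  rw [h1, h1', h2, h3] at E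
  field_simp at E ⊢
  linear_combination E - 2 * a ^ 2 * (p ^ 2 - a ^ 2) * hG

lemma psi_self_zero_both (h : SquareRel Adm p q v v₁ v₂ v₁₂) {a : ℂ} (ha : Adm a)
    (hpa : p ^ 2 ≠ a ^ 2) (hqa : q ^ 2 ≠ a ^ 2) {ξ ξ₁ ξ₁₂ : ℂ}
    (hξ₁ : ξ₁ = ξ + 2 * a * p / (a ^ 2 - p ^ 2))
    (hξ₁₂ : ξ₁₂ = ξ₁ + 2 * a * q / (a ^ 2 - q ^ 2)) :
    (p + a) * (q + a) * (v.V a * v₁₂.psi a ξ₁₂ a - v.psi a ξ a * v₁₂.V a)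
      = -2 * a * (p + q + v.S0 - v₁₂.S0) * ((p + a) / (p - a)) * (1 - 2 * a * v₁.S a a)
        - 2 * a ^ 2 * v.V a * v₁₂.V a * (p ^ 2 - q ^ 2) / ((p - a) * (q - a)) := by
  have hm := sub_ne_zero_of_sq_ne hpa
  have hp := add_ne_zero_of_sq_ne hpa
  have hm' := sub_ne_zero_of_sq_ne hqa
  have hp' := add_ne_zero_of_sq_ne hqa
  have h1 := h.V_one ha
  have h2 := h.psi_one ha hpa hqa hξ₁ hξ₁₂
  have hS := h.e₁.psi_self ha hpa hξ₁
  generalize v₁.psi a ξ₁ a = y at *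
  generalize v.psi a ξ a = x at *
  generalize v₁₂.psi a ξ₁₂ a = w at *
  generalize p + q + v.S0 - v₁₂.S0 = g at *
  have E : (p - a) * (v.V a * (g * y) - x * (g * v₁.V a))
      = -2 * a * g * (1 - 2 * a * v₁.S a a) + 2 * a ^ 2 / (p + a) * v.V a * (g * v₁.V a) := by
    linear_combination g * hS
  rw [h1, h2] at E
  field_simp at E ⊢
  linear_combination E

lemma psi_self_zero_both_neg (h : SquareRel Adm p q v v₁ v₂ v₁₂) {a : ℂ} (hna : Adm (-a))
    (hpa : p ^ 2 ≠ a ^ 2) (hqa : q ^ 2 ≠ a ^ 2) {ξ ξ₁ ξ₁₂ : ℂ}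
    (hξ₁ : ξ₁ = ξ + 2 * a * p / (a ^ 2 - p ^ 2))
    (hξ₁₂ : ξ₁₂ = ξ₁ + 2 * a * q / (a ^ 2 - q ^ 2)) :
    (p - a) * (q - a) * (v.V (-a) * v₁₂.psi a ξ₁₂ (-a) - v.psi a ξ (-a) * v₁₂.V (-a))
      = -2 * a * (p + q + v.S0 - v₁₂.S0) * ((p - a) / (p + a)) * (1 + 2 * a * v₁.S (-a) (-a))
        + 2 * a ^ 2 * v.V (-a) * v₁₂.V (-a) * (p ^ 2 - q ^ 2) / ((p + a) * (q + a)) := by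
  have h1 := h.psi_self_zero_both hna (ξ := -ξ) (ξ₁ := -ξ₁) (ξ₁₂ := -ξ₁₂) (by rwa [neg_sq])
    (by rwa [neg_sq]) (by rw [hξ₁]; ring) (by rw [hξ₁₂]; ring)
  simp only [Vertex.psi] at h1 ⊢
  rw [sub_neg_eq_add, sub_neg_eq_add, ← sub_eq_add_neg, ← sub_eq_add_neg] at h1
  linear_combination -h1

/-- The determinant of the two coefficient vectors at opposite vertices. -/
lemma Q2_det (h : SquareRel Adm p q v v₁ v₂ v₁₂) {a : ℂ} (ha : Adm a) (hna : Adm (-a))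
    (hpa : p ^ 2 ≠ a ^ 2) (hqa : q ^ 2 ≠ a ^ 2) {ξ ξ₁ ξ₂ ξ₁₂ ρ σ A D : ℂ} (hρ : ρ * σ = 1)
    (hξ₁ : ξ₁ = ξ + 2 * a * p / (a ^ 2 - p ^ 2)) (hξ₂ : ξ₂ = ξ + 2 * a * q / (a ^ 2 - q ^ 2))
    (hξ₁₂ : ξ₁₂ = ξ₁ + 2 * a * q / (a ^ 2 - q ^ 2)) :
    (a * A * ρ * v.V a - a / 2 * v.psi a ξ (-a))
        * (-a * D * σ * ((p - a) * (q - a) * v₁₂.V (-a))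
          - a / 2 * ((p + a) * (q + a) * v₁₂.psi a ξ₁₂ a))
      - (-a * D * σ * v.V (-a) - a / 2 * v.psi a ξ a)
        * (a * A * ρ * ((p + a) * (q + a) * v₁₂.V a)
          - a / 2 * ((p - a) * (q - a) * v₁₂.psi a ξ₁₂ (-a)))
      = a ^ 3 * (p + q + v.S0 - v₁₂.S0)
        * (v₁.w a A D ξ₁ ((p + a) / (p - a) * ρ) ((p - a) / (p + a) * σ)
          + v₂.w a A D ξ₂ ((q + a) / (q - a) * ρ) ((q - a) / (q + a) * σ) - 1 / 2
          - a ^ 2 * (p / (p ^ 2 - a ^ 2)) ^ 2 - a ^ 2 * (q / (q ^ 2 - a ^ 2)) ^ 2) := by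
  have hm := sub_ne_zero_of_sq_ne hpa
  have hp := add_ne_zero_of_sq_ne hpa
  have hm' := sub_ne_zero_of_sq_ne hqa
  have hp' := add_ne_zero_of_sq_ne hqa
  have hξ₁₂' : ξ₁₂ = ξ₂ + 2 * a * p / (a ^ 2 - p ^ 2) := by rw [hξ₁₂, hξ₁, hξ₂]; ring
  have hG := h.wronskian_zero_both ha hna
  have j1 := h.psi_zero_both ha hna hpa hqa hξ₁ hξ₁₂
  have j2 := h.swap.psi_zero_both ha hna hqa hpa hξ₂ hξ₁₂'
  have hW := h.psi_wronskian ha hna hpa hqa hξ₁ hξ₁₂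
  have d1 := h.psi_self_zero_both ha hpa hqa hξ₁ hξ₁₂
  have d2 := h.swap.psi_self_zero_both ha hqa hpa hξ₂ hξ₁₂'
  have d1' := h.psi_self_zero_both_neg hna hpa hqa hξ₁ hξ₁₂
  have d2' := h.swap.psi_self_zero_both_neg hna hqa hpa hξ₂ hξ₁₂'
  rw [add_comm q p] at j2 d2 d2'
  unfold Vertex.w
  rw [show p ^ 2 - a ^ 2 = (p - a) * (p + a) by ring,
    show q ^ 2 - a ^ 2 = (q - a) * (q + a) by ring] at j1 j2 hW ⊢
  -- The same quantity is computed through `v₁` and through `v₂`. Averaging cancels the remainder,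
  -- which is antisymmetric in `p` and `q`, and makes both middle vertices appear.
  have hA : (p + a) * (q + a) * (v.V a * v₁₂.psi a ξ₁₂ a - v.psi a ξ a * v₁₂.V a)
      = -a * (p + q + v.S0 - v₁₂.S0) * ((p + a) / (p - a) * (1 - 2 * a * v₁.S a a)
        + (q + a) / (q - a) * (1 - 2 * a * v₂.S a a)) := by
    linear_combination (d1 + d2) / 2
  have hD : (p - a) * (q - a) * (v.V (-a) * v₁₂.psi a ξ₁₂ (-a) - v.psi a ξ (-a) * v₁₂.V (-a))
      = -a * (p + q + v.S0 - v₁₂.S0) * ((p - a) / (p + a) * (1 + 2 * a * v₁.S (-a) (-a))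
        + (q - a) / (q + a) * (1 + 2 * a * v₂.S (-a) (-a))) := by
    linear_combination (d1' + d2') / 2
  generalize v.psi a ξ a = x at *
  generalize v.psi a ξ (-a) = x' at *
  generalize v₁₂.psi a ξ₁₂ a = w at *
  generalize v₁₂.psi a ξ₁₂ (-a) = w' at *
  generalize p + q + v.S0 - v₁₂.S0 = g at *
  -- Averaging again: the cross terms of the two computations add up to a multiple of the symmetric
  -- Wronskian `hW`, so only scalars times `g` remain.
  have hJ : (p + a) * (q + a) * w * x' - (p - a) * (q - a) * w' * x
      = 4 * a * g * (1 / 4 * ξ₁ ^ 2 + a * ξ₁ * v₁.S (-a) a + a ^ 2 * (v₁.Z a (-a) + v₁.Z (-a) a)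
        + (1 / 4 * ξ₂ ^ 2 + a * ξ₂ * v₂.S (-a) a + a ^ 2 * (v₂.Z a (-a) + v₂.Z (-a) a))
        - a ^ 2 * (p / ((p - a) * (p + a))) ^ 2 - a ^ 2 * (q / ((q - a) * (q + a))) ^ 2) := by
    generalize 1 / 4 * ξ₁ ^ 2 + a * ξ₁ * v₁.S (-a) a + a ^ 2 * (v₁.Z a (-a) + v₁.Z (-a) a) = k at *
    generalize 1 / 4 * ξ₂ ^ 2 + a * ξ₂ * v₂.S (-a) a + a ^ 2 * (v₂.Z a (-a) + v₂.Z (-a) a) = l at *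
    have e : (p + a) * (q + a) * w * x' - (p - a) * (q - a) * w' * x = 4 * a * g * (k + l)
        + a ^ 2 * (((p - a) * (p + a) + (q - a) * (q + a)) / ((p - a) * (p + a) * ((q - a) * (q + a)))
          * (-4 * a * g * (1 + a ^ 2 / ((p - a) * (p + a)) + a ^ 2 / ((q - a) * (q + a))))
          + 8 * a ^ 3 * g / ((p - a) * (p + a) * ((q - a) * (q + a)))) := by
      rw [← hW]
      field_simp at j1 j2 ⊢
      linear_combination (j1 + j2) / 2
    rw [e]
    field_simp
    ring
  linear_combination (a ^ 2 / 4) * hJ - (a ^ 2 / 2) * A * ρ * hA - (a ^ 2 / 2) * D * σ * hD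
    + a ^ 2 * A * D * ρ * σ * hG + 2 * a ^ 3 * A * D * g * hρ

lemma eqQ2 (h : SquareRel Adm p q v v₁ v₂ v₁₂) {a : ℂ} (ha : Adm a) (hna : Adm (-a))
    (a0 : a ≠ 0) (hpa : p ^ 2 ≠ a ^ 2) (hqa : q ^ 2 ≠ a ^ 2) (ξ A D : ℂ) {ρ σ : ℂ}
    (hρ : ρ * σ = 1) :
    EqQ2 p q a ((gam p q a)⁻¹ * v.w a A D ξ ρ σ)
      ((gam p q a)⁻¹ * v₁.w a A D (ξ + 2 * a * p / (a ^ 2 - p ^ 2)) ((p + a) / (p - a) * ρ)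
        ((p - a) / (p + a) * σ))
      ((gam p q a)⁻¹ * v₂.w a A D (ξ + 2 * a * q / (a ^ 2 - q ^ 2)) ((q + a) / (q - a) * ρ)
        ((q - a) / (q + a) * σ))
      ((gam p q a)⁻¹ * v₁₂.w a A D (ξ + 2 * a * p / (a ^ 2 - p ^ 2) + 2 * a * q / (a ^ 2 - q ^ 2))
        ((q + a) / (q - a) * ((p + a) / (p - a) * ρ))
        ((q - a) / (q + a) * ((p - a) / (p + a) * σ))) := by
  have hm := sub_ne_zero_of_sq_ne hpa
  have hp := add_ne_zero_of_sq_ne hpa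
  have hm' := sub_ne_zero_of_sq_ne hqa
  have hp' := add_ne_zero_of_sq_ne hqa
  have h1 := h.e₁.Q2_diff ha hna hpa ρ σ ξ A D
  have h2 := h.e₂.Q2_diff ha hna hqa ρ σ ξ A D
  have h12 := h.e₁₂.Q2_diff' ha hna hqa ((p + a) / (p - a) * ρ) ((p - a) / (p + a) * σ)
    (ξ + 2 * a * p / (a ^ 2 - p ^ 2)) A D
  have h21 := h.e₂₁.Q2_diff' ha hna hpa ((q + a) / (q - a) * ρ) ((q - a) / (q + a) * σ)
    (ξ + 2 * a * q / (a ^ 2 - q ^ 2)) A D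
  rw [add_right_comm ξ (2 * a * q / (a ^ 2 - q ^ 2)), mul_left_comm ((p + a) / (p - a)),
    mul_left_comm ((p - a) / (p + a))] at h21
  have hdet := h.Q2_det (ξ := ξ) (A := A) (D := D) ha hna hpa hqa hρ rfl rfl rfl
  have hF := h.wronskian_one_two ha hna
  have hpot := h.potential
  generalize v.w a A D ξ ρ σ = u at *
  generalize v₁.w a A D (ξ + 2 * a * p / (a ^ 2 - p ^ 2)) ((p + a) / (p - a) * ρ)
        ((p - a) / (p + a) * σ) = u₁ at *
  generalize v₂.w a A D (ξ + 2 * a * q / (a ^ 2 - q ^ 2)) ((q + a) / (q - a) * ρ)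
        ((q - a) / (q + a) * σ) = u₂ at *
  generalize v₁₂.w a A D (ξ + 2 * a * p / (a ^ 2 - p ^ 2) + 2 * a * q / (a ^ 2 - q ^ 2))
        ((q + a) / (q - a) * ((p + a) / (p - a) * ρ))
        ((q - a) / (q + a) * ((p - a) / (p + a) * σ)) = u₁₂ at *
  generalize v₁₂.psi a (ξ + 2 * a * p / (a ^ 2 - p ^ 2) + 2 * a * q / (a ^ 2 - q ^ 2)) a = W at *
  generalize v₁₂.psi a (ξ + 2 * a * p / (a ^ 2 - p ^ 2) + 2 * a * q / (a ^ 2 - q ^ 2)) (-a)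
    = W' at *
  set f := p - q + v₂.S0 - v₁.S0
  set g := p + q + v.S0 - v₁₂.S0
  clear_value f g
  set R := a * A * ρ * v.V a - a / 2 * v.psi a ξ (-a)
  set R' := -a * D * σ * v.V (-a) - a / 2 * v.psi a ξ a
  set K := a * A * ρ * ((p + a) * (q + a) * v₁₂.V a) - a / 2 * ((p - a) * (q - a) * W') with hK
  set K' := -a * D * σ * ((p - a) * (q - a) * v₁₂.V (-a)) - a / 2 * ((p + a) * (q + a) * W) with hK'
  have k12 : (q ^ 2 - a ^ 2) * (u₁₂ - u₁ + a ^ 2 * (q / (q ^ 2 - a ^ 2)) ^ 2)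
      = K * (v₁.V a / (p - a)) + K' * (v₁.V (-a) / (p + a)) := by
    rw [h12, hK, hK']
    field_simp
    ring
  have k21 : (p ^ 2 - a ^ 2) * (u₁₂ - u₂ + a ^ 2 * (p / (p ^ 2 - a ^ 2)) ^ 2)
      = K * (v₂.V a / (q - a)) + K' * (v₂.V (-a) / (q + a)) := by
    rw [h21, hK, hK']
    field_simp
    ring
  clear_value R R' K K'
  set α := a ^ 2 * (p / (p ^ 2 - a ^ 2)) ^ 2 with hα
  set β := a ^ 2 * (q / (q ^ 2 - a ^ 2)) ^ 2 with hβ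
  -- Each factor is a scalar product of two-vectors: `(R, R')` or `(K, K')` with a vector at `v₁` or
  -- `v₂`. The difference of products is therefore a product of two determinants.
  have key : (p ^ 2 - a ^ 2) * (u₁ - u - α) * (u₁₂ - u₂ + α)
      - (q ^ 2 - a ^ 2) * (u₂ - u - β) * (u₁₂ - u₁ + β)
      = (R * K' - R' * K) * (v₁.V a / (p - a) * (v₂.V (-a) / (q + a))
        - v₁.V (-a) / (p + a) * (v₂.V a / (q - a))) := by
    linear_combination (p ^ 2 - a ^ 2) * (u₁₂ - u₂ + α) * h1 - (q ^ 2 - a ^ 2) * (u₁₂ - u₁ + β) * h2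
      + (R * (v₁.V a / (p - a)) + R' * (v₁.V (-a) / (p + a))) * k21
      - (R * (v₂.V a / (q - a)) + R' * (v₂.V (-a) / (q + a))) * k12
  have hF' : v₁.V a / (p - a) * (v₂.V (-a) / (q + a)) - v₁.V (-a) / (p + a) * (v₂.V a / (q - a))
      = -2 * a * f / ((p ^ 2 - a ^ 2) * (q ^ 2 - a ^ 2)) := by
    rw [show p ^ 2 - a ^ 2 = (p - a) * (p + a) by ring,
      show q ^ 2 - a ^ 2 = (q - a) * (q + a) by ring]
    field_simp
    linear_combination -hF
  have hPp := sub_ne_zero.2 hpa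
  have hQq := sub_ne_zero.2 hqa
  rw [hdet, hF'] at key
  have key' : (p ^ 2 - a ^ 2) * (u₁ - u - α) * (u₁₂ - u₂ + α)
      - (q ^ 2 - a ^ 2) * (u₂ - u - β) * (u₁₂ - u₁ + β)
      = -2 * a ^ 4 * (p ^ 2 - q ^ 2) * (u₁ + u₂ - 1 / 2 - α - β)
        / ((p ^ 2 - a ^ 2) * (q ^ 2 - a ^ 2)) := by
    rw [key, ← hpot]
    ring
  rw [hα, hβ, div_pow, div_pow] at key'
  unfold EqQ2 gam
  clear_value α β
  clear key k12 k21 h1 h2 h12 h21 hdet hF hF' hα hβ hm hp hm' hp' hpot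
  -- Only `p²` and `q²` occur now; with `p² - a²` and `q² - a²` as variables the denominators are
  -- monomials.
  obtain ⟨p', hp'⟩ : ∃ p', p ^ 2 = p' + a ^ 2 := ⟨p ^ 2 - a ^ 2, by ring⟩
  obtain ⟨q', hq'⟩ : ∃ q', q ^ 2 = q' + a ^ 2 := ⟨q ^ 2 - a ^ 2, by ring⟩
  simp only [hp', hq', add_sub_cancel_right, add_sub_add_right_eq_sub] at key' hPp hQq ⊢
  field_simp at key' ⊢
  linear_combination -key'

end SquareRel


/-! ### The Sylvester equation and the bracket -/

section Bracket

set_option linter.unusedSectionVars false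

variable {ι : Type} [Fintype ι] [DecidableEq ι]

/-- The homogeneous Sylvester equation `X Γ + Γ X = 0` only has the trivial solution if no two
eigenvalues of `Γ` add up to zero. -/
lemma sylvester_unique {Γ X : Matrix ι ι ℂ}
    (hk : ∀ x ∈ spectrum ℂ Γ, ∀ y ∈ spectrum ℂ Γ, x + y ≠ 0) (h : X * Γ + Γ * X = 0) : X = 0 := by
  -- The relation `Γ X = X (-Γ)` extends to polynomials in `Γ`. For the characteristic polynomial
  -- `χ` of `Γ`, Cayley–Hamilton gives `X χ(-Γ) = 0`, and spectral mapping shows that `χ(-Γ)` is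
  -- invertible because no two eigenvalues sum to zero.
  have hpow : ∀ k : ℕ, Γ ^ k * X = X * (-Γ) ^ k := by
    intro k
    induction k with
    | zero => simp
    | succ k ih =>
      have h' : Γ * X = X * -Γ := by rw [mul_neg]; exact eq_neg_of_add_eq_zero_right h
      rw [pow_succ, mul_assoc, h', ← mul_assoc, ih, mul_assoc, ← pow_succ]
  have hpoly : ∀ f : Polynomial ℂ, Polynomial.aeval Γ f * X = X * Polynomial.aeval (-Γ) f := by
    intro f
    induction f using Polynomial.induction_on' with
    | add f g hf hg => simp [add_mul, mul_add, hf, hg]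
    | monomial k z =>
      rw [Polynomial.aeval_monomial, Polynomial.aeval_monomial, mul_assoc, hpow,
        Algebra.algebraMap_eq_smul_one]
      simp
  have h0 : X * Polynomial.aeval (-Γ) Γ.charpoly = 0 := by
    rw [← hpoly, Matrix.aeval_self_charpoly, zero_mul]
  by_cases hι : Nonempty ι
  · have hu : IsUnit (Polynomial.aeval (-Γ) Γ.charpoly) := by
      rw [← spectrum.zero_notMem_iff ℂ, spectrum.map_polynomial_aeval_of_nonempty _ _
        (spectrum.nonempty_of_isAlgClosed_of_finiteDimensional ℂ _)]
      rintro ⟨x, hx, hx0⟩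
      have h1 : x ∈ spectrum ℂ Γ := by
        rw [Matrix.mem_spectrum_iff_isRoot_charpoly]
        exact hx0
      have h2 : -x ∈ spectrum ℂ Γ := by
        rw [← spectrum.neg_eq] at hx
        simpa using hx
      exact hk x h1 (-x) h2 (by ring)
    exact (hu.mul_left_eq_zero).1 h0
  · ext i
    exact (hι ⟨i⟩).elim

/-- `X` is a function of `Γ`, in the sense that it inherits commutation relations from `Γ`. -/
structure IsFun (Γ X : Matrix ι ι ℂ) : Prop where
  comm : ∀ F, Commute Γ F → Commute X F
  symm : ∀ H, H * Γ = Γᵀ * H → H * X = Xᵀ * H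

namespace IsFun

variable {Γ X Y : Matrix ι ι ℂ}

lemma one : IsFun Γ 1 := ⟨fun F _ => Commute.one_left F, fun H _ => by simp⟩

lemma self : IsFun Γ Γ := ⟨fun _ h => h, fun _ h => h⟩

lemma add (hX : IsFun Γ X) (hY : IsFun Γ Y) : IsFun Γ (X + Y) :=
  ⟨fun F h => (hX.comm F h).add_left (hY.comm F h),
    fun H h => by rw [mul_add, hX.symm H h, hY.symm H h, transpose_add, add_mul]⟩

lemma smul (a : ℂ) (hX : IsFun Γ X) : IsFun Γ (a • X) :=
  ⟨fun F h => (hX.comm F h).smul_left a,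
    fun H h => by rw [mul_smul_comm, hX.symm H h, transpose_smul, smul_mul_assoc]⟩

lemma mul (hX : IsFun Γ X) (hY : IsFun Γ Y) : IsFun Γ (X * Y) :=
  ⟨fun F h => (hX.comm F h).mul_left (hY.comm F h), fun H h => by
    -- A double commutant argument: `Y` commutes with `Γ`, hence with everything inheriting
    -- commutation from `Γ`.
    have hXY : Commute X Y := hX.comm Y (hY.comm Γ (Commute.refl Γ)).symm
    rw [hXY.eq, ← mul_assoc, hY.symm H h, mul_assoc, hX.symm H h, ← mul_assoc, ← transpose_mul,
      hXY.eq]⟩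

lemma inv (hX : IsFun Γ X) (hu : IsUnit X) : IsFun Γ X⁻¹ := by
  have hd := (Matrix.isUnit_iff_isUnit_det X).1 hu
  have hd' : IsUnit Xᵀ.det := by rwa [det_transpose]
  refine ⟨fun F h => ?_, fun H h => ?_⟩
  · have h1 := (hX.comm F h).eq
    calc X⁻¹ * F = X⁻¹ * (F * X) * X⁻¹ := by
          rw [mul_assoc, mul_assoc, Matrix.mul_nonsing_inv X hd, mul_one]
      _ = F * X⁻¹ := by rw [← h1, ← mul_assoc, Matrix.nonsing_inv_mul X hd, one_mul]
  · have h1 := hX.symm H h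
    calc H * X⁻¹ = Xᵀ⁻¹ * (Xᵀ * H) * X⁻¹ := by
          rw [← mul_assoc, Matrix.nonsing_inv_mul _ hd', one_mul]
      _ = X⁻¹ᵀ * H := by
          rw [← h1, mul_assoc, mul_assoc, Matrix.mul_nonsing_inv X hd, mul_one,
            transpose_nonsing_inv]

end IsFun

/-- The resolvent `(a I + Γ)⁻¹`. -/
noncomputable def res (Γ : Matrix ι ι ℂ) (a : ℂ) : Matrix ι ι ℂ :=
  (a • (1 : Matrix ι ι ℂ) + Γ)⁻¹

/-- The bracket `c Y (I + M)⁻¹ X r`. -/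
noncomputable def br (c r : ι → ℂ) (M X Y : Matrix ι ι ℂ) : ℂ :=
  c ⬝ᵥ (Y * (1 + M)⁻¹ * X) *ᵥ r

variable {c r : ι → ℂ} {M : Matrix ι ι ℂ} {Γ : Matrix ι ι ℂ}

lemma br_add_left (X X' Y : Matrix ι ι ℂ) :
    br c r M (X + X') Y = br c r M X Y + br c r M X' Y := by
  simp [br, mul_add, add_mulVec, dotProduct_add]

lemma br_sub_right (X Y Y' : Matrix ι ι ℂ) :
    br c r M X (Y - Y') = br c r M X Y - br c r M X Y' := by
  simp [br, sub_mul, sub_mulVec, dotProduct_sub]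

lemma br_smul_left (t : ℂ) (X Y : Matrix ι ι ℂ) :
    br c r M (t • X) Y = t * br c r M X Y := by
  simp [br, smul_mulVec, dotProduct_smul]

lemma br_smul_right (t : ℂ) (X Y : Matrix ι ι ℂ) :
    br c r M X (t • Y) = t * br c r M X Y := by
  simp [br, smul_mulVec, dotProduct_smul]

lemma isFun_res {a : ℂ} (ha : IsUnit (a • (1 : Matrix ι ι ℂ) + Γ)) : IsFun Γ (res Γ a) :=
  ((IsFun.one.smul a).add IsFun.self).inv ha

lemma add_mul_res {a : ℂ} (ha : IsUnit (a • (1 : Matrix ι ι ℂ) + Γ)) (p : ℂ) :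
    (p • (1 : Matrix ι ι ℂ) + Γ) * res Γ a = (p - a) • res Γ a + 1 := by
  have h1 : (a • (1 : Matrix ι ι ℂ) + Γ) * res Γ a = 1 :=
    Matrix.mul_nonsing_inv _ ((Matrix.isUnit_iff_isUnit_det _).1 ha)
  rw [show p • (1 : Matrix ι ι ℂ) + Γ = (p - a) • 1 + (a • 1 + Γ) by module, add_mul, h1,
    smul_mul_assoc, one_mul]

lemma res_mul_sub {a : ℂ} (ha : IsUnit (a • (1 : Matrix ι ι ℂ) + Γ)) (p : ℂ) :
    res Γ a * (p • (1 : Matrix ι ι ℂ) - Γ) = (p + a) • res Γ a - 1 := by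
  have h1 : res Γ a * (a • (1 : Matrix ι ι ℂ) + Γ) = 1 :=
    Matrix.nonsing_inv_mul _ ((Matrix.isUnit_iff_isUnit_det _).1 ha)
  rw [show p • (1 : Matrix ι ι ℂ) - Γ = (p + a) • 1 - (a • 1 + Γ) by module, mul_sub, h1,
    mul_smul_comm, mul_one]

lemma add_mul_res_sq {a : ℂ} (ha : IsUnit (a • (1 : Matrix ι ι ℂ) + Γ)) (p : ℂ) :
    (p • (1 : Matrix ι ι ℂ) + Γ) * res Γ a ^ 2 = (p - a) • res Γ a ^ 2 + res Γ a := by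
  rw [sq, ← mul_assoc, add_mul_res ha, add_mul, one_mul, smul_mul_assoc]

lemma res_sq_mul_sub {a : ℂ} (ha : IsUnit (a • (1 : Matrix ι ι ℂ) + Γ)) (p : ℂ) :
    res Γ a ^ 2 * (p • (1 : Matrix ι ι ℂ) - Γ) = (p + a) • res Γ a ^ 2 - res Γ a := by
  rw [sq, mul_assoc, res_mul_sub ha, mul_sub, mul_one, mul_smul_comm]

/-- The bracket is symmetric if the data factorise through a symmetric Cauchy matrix `G`. -/
lemma br_symm {F G H : Matrix ι ι ℂ} {e : ι → ℂ} (hr : r = F *ᵥ e) (hc : c = e ᵥ* H)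
    (hM : M = F * G * H) (hF : Commute Γ F) (hH : H * Γ = Γᵀ * H) (hHF : H * F = Fᵀ * H)
    (hHs : Hᵀ = H) (hGs : Gᵀ = G) (hu : IsUnit (1 + M)) {X Y : Matrix ι ι ℂ} (hX : IsFun Γ X)
    (hY : IsFun Γ Y) : br c r M X Y = br c r M Y X := by
  set A := 1 + M with hA
  set L := H * F with hL
  set B := 1 + G * L with hB
  have hdA : IsUnit A.det := (Matrix.isUnit_iff_isUnit_det _).1 hu
  have hdB : IsUnit B.det := by
    have : A.det = B.det := by
      rw [hA, hB, hM, hL, mul_assoc, Matrix.det_one_add_mul_comm, mul_assoc]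
    rwa [← this]
  have hLs : Lᵀ = L := by rw [hL, transpose_mul, hHs, ← hHF]
  have hAF : A⁻¹ * F = F * B⁻¹ := by
    have h1 : A * F = F * B := by
      rw [hA, hB, hM, hL]; noncomm_ring
    calc A⁻¹ * F = A⁻¹ * (F * B) * B⁻¹ := by
          rw [mul_assoc, mul_assoc, Matrix.mul_nonsing_inv _ hdB, mul_one]
      _ = F * B⁻¹ := by rw [← h1, ← mul_assoc, Matrix.nonsing_inv_mul _ hdA, one_mul]
  have hdB' : IsUnit Bᵀ.det := by rwa [det_transpose]
  have hK : (L * B⁻¹)ᵀ = L * B⁻¹ := by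
    have h1 : Bᵀ * L = L * B := by
      rw [hB, transpose_add, transpose_mul, hLs, hGs, transpose_one]; noncomm_ring
    rw [transpose_mul, hLs, transpose_nonsing_inv]
    calc Bᵀ⁻¹ * L = Bᵀ⁻¹ * (L * B) * B⁻¹ := by
          rw [mul_assoc, mul_assoc, Matrix.mul_nonsing_inv _ hdB, mul_one]
      _ = L * B⁻¹ := by rw [← h1, ← mul_assoc, Matrix.nonsing_inv_mul _ hdB', one_mul]
  -- Moving `F` through the inverse replaces `(1 + M)⁻¹` by `B⁻¹` and leaves the symmetric kernel `L
  -- B⁻¹` between `Yᵀ` and `X`. The bracket is thus a symmetric bilinear form in `X e` and `Y e`.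
  have form : ∀ X Y : Matrix ι ι ℂ, IsFun Γ X → IsFun Γ Y →
      br c r M X Y = e ⬝ᵥ (Yᵀ * (L * B⁻¹) * X) *ᵥ e := by
    intro X Y hX hY
    have h1 : H * (Y * A⁻¹ * X) * F = Yᵀ * (L * B⁻¹) * X := by
      calc H * (Y * A⁻¹ * X) * F = (H * Y) * A⁻¹ * (X * F) := by noncomm_ring
        _ = Yᵀ * H * (A⁻¹ * F) * X := by
          rw [hY.symm H hH, (hX.comm F hF).eq]; noncomm_ring
        _ = Yᵀ * (L * B⁻¹) * X := by rw [hAF, hL]; noncomm_ring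
    rw [br, ← hA, hr, hc, ← h1, ← dotProduct_mulVec, mulVec_mulVec, mulVec_mulVec, ← mul_assoc]
  rw [form X Y hX hY, form Y X hY hX]
  rw [dotProduct_mulVec, ← mulVec_transpose, transpose_mul, transpose_mul, hK, transpose_transpose,
    dotProduct_comm]
  simp only [mul_assoc]

/-- Solutions of the Sylvester equation follow the shift of their right-hand sides. -/
lemma sylvester_shift {p : ℂ} {r' : ι → ℂ} {M' : Matrix ι ι ℂ}
    (hk : ∀ x ∈ spectrum ℂ Γ, ∀ y ∈ spectrum ℂ Γ, x + y ≠ 0)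
    (hr : (p • (1 : Matrix ι ι ℂ) - Γ) *ᵥ r' = (p • (1 : Matrix ι ι ℂ) + Γ) *ᵥ r)
    (hM : M * Γ + Γ * M = vecMulVec r c) (hM' : M' * Γ + Γ * M' = vecMulVec r' c) :
    (p • (1 : Matrix ι ι ℂ) - Γ) * M' = (p • (1 : Matrix ι ι ℂ) + Γ) * M := by
  rw [← sub_eq_zero]
  apply sylvester_unique hk
  have h1 : (p • (1 : Matrix ι ι ℂ) - Γ) * (M' * Γ + Γ * M')
      = (p • (1 : Matrix ι ι ℂ) + Γ) * (M * Γ + Γ * M) := by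
    rw [hM, hM', mul_vecMulVec, mul_vecMulVec, hr]
  rw [← sub_eq_zero] at h1
  rw [← h1]
  simp only [sub_mul, add_mul, mul_sub, mul_add, smul_mul_assoc, one_mul, mul_smul_comm,
    mul_assoc]
  abel

/-- The shift relation of the bracket along an edge. -/
lemma br_shift {p : ℂ} {r' : ι → ℂ} {M' : Matrix ι ι ℂ}
    (hr : (p • (1 : Matrix ι ι ℂ) - Γ) *ᵥ r' = (p • (1 : Matrix ι ι ℂ) + Γ) *ᵥ r)
    (hM : M * Γ + Γ * M = vecMulVec r c)
    (hMM : (p • (1 : Matrix ι ι ℂ) - Γ) * M' = (p • (1 : Matrix ι ι ℂ) + Γ) * M)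
    (hu : IsUnit (1 + M)) (hu' : IsUnit (1 + M')) {X : Matrix ι ι ℂ} (hX : IsFun Γ X)
    (Y : Matrix ι ι ℂ) :
    br c r' M' X (Y * (p • (1 : Matrix ι ι ℂ) - Γ))
      = br c r M ((p • (1 : Matrix ι ι ℂ) + Γ) * X) Y - br c r' M' X 1 * br c r M 1 Y := by
  have hd := (Matrix.isUnit_iff_isUnit_det _).1 hu
  have hd' := (Matrix.isUnit_iff_isUnit_det _).1 hu'
  have hXG : Commute X Γ := hX.comm Γ (Commute.refl Γ)
  -- The Sylvester equation makes the failure of `p - Γ` to intertwine `1 + M` with `1 + M'` a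
  -- rank-one matrix; this becomes the product of brackets.
  have h1 : (1 + M) * (p • (1 : Matrix ι ι ℂ) - Γ) + vecMulVec r c
      = (p • (1 : Matrix ι ι ℂ) - Γ) * (1 + M') := by
    rw [mul_add, hMM, ← hM]
    simp only [add_mul, mul_sub, mul_smul_comm, mul_one, one_mul, smul_mul_assoc, smul_add]
    abel
  have hcm : Commute X (p • (1 : Matrix ι ι ℂ) - Γ) :=
    ((Commute.one_right X).smul_right p).sub_right hXG
  have hcp : Commute X (p • (1 : Matrix ι ι ℂ) + Γ) :=
    ((Commute.one_right X).smul_right p).add_right hXG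
  set w := ((1 + M')⁻¹ * X) *ᵥ r' with hw
  have h2 : (1 + M) *ᵥ ((p • (1 : Matrix ι ι ℂ) - Γ) *ᵥ w) + (c ⬝ᵥ w) • r
      = ((p • (1 : Matrix ι ι ℂ) + Γ) * X) *ᵥ r := by
    have h3 : (c ⬝ᵥ w) • r = vecMulVec r c *ᵥ w := by
      rw [vecMulVec_mulVec]; ext i; simp [mul_comm]
    rw [h3, mulVec_mulVec, ← add_mulVec, h1, hw, mulVec_mulVec, mul_assoc, ← mul_assoc (1 + M'),
      Matrix.mul_nonsing_inv _ hd', one_mul, ← hcm.eq, ← mulVec_mulVec, hr, mulVec_mulVec, hcp.eq]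
  have h4 : (p • (1 : Matrix ι ι ℂ) - Γ) *ᵥ w
      = ((1 + M)⁻¹ * ((p • (1 : Matrix ι ι ℂ) + Γ) * X)) *ᵥ r - (c ⬝ᵥ w) • (1 + M)⁻¹ *ᵥ r := by
    rw [← mulVec_mulVec, ← h2, mulVec_add, mulVec_mulVec _ (1 + M)⁻¹ (1 + M),
      Matrix.nonsing_inv_mul _ hd, one_mulVec, mulVec_smul, add_sub_cancel_right]
  have h5 : br c r' M' X 1 = c ⬝ᵥ w := by rw [br, one_mul, hw]
  have h6 : br c r' M' X (Y * (p • (1 : Matrix ι ι ℂ) - Γ))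
      = c ⬝ᵥ Y *ᵥ ((p • (1 : Matrix ι ι ℂ) - Γ) *ᵥ w) := by
    rw [br, hw, mulVec_mulVec, mulVec_mulVec]; simp only [mul_assoc]
  rw [h6, h4, h5, mulVec_sub, mulVec_smul, dotProduct_sub, dotProduct_smul, mulVec_mulVec,
    mulVec_mulVec, br, br, mul_one, smul_eq_mul]
  simp only [mul_assoc]

/-- The scalar quantities attached to the data at a vertex. -/
noncomputable def vertexOf (Γ : Matrix ι ι ℂ) (c r : ι → ℂ) (M : Matrix ι ι ℂ) : Vertex where
  S0 := br c r M 1 1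
  T0 := br c r M 1 Γ
  S a b := br c r M (res Γ a) (res Γ b)
  Z a b := br c r M (res Γ a) (res Γ b ^ 2)
  X a b := br c r M (res Γ a ^ 2) (res Γ b ^ 2)
  V a := 1 - br c r M (res Γ a) 1
  Y a := br c r M (res Γ a ^ 2) 1
  T a := br c r M (res Γ a) Γ
  T2 a := br c r M (res Γ a ^ 2) Γ

/-- Every shift relation is `br_shift` for `X`, `Y` chosen among `1`, a resolvent and its square.
The resolvent identities absorb the factors `p ± Γ`, and symmetry puts the arguments in the order
fixed by `Vertex`. -/
lemma edgeRel_vertexOf {p : ℂ} {r' : ι → ℂ} {M' : Matrix ι ι ℂ}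
    (hk : ∀ x ∈ spectrum ℂ Γ, ∀ y ∈ spectrum ℂ Γ, x + y ≠ 0)
    (hr : (p • (1 : Matrix ι ι ℂ) - Γ) *ᵥ r' = (p • (1 : Matrix ι ι ℂ) + Γ) *ᵥ r)
    (hM : M * Γ + Γ * M = vecMulVec r c) (hM' : M' * Γ + Γ * M' = vecMulVec r' c)
    (hu : IsUnit (1 + M)) (hu' : IsUnit (1 + M'))
    (hs : ∀ X Y, IsFun Γ X → IsFun Γ Y → br c r M X Y = br c r M Y X)
    (hs' : ∀ X Y, IsFun Γ X → IsFun Γ Y → br c r' M' X Y = br c r' M' Y X) :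
    EdgeRel (fun a => IsUnit (a • (1 : Matrix ι ι ℂ) + Γ)) p (vertexOf Γ c r M)
      (vertexOf Γ c r' M') := by
  have key := fun X (hX : IsFun Γ X) Y =>
    br_shift hr hM (sylvester_shift hk hr hM hM') hu hu' hX Y
  have f1 : IsFun Γ (1 : Matrix ι ι ℂ) := IsFun.one
  have fΓ : IsFun Γ Γ := IsFun.self
  have fR := fun a (ha : IsUnit (a • (1 : Matrix ι ι ℂ) + Γ)) => isFun_res ha
  have fR2 : ∀ a, IsUnit (a • (1 : Matrix ι ι ℂ) + Γ) → IsFun Γ (res Γ a ^ 2) := fun a ha => by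
    rw [sq]; exact (fR a ha).mul (fR a ha)
  constructor <;> dsimp only [vertexOf]
  · have h := key 1 f1 1
    rw [one_mul, mul_one, br_sub_right, br_smul_right, br_add_left, br_smul_left, hs Γ 1 fΓ f1] at h
    linear_combination h
  · intro a ha
    have h := key 1 f1 (res Γ a)
    rw [res_mul_sub ha, mul_one, br_sub_right, br_smul_right, br_add_left, br_smul_left,
      hs 1 _ f1 (fR a ha), hs' 1 _ f1 (fR a ha), hs Γ _ fΓ (fR a ha)] at h
    linear_combination -h
  · intro a ha
    have h := key _ (fR a ha) 1
    rw [one_mul, add_mul_res ha, br_sub_right, br_smul_right, br_add_left, br_smul_left] at h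
    linear_combination -h
  · intro a ha
    have h := key 1 f1 (res Γ a ^ 2)
    rw [res_sq_mul_sub ha, mul_one, br_sub_right, br_smul_right, br_add_left, br_smul_left,
      hs 1 _ f1 (fR2 a ha), hs' 1 _ f1 (fR2 a ha), hs' 1 _ f1 (fR a ha), hs Γ _ fΓ (fR2 a ha)] at h
    linear_combination h
  · intro a ha
    have h := key _ (fR2 a ha) 1
    rw [one_mul, add_mul_res_sq ha, br_sub_right, br_smul_right, br_add_left, br_smul_left] at h
    linear_combination h
  · intro a b ha hb
    have h := key _ (fR a ha) (res Γ b)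
    rw [res_mul_sub hb, add_mul_res ha, br_sub_right, br_smul_right, br_add_left, br_smul_left,
      hs 1 _ f1 (fR b hb)] at h
    linear_combination -h
  · intro a b ha hb
    have h := key _ (fR a ha) (res Γ b ^ 2)
    rw [res_sq_mul_sub hb, add_mul_res ha, br_sub_right, br_smul_right, br_add_left, br_smul_left,
      hs 1 _ f1 (fR2 b hb)] at h
    linear_combination h
  · intro a b ha hb
    have h := key _ (fR2 b hb) (res Γ a)
    rw [res_mul_sub ha, add_mul_res_sq hb, br_sub_right, br_smul_right, br_add_left, br_smul_left,
      hs 1 _ f1 (fR a ha), hs' _ _ (fR2 b hb) (fR a ha), hs _ _ (fR2 b hb) (fR a ha),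
      hs _ _ (fR b hb) (fR a ha)] at h
    linear_combination h
  · intro a b ha hb
    have h := key _ (fR2 a ha) (res Γ b ^ 2)
    rw [res_sq_mul_sub hb, add_mul_res_sq ha, br_sub_right, br_smul_right, br_add_left,
      br_smul_left, hs 1 _ f1 (fR2 b hb), hs' _ _ (fR2 a ha) (fR b hb)] at h
    linear_combination h
  · exact fun a b ha hb => hs _ _ (fR a ha) (fR b hb)
  · exact fun a b ha hb => hs' _ _ (fR a ha) (fR b hb)
  · exact fun a b ha hb => hs _ _ (fR2 a ha) (fR2 b hb)
  · exact fun a b ha hb => hs' _ _ (fR2 a ha) (fR2 b hb)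

end Bracket


/-! ### Taylor coefficients of the plain wave factors -/

/-- Leibniz' rule for an affine factor has only two terms. The function is quantified after `l`
because the induction passes to its derivative; at `l = 0` the truncated `l - 1` is harmless, its
coefficient being zero. -/
lemma iteratedDeriv_linear_mul (b ε k : ℂ) (l : ℕ) :
    ∀ f : ℂ → ℂ, AnalyticAt ℂ f k → iteratedDeriv l (fun κ => (b + ε * κ) * f κ) k
      = (b + ε * k) * iteratedDeriv l f k + l * ε * iteratedDeriv (l - 1) f k := by
  induction l with
  | zero => intro f _; simp
  | succ l ih =>
    intro f hf
    have h1 : deriv (fun κ => (b + ε * κ) * f κ)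
        =ᶠ[nhds k] ((fun κ => ε * f κ) + fun κ => (b + ε * κ) * deriv f κ) := by
      filter_upwards [hf.eventually_analyticAt] with κ hκ
      have hd : HasDerivAt (fun κ => (b + ε * κ) * f κ)
          (ε * 1 * f κ + (b + ε * κ) * deriv f κ) κ :=
        (((hasDerivAt_id κ).const_mul ε).const_add b).mul hκ.differentiableAt.hasDerivAt
      rw [hd.deriv]
      simp
    have h2 : AnalyticAt ℂ (fun κ => ε * f κ) k := analyticAt_const.mul hf
    have h3 : AnalyticAt ℂ (fun κ => (b + ε * κ) * deriv f κ) k :=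
      (analyticAt_const.add (analyticAt_const.mul analyticAt_id)).mul hf.deriv
    rw [iteratedDeriv_succ', h1.iteratedDeriv_eq, iteratedDeriv_add h2.contDiffAt h3.contDiffAt,
      iteratedDeriv_const_mul_field, ih _ hf.deriv, ← iteratedDeriv_succ', Nat.add_sub_cancel]
    rcases l with _ | l
    · simp; ring
    · rw [Nat.add_sub_cancel, ← iteratedDeriv_succ']
      push_cast
      ring

/-- The numerators must not vanish either, since the exponents may be negative. -/
lemma analyticAt_rho {p q k : ℂ} (ρ₀ : ℂ) (n m : ℤ) (h1 : p - k ≠ 0) (h2 : p + k ≠ 0)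
    (h3 : q - k ≠ 0) (h4 : q + k ≠ 0) : AnalyticAt ℂ (fun κ => rho p q κ ρ₀ n m) k := by
  unfold rho
  have hp : AnalyticAt ℂ (fun κ => (p + κ) / (p - κ)) k :=
    (analyticAt_const.add analyticAt_id).div (analyticAt_const.sub analyticAt_id) h1
  have hq : AnalyticAt ℂ (fun κ => (q + κ) / (q - κ)) k :=
    (analyticAt_const.add analyticAt_id).div (analyticAt_const.sub analyticAt_id) h3
  exact ((hp.fun_zpow (div_ne_zero h2 h1)).mul (hq.fun_zpow (div_ne_zero h4 h3))).mul
    analyticAt_const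

lemma rho_succ_left {p q k : ℂ} (ρ₀ : ℂ) (n m : ℤ) (h1 : p - k ≠ 0) (h2 : p + k ≠ 0) :
    rho p q k ρ₀ (n + 1) m = (p + k) / (p - k) * rho p q k ρ₀ n m := by
  unfold rho
  rw [zpow_add_one₀ (div_ne_zero h2 h1)]
  ring

lemma rho_succ_right {p q k : ℂ} (ρ₀ : ℂ) (n m : ℤ) (h1 : q - k ≠ 0) (h2 : q + k ≠ 0) :
    rho p q k ρ₀ n (m + 1) = (q + k) / (q - k) * rho p q k ρ₀ n m := by
  unfold rho
  rw [zpow_add_one₀ (div_ne_zero h2 h1)]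
  ring

/-- Taylor coefficients turn multiplication by `κ` into a Jordan block. -/
lemma taylor_shift {p k : ℂ} {f g : ℂ → ℂ} (hf : AnalyticAt ℂ f k) (hg : AnalyticAt ℂ g k)
    (h : ∀ᶠ κ in nhds k, (p - κ) * g κ = (p + κ) * f κ) (l : ℕ) :
    p * (iteratedDeriv l g k / (l ! : ℂ)) - (k * (iteratedDeriv l g k / (l ! : ℂ))
        + if l = 0 then 0 else iteratedDeriv (l - 1) g k / ((l - 1)! : ℂ))
      = p * (iteratedDeriv l f k / (l ! : ℂ)) + (k * (iteratedDeriv l f k / (l ! : ℂ))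
        + if l = 0 then 0 else iteratedDeriv (l - 1) f k / ((l - 1)! : ℂ)) := by
  have h1 : (fun κ => (p + -1 * κ) * g κ) =ᶠ[nhds k] fun κ => (p + 1 * κ) * f κ := by
    filter_upwards [h] with κ hκ
    linear_combination hκ
  have h2 := h1.iteratedDeriv_eq l
  rw [iteratedDeriv_linear_mul _ _ _ _ _ hg, iteratedDeriv_linear_mul _ _ _ _ _ hf] at h2
  have hl : (l ! : ℂ) ≠ 0 := by exact_mod_cast Nat.factorial_ne_zero l
  rcases l with _ | l
  · simp at h2 ⊢
    linear_combination h2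
  · have hl' : (l ! : ℂ) ≠ 0 := by exact_mod_cast Nat.factorial_ne_zero l
    have hl1 : (l : ℂ) + 1 ≠ 0 := by exact_mod_cast Nat.succ_ne_zero l
    simp only [Nat.add_sub_cancel, Nat.succ_ne_zero, if_false, Nat.factorial_succ] at h2 ⊢
    push_cast at h2 ⊢
    field_simp
    linear_combination h2

/-! ### Toeplitz, Hankel and Jordan blocks -/

/-- The nilpotent lower shift matrix. -/
def lowerShift (d : ℕ) : Matrix (Fin d) (Fin d) ℂ :=
  Matrix.of fun i l => if (i : ℕ) = (l : ℕ) + 1 then 1 else 0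

lemma lowerShift_pow_apply (d k : ℕ) (i l : Fin d) :
    (lowerShift d ^ k) i l = if (i : ℕ) = (l : ℕ) + k then 1 else 0 := by
  induction k generalizing i l with
  | zero => simp [Matrix.one_apply, Fin.ext_iff]
  | succ k ih =>
    rw [pow_succ, Matrix.mul_apply]
    have hL : ∀ j : Fin d, lowerShift d j l = if (j : ℕ) = (l : ℕ) + 1 then 1 else 0 :=
      fun _ => rfl
    simp only [ih, hL]
    by_cases h : (l : ℕ) + 1 < d
    · rw [Finset.sum_eq_single ⟨(l : ℕ) + 1, h⟩]
      · simp [add_assoc, add_comm 1 k]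
      · intro j _ hj
        have : (j : ℕ) ≠ l + 1 := fun h' => hj (Fin.ext h')
        simp [this]
      · simp
    · have h1 : (i : ℕ) ≠ l + (k + 1) := by have := i.2; omega
      rw [if_neg h1]
      apply Finset.sum_eq_zero
      intro j _
      have : (j : ℕ) ≠ l + 1 := by have := j.2; omega
      simp [this]

/-- As polynomials in one nilpotent matrix, Toeplitz blocks commute, and their relation to Hankel
blocks needs checking only for the shift. -/
lemma toeplitz_eq_sum (d : ℕ) (α : ℕ → ℂ) :
    toeplitz d α = ∑ k ∈ Finset.range d, α k • lowerShift d ^ k := by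
  ext i l
  rw [Matrix.sum_apply]
  simp only [Matrix.smul_apply, lowerShift_pow_apply, toeplitz, Matrix.of_apply, smul_eq_mul,
    mul_ite, mul_one, mul_zero]
  by_cases h : l ≤ i
  · rw [if_pos h, Finset.sum_eq_single ((i : ℕ) - l)]
    · rw [if_pos (by have := Fin.le_def.1 h; omega)]
    · intro k _ hk
      rw [if_neg (by omega)]
    · intro hk
      exact absurd (Finset.mem_range.2 (by have := i.2; omega)) hk
  · rw [if_neg h, Finset.sum_eq_zero]
    intro k _
    rw [if_neg (fun h' => h (Fin.le_def.2 (by omega)))]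

lemma toeplitz_commute (d : ℕ) (α β : ℕ → ℂ) : Commute (toeplitz d α) (toeplitz d β) := by
  rw [toeplitz_eq_sum, toeplitz_eq_sum]
  refine Commute.sum_left _ _ _ fun k _ => Commute.sum_right _ _ _ fun l _ => ?_
  exact (((Commute.refl (lowerShift d)).pow_pow k l).smul_left _).smul_right _

lemma hankel_transpose (d : ℕ) (c : Fin d → ℂ) : (hankel d c)ᵀ = hankel d c := by
  ext i l
  simp [hankel, add_comm]

/-- The product with the shift is again a Hankel matrix, with entries depending on `i + l` alone. It
is therefore symmetric, and transposing it moves the shift to the other side. -/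
lemma hankel_mul_lowerShift (d : ℕ) (c : Fin d → ℂ) :
    hankel d c * lowerShift d = (lowerShift d)ᵀ * hankel d c := by
  have h1 : ∀ i l : Fin d, (hankel d c * lowerShift d) i l
      = if h : (i : ℕ) + l + 1 < d then c ⟨(i : ℕ) + l + 1, h⟩ else 0 := by
    intro i l
    rw [Matrix.mul_apply]
    by_cases h : (l : ℕ) + 1 < d
    · rw [Finset.sum_eq_single ⟨(l : ℕ) + 1, h⟩]
      · simp [hankel, lowerShift, add_assoc]
      · intro j _ hj
        have : (j : ℕ) ≠ l + 1 := fun h' => hj (Fin.ext h')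
        simp [lowerShift, this]
      · simp
    · rw [dif_neg (by omega)]
      apply Finset.sum_eq_zero
      intro j _
      have : (j : ℕ) ≠ l + 1 := by have := j.2; omega
      simp [lowerShift, this]
  have h2 : (hankel d c * lowerShift d)ᵀ = hankel d c * lowerShift d := by
    ext i l
    rw [transpose_apply, h1, h1]
    simp [add_comm]
  rw [← h2, transpose_mul, hankel_transpose]

lemma hankel_mul_toeplitz (d : ℕ) (c : Fin d → ℂ) (α : ℕ → ℂ) :
    hankel d c * toeplitz d α = (toeplitz d α)ᵀ * hankel d c := by
  have hk : ∀ k, hankel d c * lowerShift d ^ k = (lowerShift d ^ k)ᵀ * hankel d c := by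
    intro k
    induction k with
    | zero => simp
    | succ k ih =>
      rw [pow_succ, ← mul_assoc, ih, mul_assoc, hankel_mul_lowerShift, ← mul_assoc,
        ← transpose_mul, ← pow_succ', pow_succ]
  rw [toeplitz_eq_sum, Finset.mul_sum, transpose_sum, Finset.sum_mul]
  refine Finset.sum_congr rfl fun k _ => ?_
  rw [mul_smul_comm, hk, transpose_smul, smul_mul_assoc]

lemma jordan_eq_toeplitz (d : ℕ) (k : ℂ) :
    jordan d k = toeplitz d (fun l => if l = 0 then k else if l = 1 then 1 else 0) := by
  ext i l
  simp only [jordan, toeplitz, Matrix.of_apply, Fin.ext_iff, Fin.le_def]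
  split_ifs <;> first | rfl | omega

lemma jordan_mulVec (d : ℕ) (k : ℂ) (f : ℕ → ℂ) (i : Fin d) :
    (jordan d k *ᵥ fun l => f l) i = k * f i + if (i : ℕ) = 0 then 0 else f (i - 1) := by
  have h : ∀ l : Fin d, jordan d k i l * f l
      = (if i = l then k * f l else 0) + if (i : ℕ) = (l : ℕ) + 1 then f l else 0 := by
    intro l
    simp only [jordan, Matrix.of_apply, Fin.ext_iff]
    split_ifs <;> first | omega | simp
  rw [Matrix.mulVec, dotProduct, Finset.sum_congr rfl fun l _ => h l, Finset.sum_add_distrib,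
    Finset.sum_ite_eq]
  simp only [Finset.mem_univ, if_true]
  congr 1
  by_cases hi : (i : ℕ) = 0
  · rw [if_pos hi]
    exact Finset.sum_eq_zero fun l _ => if_neg (by omega)
  · rw [if_neg hi, Finset.sum_eq_single ⟨(i : ℕ) - 1, by have := i.2; omega⟩]
    · rw [if_pos (by simp only; omega)]
    · intro l _ hl
      exact if_neg fun h' => hl (Fin.ext (by simp only; omega))
    · simp


/-! ### The generic canonical matrix -/

section Canonical

variable {N₁ s : ℕ} {N : Fin s → ℕ}

/-- `Diag(d, T₁, …, Tₛ)` with lower triangular Toeplitz blocks `Tⱼ`. -/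
def blockToeplitz (d : Fin N₁ → ℂ) (α : Fin s → ℕ → ℂ) : Matrix (Idx N₁ N) (Idx N₁ N) ℂ :=
  fromBlocks (diagonal d) 0 0 (blockDiagonal' fun j => toeplitz (N j) (α j))

/-- The vector with entries `1` on the diagonal part and `(1, 0, …, 0)` on each Jordan block. -/
def cyclicVec : Idx N₁ N → ℂ :=
  Sum.elim (fun _ => 1) (fun x => if (x.2 : ℕ) = 0 then 1 else 0)

/-- Places `Γ` in the same commutative family as `matF` and `matA`; all commutation with `Γ` is read
off from this. -/
lemma canonicalMatrix_eq (kD : Fin N₁ → ℂ) (kJ : Fin s → ℂ) :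
    canonicalMatrix (N := N) kD kJ
      = blockToeplitz kD (fun j l => if l = 0 then kJ j else if l = 1 then 1 else 0) := by
  simp only [canonicalMatrix, blockToeplitz, jordan_eq_toeplitz]

lemma matA_eq (α : Fin s → ℕ → ℂ) :
    matA (N₁ := N₁) (N := N) α = blockToeplitz (fun _ => 1) α := by
  simp only [matA, blockToeplitz, diagonal_one]

lemma blockToeplitz_commute (d d' : Fin N₁ → ℂ) (α α' : Fin s → ℕ → ℂ) :
    Commute (blockToeplitz (N := N) d α) (blockToeplitz d' α') := by
  have h : (fun j => toeplitz (N j) (α j) * toeplitz (N j) (α' j))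
      = fun j => toeplitz (N j) (α' j) * toeplitz (N j) (α j) :=
    funext fun j => (toeplitz_commute _ _ _).eq
  have h' : (fun i => d i * d' i) = fun i => d' i * d i := funext fun i => mul_comm _ _
  simp only [Commute, SemiconjBy, blockToeplitz, fromBlocks_multiply, Matrix.mul_zero, Matrix.zero_mul, add_zero,
    zero_add, diagonal_mul_diagonal, ← blockDiagonal'_mul, h, h']

lemma matH_transpose (c : Idx N₁ N → ℂ) : (matH c)ᵀ = matH c := by
  simp only [matH, fromBlocks_transpose, diagonal_transpose, blockDiagonal'_transpose,
    hankel_transpose, transpose_zero]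

lemma matH_mul_blockToeplitz (c : Idx N₁ N → ℂ) (d : Fin N₁ → ℂ) (α : Fin s → ℕ → ℂ) :
    matH c * blockToeplitz d α = (blockToeplitz d α)ᵀ * matH c := by
  simp only [matH, blockToeplitz, fromBlocks_transpose, fromBlocks_multiply, Matrix.mul_zero, Matrix.zero_mul,
    add_zero, zero_add, diagonal_mul_diagonal, diagonal_transpose, blockDiagonal'_transpose,
    ← blockDiagonal'_mul, hankel_mul_toeplitz, transpose_zero, mul_comm]

lemma blockDiagonal'_mulVec (A : ∀ j, Matrix (Fin (N j)) (Fin (N j)) ℂ)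
    (v : (Σ j : Fin s, Fin (N j)) → ℂ) (j : Fin s) (i : Fin (N j)) :
    (blockDiagonal' A *ᵥ v) ⟨j, i⟩ = (A j *ᵥ fun l => v ⟨j, l⟩) i := by
  rw [Matrix.mulVec, dotProduct, Fintype.sum_sigma, Finset.sum_eq_single j]
  · simp only [blockDiagonal'_apply_eq, Matrix.mulVec, dotProduct]
  · intro j' _ hj'
    exact Finset.sum_eq_zero fun l _ => by
      rw [blockDiagonal'_apply_ne A _ _ (Ne.symm hj'), zero_mul]
  · simp

/-- On each block the cyclic vector selects the first column, so any vector `r` is `F e` for some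
`F` in the family. Dually, `cyclicVec_vecMul_matH` recovers `c` as `e H`. -/
lemma blockToeplitz_mulVec_cyclicVec (d : Fin N₁ → ℂ) (α : Fin s → ℕ → ℂ) :
    blockToeplitz (N := N) d α *ᵥ cyclicVec = Sum.elim d (fun x => α x.1 x.2) := by
  rw [blockToeplitz, fromBlocks_mulVec]
  ext x
  rcases x with i | ⟨j, i⟩
  · simp [cyclicVec, mulVec_diagonal]
  · simp only [zero_mulVec, zero_add, Sum.elim_inr]
    rw [blockDiagonal'_mulVec, Matrix.mulVec, dotProduct]
    have h0 : 0 < N j := Nat.lt_of_le_of_lt (Nat.zero_le _) i.2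
    rw [Finset.sum_eq_single ⟨0, h0⟩]
    · have h1 : toeplitz (N j) (α j) i ⟨0, h0⟩ = α j i := by
        rw [toeplitz, Matrix.of_apply, if_pos (Fin.le_def.2 (Nat.zero_le _))]
        simp
      rw [h1]
      simp [cyclicVec]
    · intro l _ hl
      have : (l : ℕ) ≠ 0 := fun h => hl (Fin.ext h)
      simp [cyclicVec, this]
    · simp

lemma cyclicVec_vecMul_matH (c : Idx N₁ N → ℂ) : cyclicVec ᵥ* matH c = c := by
  rw [← mulVec_transpose, matH_transpose, matH, fromBlocks_mulVec]
  ext x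
  rcases x with i | ⟨j, i⟩
  · simp [cyclicVec, mulVec_diagonal]
  · simp only [zero_mulVec, zero_add, Sum.elim_inr]
    rw [blockDiagonal'_mulVec, Matrix.mulVec, dotProduct]
    have h0 : 0 < N j := Nat.lt_of_le_of_lt (Nat.zero_le _) i.2
    rw [Finset.sum_eq_single ⟨0, h0⟩]
    · simp [cyclicVec, hankel]
    · intro l _ hl
      have : (l : ℕ) ≠ 0 := fun h => hl (Fin.ext h)
      simp [cyclicVec, this]
    · simp

lemma canonicalMatrix_mulVec_inl (kD : Fin N₁ → ℂ) (kJ : Fin s → ℂ) (v : Idx N₁ N → ℂ)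
    (i : Fin N₁) : (canonicalMatrix kD kJ *ᵥ v) (Sum.inl i) = kD i * v (Sum.inl i) := by
  rw [canonicalMatrix, fromBlocks_mulVec]
  simp [mulVec_diagonal]

lemma canonicalMatrix_mulVec_inr (kD : Fin N₁ → ℂ) (kJ : Fin s → ℂ) {v : Idx N₁ N → ℂ}
    {j : Fin s} {f : ℕ → ℂ} (hf : ∀ l : Fin (N j), v (Sum.inr ⟨j, l⟩) = f l) (i : Fin (N j)) :
    (canonicalMatrix kD kJ *ᵥ v) (Sum.inr ⟨j, i⟩)
      = kJ j * f i + if (i : ℕ) = 0 then 0 else f (i - 1) := by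
  rw [canonicalMatrix, fromBlocks_mulVec]
  simp only [zero_mulVec, zero_add, Sum.elim_inr]
  rw [blockDiagonal'_mulVec]
  simp only [Function.comp_apply, hf]
  exact jordan_mulVec (N j) (kJ j) f i

lemma matG_transpose (kD : Fin N₁ → ℂ) (kJ : Fin s → ℂ) :
    (matG (N := N) kD kJ)ᵀ = matG kD kJ := by
  rw [matG, fromBlocks_transpose, transpose_transpose]
  congr 1
  · ext i l
    simp [add_comm]
  · ext x y
    simp only [transpose_apply, matGJJ, Matrix.of_apply]
    rw [add_comm (y.2 : ℕ), add_comm (kJ y.1), Nat.choose_symm_add]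

/-- The symmetric matrix `G` solves the Sylvester equation of rank one. -/
lemma sylvester_matG (kD : Fin N₁ → ℂ) (kJ : Fin s → ℂ) (hDD : ∀ i l, kD i + kD l ≠ 0)
    (hDJ : ∀ i j, 0 < N j → kD i + kJ j ≠ 0)
    (hJJ : ∀ j j', 0 < N j → 0 < N j' → kJ j + kJ j' ≠ 0) :
    canonicalMatrix (N := N) kD kJ * matG kD kJ + matG kD kJ * (canonicalMatrix kD kJ)ᵀ
      = vecMulVec cyclicVec cyclicVec := by
  have hl : ∀ (A B : Matrix (Idx N₁ N) (Idx N₁ N) ℂ) (x y : Idx N₁ N),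
      (A * B) x y = (A *ᵥ fun z => B z y) x := fun _ _ _ _ => rfl
  have hr : ∀ (A B : Matrix (Idx N₁ N) (Idx N₁ N) ℂ) (x y : Idx N₁ N),
      (B * Aᵀ) x y = (A *ᵥ fun z => B x z) y := by
    intro A B x y
    rw [Matrix.mul_apply, Matrix.mulVec, dotProduct]
    exact Finset.sum_congr rfl fun z _ => mul_comm _ _
  -- The mixed blocks are geometric sequences: `K` times an entry cancels the previous entry
  -- supplied by the subdiagonal of the Jordan block, except in the first place.
  have hg : ∀ K : ℂ, K ≠ 0 → ∀ l : ℕ, K * (-(-1 / K) ^ (l + 1))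
      + (if l = 0 then 0 else -(-1 / K) ^ (l - 1 + 1)) = if l = 0 then 1 else 0 := by
    intro K hK l
    rcases l with _ | l
    · simp; field_simp
    · simp only [Nat.add_sub_cancel, Nat.succ_ne_zero, if_false]
      rw [pow_succ _ (l + 1)]
      field_simp
      ring
  ext x y
  rw [Matrix.add_apply, hl, hr, vecMulVec_apply]
  rcases x with i | ⟨j, i⟩ <;> rcases y with l | ⟨j', l⟩
  · rw [canonicalMatrix_mulVec_inl, canonicalMatrix_mulVec_inl]
    have := hDD i l
    simp only [matG, fromBlocks_apply₁₁, Matrix.of_apply, cyclicVec, Sum.elim_inl]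
    field_simp
  · have hK := hDJ i j' (Nat.lt_of_le_of_lt (Nat.zero_le _) l.2)
    rw [canonicalMatrix_mulVec_inl, canonicalMatrix_mulVec_inr _ _
      (f := fun l => -(-1 / (kD i + kJ j')) ^ (l + 1)) (fun l => rfl)]
    simp only [matG, fromBlocks_apply₁₂, matGDJ, Matrix.of_apply, cyclicVec, Sum.elim_inl,
      Sum.elim_inr, one_mul]
    rw [← hg _ hK l]
    ring
  · have hK := hDJ l j (Nat.lt_of_le_of_lt (Nat.zero_le _) i.2)
    rw [canonicalMatrix_mulVec_inl, canonicalMatrix_mulVec_inr _ _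
      (f := fun i => -(-1 / (kD l + kJ j)) ^ (i + 1)) (fun l => rfl)]
    simp only [matG, fromBlocks_apply₂₁, transpose_apply, matGDJ, Matrix.of_apply, cyclicVec,
      Sum.elim_inl, Sum.elim_inr, mul_one]
    rw [← hg _ hK i]
    ring
  · have hK := hJJ j j' (Nat.lt_of_le_of_lt (Nat.zero_le _) i.2)
      (Nat.lt_of_le_of_lt (Nat.zero_le _) l.2)
    rw [canonicalMatrix_mulVec_inr _ _ (f := fun i => (Nat.choose (i + l) i : ℂ)
        * ((-1) ^ (i + (l : ℕ)) / (kJ j + kJ j') ^ (i + (l : ℕ) + 1))) (fun l => rfl),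
      canonicalMatrix_mulVec_inr _ _ (f := fun l => (Nat.choose (i + l) i : ℂ)
        * ((-1) ^ ((i : ℕ) + l) / (kJ j + kJ j') ^ ((i : ℕ) + l + 1))) (fun l => rfl)]
    simp only [cyclicVec, Sum.elim_inr]
    generalize (i : ℕ) = i
    generalize (l : ℕ) = l
    generalize hKK : kJ j + kJ j' = K at *
    rw [show kJ j' = K - kJ j by rw [← hKK]; ring]
    rcases i with _ | i <;> rcases l with _ | l
    · simp; field_simp; ring
    · simp [pow_succ]; field_simp; ring
    · simp [pow_succ]; field_simp; ring
    -- In the interior the identity is Pascal's rule: the two subdiagonals contribute the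
    -- neighbouring binomials with the opposite sign.
    · simp only [Nat.add_sub_cancel, Nat.succ_ne_zero, if_false, mul_zero]
      rw [show i + 1 + (l + 1) = i + l + 1 + 1 by ring, show i + (l + 1) = i + l + 1 by ring,
        show i + 1 + l = i + l + 1 by ring, Nat.choose_succ_succ (i + l + 1) i]
      push_cast
      rw [pow_succ (-1 : ℂ) (i + l + 1), pow_succ K (i + l + 1 + 1)]
      field_simp
      ring

end Canonical


/-! ### Explicit solutions of the starting set -/

/-- The coordinate functional at `x` is a left eigenvector, so row `x` of `k - Γ` is zero. For a
Jordan block this applies to the first row, which requires the block to be nonempty. -/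
lemma mem_spectrum_of_row {ι : Type} [Fintype ι] [DecidableEq ι] {Γ : Matrix ι ι ℂ} {k : ℂ} {x : ι}
    (h : ∀ v : ι → ℂ, (Γ *ᵥ v) x = k * v x) : k ∈ spectrum ℂ Γ := by
  rw [spectrum.mem_iff]
  intro hu
  have hd := (Matrix.isUnit_iff_isUnit_det _).1 hu
  set A := algebraMap ℂ (Matrix ι ι ℂ) k - Γ with hA
  have h1 : (A *ᵥ (A⁻¹ *ᵥ Pi.single x 1)) x = 1 := by
    rw [mulVec_mulVec, Matrix.mul_nonsing_inv _ hd, one_mulVec, Pi.single_eq_same]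
  have h2 : ∀ v : ι → ℂ, (A *ᵥ v) x = 0 := by
    intro v
    rw [hA, sub_mulVec, Pi.sub_apply, h, Algebra.algebraMap_eq_smul_one, smul_mulVec, one_mulVec,
      Pi.smul_apply, smul_eq_mul, sub_self]
  rw [h2] at h1
  exact zero_ne_one h1

section Canonical

variable {N₁ s : ℕ} {N : Fin s → ℕ}

lemma kD_mem_spectrum (kD : Fin N₁ → ℂ) (kJ : Fin s → ℂ) (i : Fin N₁) :
    kD i ∈ spectrum ℂ (canonicalMatrix (N := N) kD kJ) :=
  mem_spectrum_of_row fun v => canonicalMatrix_mulVec_inl kD kJ v i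

lemma kJ_mem_spectrum (kD : Fin N₁ → ℂ) (kJ : Fin s → ℂ) {j : Fin s} (hj : 0 < N j) :
    kJ j ∈ spectrum ℂ (canonicalMatrix (N := N) kD kJ) :=
  mem_spectrum_of_row (x := Sum.inr ⟨j, ⟨0, hj⟩⟩) fun v => by
    rw [canonicalMatrix_mulVec_inr kD kJ
      (f := fun l => if h : l < N j then v (Sum.inr ⟨j, ⟨l, h⟩⟩) else 0) (fun l => by simp)]
    simp [hj]

lemma InvertibleAt.sub_ne_zero {ι : Type} [Fintype ι] [DecidableEq ι] {Γ : Matrix ι ι ℂ} {p k : ℂ}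
    (hp : InvertibleAt Γ p) (hk : k ∈ spectrum ℂ Γ) : p - k ≠ 0 := by
  intro h
  rw [← sub_eq_zero.1 h, spectrum.mem_iff, Algebra.algebraMap_eq_smul_one] at hk
  exact hk hp.2

lemma InvertibleAt.add_ne_zero {ι : Type} [Fintype ι] [DecidableEq ι] {Γ : Matrix ι ι ℂ} {p k : ℂ}
    (hp : InvertibleAt Γ p) (hk : k ∈ spectrum ℂ Γ) : p + k ≠ 0 := by
  intro h
  rw [eq_neg_of_add_eq_zero_right h, spectrum.mem_iff, Algebra.algebraMap_eq_smul_one, neg_smul,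
    ← neg_add', IsUnit.neg_iff] at hk
  exact hk hp.1

/-- The explicit vector follows a shift under which all plain wave factors are multiplied by
`(p + κ) / (p - κ)`. -/
lemma taylorVec_shift {p : ℂ} {kD : Fin N₁ → ℂ} {kJ : Fin s → ℂ} {f g : Fin N₁ → ℂ}
    {F G : Fin s → ℂ → ℂ} (hfg : ∀ i, (p - kD i) * g i = (p + kD i) * f i)
    (hF : ∀ j, 0 < N j → AnalyticAt ℂ (F j) (kJ j))
    (hG : ∀ j, 0 < N j → AnalyticAt ℂ (G j) (kJ j))
    (hFG : ∀ j, 0 < N j → ∀ᶠ κ in nhds (kJ j), (p - κ) * G j κ = (p + κ) * F j κ) :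
    (p • (1 : Matrix (Idx N₁ N) (Idx N₁ N) ℂ) - canonicalMatrix kD kJ) *ᵥ
        Sum.elim g (fun x => iteratedDeriv x.2 (G x.1) (kJ x.1) / ((x.2 : ℕ)! : ℂ))
      = (p • (1 : Matrix (Idx N₁ N) (Idx N₁ N) ℂ) + canonicalMatrix kD kJ) *ᵥ
        Sum.elim f (fun x => iteratedDeriv x.2 (F x.1) (kJ x.1) / ((x.2 : ℕ)! : ℂ)) := by
  rw [sub_mulVec, add_mulVec, smul_mulVec, smul_mulVec, one_mulVec, one_mulVec]
  ext x
  rw [Pi.sub_apply, Pi.add_apply, Pi.smul_apply, Pi.smul_apply, smul_eq_mul, smul_eq_mul]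
  rcases x with i | ⟨j, i⟩
  · rw [canonicalMatrix_mulVec_inl, canonicalMatrix_mulVec_inl]
    simp only [Sum.elim_inl]
    linear_combination hfg i
  · have hj : 0 < N j := Nat.lt_of_le_of_lt (Nat.zero_le _) i.2
    rw [canonicalMatrix_mulVec_inr kD kJ
        (f := fun l => iteratedDeriv l (G j) (kJ j) / (l ! : ℂ)) (fun l => rfl),
      canonicalMatrix_mulVec_inr kD kJ
        (f := fun l => iteratedDeriv l (F j) (kJ j) / (l ! : ℂ)) (fun l => rfl)]
    exact taylor_shift (hF j hj) (hG j hj) (hFG j hj) i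

lemma eventually_rho {q k : ℂ} {P : ℂ → Prop}
    (hP : ∀ κ, q - κ ≠ 0 → q + κ ≠ 0 → P κ) (h1 : q - k ≠ 0) (h2 : q + k ≠ 0) :
    ∀ᶠ κ in nhds k, P κ := by
  have c1 : ContinuousAt (fun κ : ℂ => q - κ) k := by fun_prop
  have c2 : ContinuousAt (fun κ : ℂ => q + κ) k := by fun_prop
  filter_upwards [c1.eventually_ne h1, c2.eventually_ne h2] with κ h3 h4
  exact hP κ h3 h4

variable {p q : ℂ} {kD : Fin N₁ → ℂ} {kJ : Fin s → ℂ}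

lemma explicitR_shift_n (hp : InvertibleAt (canonicalMatrix (N := N) kD kJ) p)
    (hq : InvertibleAt (canonicalMatrix (N := N) kD kJ) q) (ρD : Fin N₁ → ℂ) (ρJ : Fin s → ℂ)
    (n m : ℤ) :
    (p • (1 : Matrix (Idx N₁ N) (Idx N₁ N) ℂ) - canonicalMatrix kD kJ) *ᵥ
        explicitR p q kD ρD kJ ρJ (n + 1) m
      = (p • (1 : Matrix (Idx N₁ N) (Idx N₁ N) ℂ) + canonicalMatrix kD kJ) *ᵥ
        explicitR p q kD ρD kJ ρJ n m := by
  have hrel : ∀ κ ρ₀ : ℂ, p - κ ≠ 0 → p + κ ≠ 0 →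
      (p - κ) * rho p q κ ρ₀ (n + 1) m = (p + κ) * rho p q κ ρ₀ n m := by
    intro κ ρ₀ h1 h2
    rw [rho_succ_left _ _ _ h1 h2]
    field_simp
  have ha : ∀ n' m' : ℤ, ∀ j, 0 < N j → AnalyticAt ℂ (fun κ => rho p q κ (ρJ j) n' m') (kJ j) := by
    intro n' m' j hj
    have hm := kJ_mem_spectrum kD kJ hj
    exact analyticAt_rho _ _ _ (hp.sub_ne_zero hm) (hp.add_ne_zero hm) (hq.sub_ne_zero hm)
      (hq.add_ne_zero hm)
  exact taylorVec_shift (f := fun i => rho p q (kD i) (ρD i) n m)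
    (g := fun i => rho p q (kD i) (ρD i) (n + 1) m) (F := fun j κ => rho p q κ (ρJ j) n m)
    (G := fun j κ => rho p q κ (ρJ j) (n + 1) m)
    (fun i => hrel _ _ (hp.sub_ne_zero (kD_mem_spectrum _ _ i))
      (hp.add_ne_zero (kD_mem_spectrum _ _ i)))
    (ha _ _) (ha _ _)
    (fun j hj => eventually_rho (fun κ h1 h2 => hrel κ _ h1 h2)
      (hp.sub_ne_zero (kJ_mem_spectrum kD kJ hj)) (hp.add_ne_zero (kJ_mem_spectrum kD kJ hj)))

lemma explicitR_shift_m (hp : InvertibleAt (canonicalMatrix (N := N) kD kJ) p)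
    (hq : InvertibleAt (canonicalMatrix (N := N) kD kJ) q) (ρD : Fin N₁ → ℂ) (ρJ : Fin s → ℂ)
    (n m : ℤ) :
    (q • (1 : Matrix (Idx N₁ N) (Idx N₁ N) ℂ) - canonicalMatrix kD kJ) *ᵥ
        explicitR p q kD ρD kJ ρJ n (m + 1)
      = (q • (1 : Matrix (Idx N₁ N) (Idx N₁ N) ℂ) + canonicalMatrix kD kJ) *ᵥ
        explicitR p q kD ρD kJ ρJ n m := by
  have hrel : ∀ κ ρ₀ : ℂ, q - κ ≠ 0 → q + κ ≠ 0 →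
      (q - κ) * rho p q κ ρ₀ n (m + 1) = (q + κ) * rho p q κ ρ₀ n m := by
    intro κ ρ₀ h1 h2
    rw [rho_succ_right _ _ _ h1 h2]
    field_simp
  have ha : ∀ n' m' : ℤ, ∀ j, 0 < N j → AnalyticAt ℂ (fun κ => rho p q κ (ρJ j) n' m') (kJ j) := by
    intro n' m' j hj
    have hm := kJ_mem_spectrum kD kJ hj
    exact analyticAt_rho _ _ _ (hp.sub_ne_zero hm) (hp.add_ne_zero hm) (hq.sub_ne_zero hm)
      (hq.add_ne_zero hm)
  exact taylorVec_shift (f := fun i => rho p q (kD i) (ρD i) n m)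
    (g := fun i => rho p q (kD i) (ρD i) n (m + 1)) (F := fun j κ => rho p q κ (ρJ j) n m)
    (G := fun j κ => rho p q κ (ρJ j) n (m + 1))
    (fun i => hrel _ _ (hq.sub_ne_zero (kD_mem_spectrum _ _ i))
      (hq.add_ne_zero (kD_mem_spectrum _ _ i)))
    (ha _ _) (ha _ _)
    (fun j hj => eventually_rho (fun κ h1 h2 => hrel κ _ h1 h2)
      (hq.sub_ne_zero (kJ_mem_spectrum kD kJ hj)) (hq.add_ne_zero (kJ_mem_spectrum kD kJ hj)))

/-- Every matrix `F` commuting with `Γ` gives a solution `F G H` of the Sylvester equation. -/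
lemma sylvester_mul_matG {F : Matrix (Idx N₁ N) (Idx N₁ N) ℂ} (c : Idx N₁ N → ℂ)
    (hk : ∀ x ∈ spectrum ℂ (canonicalMatrix (N := N) kD kJ),
      ∀ y ∈ spectrum ℂ (canonicalMatrix (N := N) kD kJ), x + y ≠ 0)
    (hF : Commute (canonicalMatrix kD kJ) F) :
    F * matG kD kJ * matH c * canonicalMatrix kD kJ
        + canonicalMatrix kD kJ * (F * matG kD kJ * matH c)
      = vecMulVec (F *ᵥ cyclicVec) c := by
  have hG := sylvester_matG (N := N) kD kJ
    (fun i l => hk _ (kD_mem_spectrum kD kJ i) _ (kD_mem_spectrum kD kJ l))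
    (fun i j hj => hk _ (kD_mem_spectrum kD kJ i) _ (kJ_mem_spectrum kD kJ hj))
    (fun j j' hj hj' => hk _ (kJ_mem_spectrum kD kJ hj) _ (kJ_mem_spectrum kD kJ hj'))
  have hH : matH c * canonicalMatrix kD kJ = (canonicalMatrix kD kJ)ᵀ * matH c := by
    rw [canonicalMatrix_eq, matH_mul_blockToeplitz]
  generalize canonicalMatrix (N := N) kD kJ = Γ at *
  generalize matG (N := N) kD kJ = G at *
  calc F * G * matH c * Γ + Γ * (F * G * matH c)
      = F * G * (matH c * Γ) + (Γ * F) * G * matH c := by simp only [mul_assoc]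
    _ = F * (Γ * G + G * Γᵀ) * matH c := by
        rw [hH, hF.eq]; noncomm_ring
    _ = vecMulVec (F *ᵥ cyclicVec) c := by
        rw [hG, mul_vecMulVec, vecMulVec_mul, cyclicVec_vecMul_matH]

/-- Since `𝒜` commutes with `Γ` it passes through both shift equations. In the Sylvester equation `𝒜
F` simply takes the place of `F`. -/
lemma startingSet_explicit (hp : InvertibleAt (canonicalMatrix (N := N) kD kJ) p)
    (hq : InvertibleAt (canonicalMatrix (N := N) kD kJ) q) (c : Idx N₁ N → ℂ)
    (hk : ∀ x ∈ spectrum ℂ (canonicalMatrix (N := N) kD kJ),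
      ∀ y ∈ spectrum ℂ (canonicalMatrix (N := N) kD kJ), x + y ≠ 0)
    (ρD : Fin N₁ → ℂ) (ρJ : Fin s → ℂ) (α : Fin s → ℕ → ℂ) :
    StartingSet p q (canonicalMatrix kD kJ) c
      (fun n m => (matA α).mulVec (explicitR p q kD ρD kJ ρJ n m))
      (fun n m => matA α * explicitM p q kD ρD kJ ρJ c n m) := by
  have hA : Commute (canonicalMatrix (N := N) kD kJ) (matA α) := by
    rw [canonicalMatrix_eq, matA_eq]; exact blockToeplitz_commute _ _ _ _
  have hm : ∀ t : ℂ, Commute (t • (1 : Matrix (Idx N₁ N) (Idx N₁ N) ℂ) - canonicalMatrix kD kJ)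
      (matA α) := fun t => ((Commute.one_left _).smul_left t).sub_left hA
  have hpl : ∀ t : ℂ, Commute (t • (1 : Matrix (Idx N₁ N) (Idx N₁ N) ℂ) + canonicalMatrix kD kJ)
      (matA α) := fun t => ((Commute.one_left _).smul_left t).add_left hA
  refine ⟨fun n m => ?_, fun n m => ?_, fun n m => ?_⟩
  · rw [mulVec_mulVec, mulVec_mulVec, (hm p).eq, (hpl p).eq, ← mulVec_mulVec, ← mulVec_mulVec,
      explicitR_shift_n hp hq]
  · rw [mulVec_mulVec, mulVec_mulVec, (hm q).eq, (hpl q).eq, ← mulVec_mulVec, ← mulVec_mulVec,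
      explicitR_shift_m hp hq]
  · have hF : Commute (canonicalMatrix (N := N) kD kJ) (matF p q kD ρD kJ ρJ n m) := by
      rw [canonicalMatrix_eq]; exact blockToeplitz_commute _ _ _ _
    have h := sylvester_mul_matG c hk (hA.mul_right hF)
    have hr : matF p q kD ρD kJ ρJ n m *ᵥ cyclicVec = explicitR (N := N) p q kD ρD kJ ρJ n m :=
      blockToeplitz_mulVec_cyclicVec _ _
    rw [← mulVec_mulVec, hr] at h
    rw [← h]
    simp only [explicitM, mul_assoc]

/-- The bracket is symmetric for every solution of the Sylvester equation. -/
lemma br_symm_of_sylvester {c r : Idx N₁ N → ℂ} {M : Matrix (Idx N₁ N) (Idx N₁ N) ℂ}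
    (hk : ∀ x ∈ spectrum ℂ (canonicalMatrix (N := N) kD kJ),
      ∀ y ∈ spectrum ℂ (canonicalMatrix (N := N) kD kJ), x + y ≠ 0)
    (hM : M * canonicalMatrix kD kJ + canonicalMatrix kD kJ * M = vecMulVec r c)
    (hu : IsUnit (1 + M)) (X Y : Matrix (Idx N₁ N) (Idx N₁ N) ℂ)
    (hX : IsFun (canonicalMatrix kD kJ) X) (hY : IsFun (canonicalMatrix kD kJ) Y) :
    br c r M X Y = br c r M Y X := by
  -- An arbitrary `r` is turned into a matrix commuting with `Γ` whose action on the cyclic vector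
  -- gives `r`. Then `M` and `F G H` solve the same Sylvester equation and coincide by uniqueness,
  -- so `br_symm` applies. Zero is only padding beyond the block size.
  set F : Matrix (Idx N₁ N) (Idx N₁ N) ℂ := blockToeplitz (fun i => r (Sum.inl i))
    (fun j l => if h : l < N j then r (Sum.inr ⟨j, ⟨l, h⟩⟩) else 0) with hFdef
  have hF : Commute (canonicalMatrix kD kJ) F := by
    rw [canonicalMatrix_eq]; exact blockToeplitz_commute _ _ _ _
  have hr : F *ᵥ cyclicVec = r := by
    rw [hFdef, blockToeplitz_mulVec_cyclicVec]
    ext x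
    rcases x with i | ⟨j, i⟩ <;> simp
  have h := sylvester_mul_matG c hk hF
  rw [hr, ← hM] at h
  have hMF : M = F * matG kD kJ * matH c := by
    rw [← sub_eq_zero]
    apply sylvester_unique hk
    rw [sub_mul, mul_sub, ← sub_eq_zero.2 h.symm]
    abel
  exact br_symm hr.symm (cyclicVec_vecMul_matH c).symm hMF hF
    (by rw [canonicalMatrix_eq, matH_mul_blockToeplitz]) (matH_mul_blockToeplitz _ _ _)
    (matH_transpose c) (matG_transpose kD kJ) hu hX hY

lemma squareRel_of_startingSet {c : Idx N₁ N → ℂ} {r : ℤ → ℤ → Idx N₁ N → ℂ}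
    {M : ℤ → ℤ → Matrix (Idx N₁ N) (Idx N₁ N) ℂ}
    (hk : ∀ x ∈ spectrum ℂ (canonicalMatrix (N := N) kD kJ),
      ∀ y ∈ spectrum ℂ (canonicalMatrix (N := N) kD kJ), x + y ≠ 0)
    (h : StartingSet p q (canonicalMatrix kD kJ) c r M) {n m : ℤ} (h00 : IsUnit (1 + M n m))
    (h10 : IsUnit (1 + M (n + 1) m)) (h01 : IsUnit (1 + M n (m + 1)))
    (h11 : IsUnit (1 + M (n + 1) (m + 1))) :
    SquareRel (fun a => IsUnit (a • (1 : Matrix (Idx N₁ N) (Idx N₁ N) ℂ) + canonicalMatrix kD kJ))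
      p q (vertexOf (canonicalMatrix kD kJ) c (r n m) (M n m))
      (vertexOf (canonicalMatrix kD kJ) c (r (n + 1) m) (M (n + 1) m))
      (vertexOf (canonicalMatrix kD kJ) c (r n (m + 1)) (M n (m + 1)))
      (vertexOf (canonicalMatrix kD kJ) c (r (n + 1) (m + 1)) (M (n + 1) (m + 1))) := by
  have hs := fun n m hu X Y hX hY => br_symm_of_sylvester hk (h.sylvester n m) hu X Y hX hY
  exact ⟨edgeRel_vertexOf hk (h.shift_n n m) (h.sylvester _ _) (h.sylvester _ _) h00 h10
      (hs _ _ h00) (hs _ _ h10),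
    edgeRel_vertexOf hk (h.shift_m n m) (h.sylvester _ _) (h.sylvester _ _) h00 h01
      (hs _ _ h00) (hs _ _ h01),
    edgeRel_vertexOf hk (h.shift_m (n + 1) m) (h.sylvester _ _) (h.sylvester _ _) h10 h11
      (hs _ _ h10) (hs _ _ h11),
    edgeRel_vertexOf hk (h.shift_n n (m + 1)) (h.sylvester _ _) (h.sylvester _ _) h01 h11
      (hs _ _ h01) (hs _ _ h11)⟩

end Canonical


/-! ### Shifts of the background functions -/

section Background

variable {p q : ℂ}

lemma zeta_succ_left (ζ₀ : ℂ) (n m : ℤ) : zeta p q ζ₀ (n + 1) m = zeta p q ζ₀ n m + p := by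
  unfold zeta; push_cast; ring

lemma zeta_succ_right (ζ₀ : ℂ) (n m : ℤ) : zeta p q ζ₀ n (m + 1) = zeta p q ζ₀ n m + q := by
  unfold zeta; push_cast; ring

lemma nu_succ_left (ν₀ : ℂ) (n m : ℤ) : nu p q ν₀ (n + 1) m = nu p q ν₀ n m + 1 / p := by
  unfold nu; push_cast; ring

lemma nu_succ_right (ν₀ : ℂ) (n m : ℤ) : nu p q ν₀ n (m + 1) = nu p q ν₀ n m + 1 / q := by
  unfold nu; push_cast; ring

lemma xi_succ_left (a ξ₀ : ℂ) (n m : ℤ) :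
    xi p q a ξ₀ (n + 1) m = xi p q a ξ₀ n m + 2 * a * p / (a ^ 2 - p ^ 2) := by
  unfold xi; push_cast; ring

lemma xi_succ_right (a ξ₀ : ℂ) (n m : ℤ) :
    xi p q a ξ₀ n (m + 1) = xi p q a ξ₀ n m + 2 * a * q / (a ^ 2 - q ^ 2) := by
  unfold xi; push_cast; ring

lemma sign_succ_left (n m : ℤ) : (-1 : ℂ) ^ (n + 1 + m) = -(-1) ^ (n + m) := by
  rw [add_right_comm, zpow_add_one₀ (by norm_num)]; ring

lemma sign_succ_right (n m : ℤ) : (-1 : ℂ) ^ (n + (m + 1)) = -(-1) ^ (n + m) := by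
  rw [← add_assoc, zpow_add_one₀ (by norm_num)]; ring

lemma sign_sq (k : ℤ) : ((-1 : ℂ) ^ k) ^ 2 = 1 := by
  rw [sq, ← mul_zpow]; norm_num

lemma rho_mul_rho_neg {a ρ₀ : ℂ} (hpa : p ^ 2 ≠ a ^ 2) (hqa : q ^ 2 ≠ a ^ 2) (h0 : ρ₀ ≠ 0)
    (n m : ℤ) : rho p q a ρ₀ n m * rho p q (-a) ρ₀⁻¹ n m = 1 := by
  have h : ∀ {p : ℂ}, p ^ 2 ≠ a ^ 2 → (p + a) / (p - a) * ((p + -a) / (p - -a)) = 1 := by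
    intro p hp
    have h1 := sub_ne_zero_of_sq_ne hp
    have h2 := add_ne_zero_of_sq_ne hp
    rw [sub_neg_eq_add, ← sub_eq_add_neg]
    field_simp
  calc rho p q a ρ₀ n m * rho p q (-a) ρ₀⁻¹ n m
      = ((p + a) / (p - a) * ((p + -a) / (p - -a))) ^ n
        * ((q + a) / (q - a) * ((q + -a) / (q - -a))) ^ m * (ρ₀ * ρ₀⁻¹) := by
        rw [mul_zpow, mul_zpow]; unfold rho; ring
    _ = 1 := by rw [h hpa, h hqa, mul_inv_cancel₀ h0, _root_.one_zpow, _root_.one_zpow, one_mul,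
        one_mul]

lemma rho_neg_succ_left {a : ℂ} (hpa : p ^ 2 ≠ a ^ 2) (ρ₀ : ℂ) (n m : ℤ) :
    rho p q (-a) ρ₀ (n + 1) m = (p - a) / (p + a) * rho p q (-a) ρ₀ n m := by
  have h1 := sub_ne_zero_of_sq_ne hpa
  have h2 := add_ne_zero_of_sq_ne hpa
  rw [rho_succ_left ρ₀ n m (by rwa [sub_neg_eq_add]) (by rwa [← sub_eq_add_neg]), sub_neg_eq_add,
    ← sub_eq_add_neg]

lemma rho_neg_succ_right {a : ℂ} (hqa : q ^ 2 ≠ a ^ 2) (ρ₀ : ℂ) (n m : ℤ) :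
    rho p q (-a) ρ₀ n (m + 1) = (q - a) / (q + a) * rho p q (-a) ρ₀ n m := by
  have h1 := sub_ne_zero_of_sq_ne hqa
  have h2 := add_ne_zero_of_sq_ne hqa
  rw [rho_succ_right ρ₀ n m (by rwa [sub_neg_eq_add]) (by rwa [← sub_eq_add_neg]), sub_neg_eq_add,
    ← sub_eq_add_neg]

lemma vartheta_succ_left {a P : ℂ} (h : P / (a - p) ≠ 0) (Q ϑ₀ : ℂ) (n m : ℤ) :
    vartheta p q a P Q ϑ₀ (n + 1) m = P / (a - p) * vartheta p q a P Q ϑ₀ n m := by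
  unfold vartheta; rw [zpow_add_one₀ h]; ring

lemma vartheta_succ_right {a Q : ℂ} (h : Q / (a - q) ≠ 0) (P ϑ₀ : ℂ) (n m : ℤ) :
    vartheta p q a P Q ϑ₀ n (m + 1) = Q / (a - q) * vartheta p q a P Q ϑ₀ n m := by
  unfold vartheta; rw [zpow_add_one₀ h]; ring

/-- The exponential prefactor of `Gab`. -/
noncomputable def expGab (p q P Q a b : ℂ) (n m : ℤ) : ℂ :=
  (P / ((p - a) * (p - b))) ^ n * (Q / ((q - a) * (q - b))) ^ m

lemma factor_mul_factor_neg {a b P : ℂ} (hpa : p ^ 2 ≠ a ^ 2) (hpb : p ^ 2 ≠ b ^ 2)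
    (hP : P ^ 2 = (p ^ 2 - a ^ 2) * (p ^ 2 - b ^ 2)) :
    P / ((p - a) * (p - b)) * (P / ((p - -a) * (p - -b))) = 1 := by
  have h1 := sub_ne_zero_of_sq_ne hpa
  have h2 := add_ne_zero_of_sq_ne hpa
  have h3 := sub_ne_zero_of_sq_ne hpb
  have h4 := add_ne_zero_of_sq_ne hpb
  rw [sub_neg_eq_add, sub_neg_eq_add]
  field_simp
  linear_combination hP

/-- The equations for `P²` and `Q²` make the base factors for `(a, b)` and `(-a, -b)` reciprocal.
This gives the normalisations `E₁ E₄ = 1` and, after `b ↦ -b`, `E₂ E₃ = 1` in `eqQ3`. -/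
lemma expGab_mul_neg {a b P Q : ℂ} (hpa : p ^ 2 ≠ a ^ 2) (hpb : p ^ 2 ≠ b ^ 2)
    (hqa : q ^ 2 ≠ a ^ 2) (hqb : q ^ 2 ≠ b ^ 2) (hP : P ^ 2 = (p ^ 2 - a ^ 2) * (p ^ 2 - b ^ 2))
    (hQ : Q ^ 2 = (q ^ 2 - a ^ 2) * (q ^ 2 - b ^ 2)) (n m : ℤ) :
    expGab p q P Q a b n m * expGab p q P Q (-a) (-b) n m = 1 := by
  calc expGab p q P Q a b n m * expGab p q P Q (-a) (-b) n m
      = (P / ((p - a) * (p - b)) * (P / ((p - -a) * (p - -b)))) ^ n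
        * (Q / ((q - a) * (q - b)) * (Q / ((q - -a) * (q - -b)))) ^ m := by
        rw [mul_zpow, mul_zpow]; unfold expGab; ring
    _ = 1 := by
        rw [factor_mul_factor_neg hpa hpb hP, factor_mul_factor_neg hqa hqb hQ, _root_.one_zpow,
          _root_.one_zpow, one_mul]

lemma expGab_succ_left {a b P : ℂ} (hpa : p ^ 2 ≠ a ^ 2) (hpb : p ^ 2 ≠ b ^ 2)
    (hP : P ^ 2 = (p ^ 2 - a ^ 2) * (p ^ 2 - b ^ 2)) (Q : ℂ) (n m : ℤ) :
    expGab p q P Q a b (n + 1) m = P / ((p - a) * (p - b)) * expGab p q P Q a b n m := by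
  have h := left_ne_zero_of_mul_eq_one (factor_mul_factor_neg hpa hpb hP)
  unfold expGab; rw [zpow_add_one₀ h]; ring

lemma expGab_succ_right {a b Q : ℂ} (hqa : q ^ 2 ≠ a ^ 2) (hqb : q ^ 2 ≠ b ^ 2)
    (hQ : Q ^ 2 = (q ^ 2 - a ^ 2) * (q ^ 2 - b ^ 2)) (P : ℂ) (n m : ℤ) :
    expGab p q P Q a b n (m + 1) = Q / ((q - a) * (q - b)) * expGab p q P Q a b n m := by
  have h := left_ne_zero_of_mul_eq_one (factor_mul_factor_neg hqa hqb hQ)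
  unfold expGab; rw [zpow_add_one₀ h]; ring

end Background

/-! ### The solution formulae in terms of the vertex data -/

section VertexData

variable {ι : Type} [Fintype ι] [DecidableEq ι]

lemma InvertibleAt.neg {Γ : Matrix ι ι ℂ} {a : ℂ} (h : InvertibleAt Γ a) :
    IsUnit ((-a) • (1 : Matrix ι ι ℂ) + Γ) := by
  rw [neg_smul, neg_add_eq_sub, ← neg_sub, IsUnit.neg_iff]
  exact h.2

variable (Γ : Matrix ι ι ℂ) (c : ι → ℂ) (r : ℤ → ℤ → ι → ℂ) (M : ℤ → ℤ → Matrix ι ι ℂ) (n m : ℤ)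

lemma Va_eq (a : ℂ) : Va Γ c r M a n m = (vertexOf Γ c (r n m) (M n m)).V a := by
  simp [Va, vertexOf, br, res]

lemma Sij_zero_zero : Sij Γ c r M 0 0 n m = (vertexOf Γ c (r n m) (M n m)).S0 := by
  simp [Sij, vertexOf, br]

lemma Sij_zero_one : Sij Γ c r M 0 1 n m = (vertexOf Γ c (r n m) (M n m)).T0 := by
  simp [Sij, vertexOf, br]

lemma Sij_neg_one_neg_one :
    Sij Γ c r M (-1) (-1) n m = (vertexOf Γ c (r n m) (M n m)).S 0 0 := by
  simp [Sij, vertexOf, br, res, Matrix.zpow_neg_one]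

lemma Sij_neg_one_neg_two :
    Sij Γ c r M (-1) (-2) n m = (vertexOf Γ c (r n m) (M n m)).Z 0 0 := by
  have h : Γ ^ (-2 : ℤ) = Γ⁻¹ ^ 2 := by
    rw [Matrix.inv_pow']
    exact Matrix.zpow_neg_natCast Γ 2
  simp [Sij, vertexOf, br, res, Matrix.zpow_neg_one, h]

lemma Gab_eq (p q P Q a b : ℂ) :
    Gab Γ c r M p q P Q a b n m
      = expGab p q P Q a b n m * (1 - (a + b) * (vertexOf Γ c (r n m) (M n m)).S a b) := rfl

end VertexData

/-! ### Validity of the solution formulae -/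

section Solutions

variable {N₁ s : ℕ} {N : Fin s → ℕ} {p q : ℂ} {kD : Fin N₁ → ℂ} {kJ : Fin s → ℂ}
  {c : Idx N₁ N → ℂ} {r : ℤ → ℤ → Idx N₁ N → ℂ} {M : ℤ → ℤ → Matrix (Idx N₁ N) (Idx N₁ N) ℂ}

lemma formulaeValid
    (hk : ∀ x ∈ spectrum ℂ (canonicalMatrix (N := N) kD kJ),
      ∀ y ∈ spectrum ℂ (canonicalMatrix (N := N) kD kJ), x + y ≠ 0)
    (h : StartingSet p q (canonicalMatrix kD kJ) c r M) :
    FormulaeValid (canonicalMatrix kD kJ) c r M p q := by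
  have hsq := fun {n m : ℤ} h00 h10 h01 h11 =>
    squareRel_of_startingSet (n := n) (m := m) hk h h00 h10 h01 h11
  -- The case `k = k'` of the spectral condition excludes the eigenvalue `0`, so `0` is an
  -- admissible parameter; Q1 with linear background is evaluated there.
  have h0 : IsUnit ((0 : ℂ) • (1 : Matrix (Idx N₁ N) (Idx N₁ N) ℂ) + canonicalMatrix kD kJ) := by
    rw [zero_smul, zero_add, ← spectrum.zero_notMem_iff ℂ]
    exact fun hz => hk 0 hz 0 hz (add_zero 0)
  generalize canonicalMatrix (N := N) kD kJ = Γ at *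
  constructor
  · intro a b P Q δ A B C D ha hb a0 b0 hpa hpb hqa hqb hP hQ hδ n m h00 h10 h01 h11
    have hpa' : p ^ 2 ≠ (-a) ^ 2 := by rwa [neg_sq]
    have hpb' : p ^ 2 ≠ (-b) ^ 2 := by rwa [neg_sq]
    have hqa' : q ^ 2 ≠ (-a) ^ 2 := by rwa [neg_sq]
    have hqb' : q ^ 2 ≠ (-b) ^ 2 := by rwa [neg_sq]
    have hE := expGab_mul_neg hpa hpb' hqa hqb' (P := P) (Q := Q) (by rwa [neg_sq])
      (by rwa [neg_sq]) n m
    rw [neg_neg] at hE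
    have l1 := fun m => expGab_succ_left (q := q) hpa hpb hP Q n m
    have l2 := fun m => expGab_succ_left (q := q) hpa hpb' (P := P) (by rwa [neg_sq]) Q n m
    have l3 := fun m => expGab_succ_left (q := q) hpa' hpb (P := P) (by rwa [neg_sq]) Q n m
    have l4 := fun m => expGab_succ_left (q := q) hpa' hpb' (P := P)
      (by rwa [neg_sq, neg_sq]) Q n m
    have r1 := expGab_succ_right (p := p) hqa hqb hQ P n m
    have r2 := expGab_succ_right (p := p) hqa hqb' (Q := Q) (by rwa [neg_sq]) P n m
    have r3 := expGab_succ_right (p := p) hqa' hqb (Q := Q) (by rwa [neg_sq]) P n m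
    have r4 := expGab_succ_right (p := p) hqa' hqb' (Q := Q) (by rwa [neg_sq, neg_sq]) P n m
    refine (hsq h00 h10 h01 h11).eqQ3 ha.1 ha.neg hb.1 hb.neg a0 b0 hpa hpb hqa hqb hP hQ
      (expGab_mul_neg hpa hpb hqa hqb hP hQ n m) hE hδ rfl ?_ ?_ ?_
    all_goals simp only [uQ3, Gab_eq, l1, l2, l3, l4, r1, r2, r3, r4]
  · intro a ξ₀ ρ₀ A D ha a0 hpa hqa hρ n m h00 h10 h01 h11
    have l := fun m => rho_succ_left (q := q) ρ₀ n m (sub_ne_zero_of_sq_ne hpa)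
      (add_ne_zero_of_sq_ne hpa)
    have r := fun n => rho_succ_right (p := p) ρ₀ n m (sub_ne_zero_of_sq_ne hqa)
      (add_ne_zero_of_sq_ne hqa)
    have h := (hsq h00 h10 h01 h11).eqQ2 ha.1 ha.neg a0 hpa hqa (xi p q a ξ₀ n m) A D
      (rho_mul_rho_neg hpa hqa hρ n m)
    rw [← l, ← r, ← r, ← rho_neg_succ_left hpa, ← rho_neg_succ_right hqa, ← rho_neg_succ_right hqa,
      ← xi_succ_left, ← xi_succ_right, ← xi_succ_right] at h
    exact h
  · intro a δ ξ₀ ρ₀ A B D ha hpa hqa hρ hδ n m h00 h10 h01 h11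
    have l := fun m => rho_succ_left (q := q) ρ₀ n m (sub_ne_zero_of_sq_ne hpa)
      (add_ne_zero_of_sq_ne hpa)
    have r := fun n => rho_succ_right (p := p) ρ₀ n m (sub_ne_zero_of_sq_ne hqa)
      (add_ne_zero_of_sq_ne hqa)
    have h := (hsq h00 h10 h01 h11).eqQ1 ha.1 ha.neg hpa hqa (xi p q a ξ₀ n m) A B D
      (rho_mul_rho_neg hpa hqa hρ n m) hδ
    rw [← l, ← r, ← r, ← rho_neg_succ_left hpa, ← rho_neg_succ_right hqa, ← rho_neg_succ_right hqa,
      ← xi_succ_left, ← xi_succ_right, ← xi_succ_right] at h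
    exact h
  · intro δ ν₀ A c₀ hp hq n m h00 h10 h01 h11
    have h := (hsq h00 h10 h01 h11).eqQ1Lin h0 hp hq δ A c₀ (nu p q ν₀ n m)
    rw [← nu_succ_left, ← nu_succ_right, ← nu_succ_right] at h
    simpa only [uQ1Lin, Sij_neg_one_neg_one, Sij_neg_one_neg_two] using h
  · intro a P Q δ ϑ₀ A B C D ha a0 hpa hqa hP hQ hϑ hAD n m h00 h10 h01 h11
    have key : ∀ {p P : ℂ}, p ^ 2 ≠ a ^ 2 → P ^ 2 = a ^ 2 - p ^ 2 →
        P / (a - p) * (P / (a + p)) = 1 := by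
      intro p P hpa hP
      have h1 : a - p ≠ 0 := sub_ne_zero_of_sq_ne hpa.symm
      have h2 : a + p ≠ 0 := add_ne_zero_of_sq_ne hpa.symm
      field_simp
      linear_combination hP
    have hp0 := left_ne_zero_of_mul_eq_one (key hpa hP)
    have hq0 := left_ne_zero_of_mul_eq_one (key hqa hQ)
    have hθ0 : vartheta p q a P Q ϑ₀ n m ≠ 0 :=
      mul_ne_zero (mul_ne_zero (zpow_ne_zero _ hp0) (zpow_ne_zero _ hq0)) hϑ
    have hP' : P / (a + p) = (P / (a - p))⁻¹ := eq_inv_of_mul_eq_one_right (key hpa hP)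
    have hQ' : Q / (a + q) = (Q / (a - q))⁻¹ := eq_inv_of_mul_eq_one_right (key hqa hQ)
    have h := (hsq h00 h10 h01 h11).eqH3 ha.1 ha.neg a0 hpa hqa hP hQ (A := A) (B := B) (C := C)
      (D := D) (mul_inv_cancel₀ hθ0) (sign_sq (n + m)) hAD
    rw [hP', hQ', ← mul_inv, ← mul_inv, ← mul_inv, ← mul_inv, mul_assoc (P / (a - p)),
      ← vartheta_succ_right hq0, ← vartheta_succ_left hp0, ← vartheta_succ_left hp0] at h
    simpa only [uH3, Va_eq, sign_succ_left, sign_succ_right, neg_neg] using h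
  · intro ζ₀ A c₀ n m h00 h10 h01 h11
    have h := (hsq h00 h10 h01 h11).eqH2 (zeta (2 * p) (2 * q) ζ₀ n m) c₀ A _ (sign_sq (n + m))
    rw [← zeta_succ_left, ← zeta_succ_right, ← zeta_succ_right] at h
    simpa only [uH2, Sij_zero_zero, Sij_zero_one, sign_succ_left, sign_succ_right, neg_neg] using h
  · intro ζ₀ A B c₀ hAB n m h00 h10 h01 h11
    have h := (hsq h00 h10 h01 h11).eqH1 (zeta p q ζ₀ n m) c₀ A B _ (sign_sq (n + m)) hAB
    rw [← zeta_succ_left, ← zeta_succ_right, ← zeta_succ_right] at h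
    simpa only [uH1, Sij_zero_zero, sign_succ_left, sign_succ_right, neg_neg] using h

end Solutions

end CauchyABS

/-- The solution formulae are valid for every solution of the starting set, and the explicit pairs
`(𝒜 r, 𝒜 F G H)` are such solutions. -/
theorem mainTheorem5 (N₁ s : ℕ) (N : Fin s → ℕ) (kD : Fin N₁ → ℂ) (kJ : Fin s → ℂ)
    (c : CauchyABS.Idx N₁ N → ℂ) (p q : ℂ)
    (Γ : Matrix (CauchyABS.Idx N₁ N) (CauchyABS.Idx N₁ N) ℂ)
    (hΓ : Γ = CauchyABS.canonicalMatrix kD kJ)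
    (hp : CauchyABS.InvertibleAt Γ p) (hq : CauchyABS.InvertibleAt Γ q)
    (hk : ∀ x ∈ spectrum ℂ Γ, ∀ y ∈ spectrum ℂ Γ, x + y ≠ 0) :
    (∀ (r : ℤ → ℤ → CauchyABS.Idx N₁ N → ℂ)
        (M : ℤ → ℤ → Matrix (CauchyABS.Idx N₁ N) (CauchyABS.Idx N₁ N) ℂ),
        CauchyABS.StartingSet p q Γ c r M → CauchyABS.FormulaeValid Γ c r M p q) ∧
    (∀ (ρD : Fin N₁ → ℂ) (ρJ : Fin s → ℂ) (α : Fin s → ℕ → ℂ),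
        CauchyABS.StartingSet p q Γ c
          (fun n m => (CauchyABS.matA α).mulVec (CauchyABS.explicitR p q kD ρD kJ ρJ n m))
          (fun n m => CauchyABS.matA α * CauchyABS.explicitM p q kD ρD kJ ρJ c n m)) := by
  subst hΓ
  exact ⟨fun _ _ h => CauchyABS.formulaeValid hk h,
    fun ρD ρJ α => CauchyABS.startingSet_explicit hp hq c hk ρD ρJ α⟩
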